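/- \textbf{Setting.} Let $q\in\mathbb{Z}$, $q>6$. Let $\widehat{\mathbb{C}}=\mathbb{C}\cup\{\infty\}$ be the Riemann sphere, $\mathbb{D}=\{z\in\mathbb{C}: |z|<1\}$, $\ell_1=\mathbb{R}$ and $\ell_3=\{te^{i\pi/q}: t\in\mathbb{R}\}$. Let $t_q,s_q>0$ be the unique numbers such that the circle $\ell_2=\{z:|z-t_qe^{i\pi/q}|=s_q\}$ is orthogonal to $\partial\mathbb{D}$ and intersects $\ell_1$ with angle $\pi/3$, and let $r_q\in(0,1)$ be the unique number such that $\ell_4=\{z:|z|=r_q\}$ intersects $\ell_2$ with angle $\pi/3$. Let $G_q$ be the group of transformations of $\widehat{\mathbb{C}}$ generated by the inversions (reflections) in $\ell_1,\ell_2,\ell_3,\ell_4$, and let $\partial_\infty G_q$ be its limit set, i.e. the smallest non-empty closed $G_q$-invariant subset of $\widehat{\mathbb{C}}$. Let $\mathcal{G}$ be the set of all (orientation preserving or reversing) Möbius transformations $g$ of $\widehat{\mathbb{C}}$ with $g^{-1}(\infty)\in\widehat{\mathbb{C}}\setminus\overline{\mathbb{D}}$. For $g\in\mathcal{G}$ put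 $$\mathscr{D}_g=\{g\tau(\widehat{\mathbb{C}}\setminus\overline{\mathbb{D}}):\tau\in G_q\}\setminus\{g(\widehat{\mathbb{C}}\setminus\overline{\mathbb{D}})\},\qquad K_g=g(\mathbb{D}\cap\partial_\infty G_q),$$ let $\mathcal{C}_g$ be the space of compactly supported Lipschitz functions $u:K_g\to\mathbb{R}$ (for the Euclidean distance), and define $$\mu^g=\sum_{D\in\mathscr{D}_g}\mathrm{rad}(D)\,\mathscr{H}^1_{\partial D}(\cdot\cap\partial D),\qquad \mathcal{E}^g(u,v)=\sum_{D\in\mathscr{D}_g}\int_{\partial D}\langle\nabla_{\partial D}u,\nabla_{\partial D}v\rangle\,\mathrm{rad}(D)\,d\mathscr{H}^1_{\partial D}\quad(u,v\in\mathcal{C}_g),$$ where $\mathscr{H}^1_{\partial D}$ is the length measure and $\nabla_{\partial D}$ the gradient along the circle $\partial D$. \textbf{Proposition.} Let $g\in\mathcal{G}$. These objects are well defined: every $D\in\mathscr{D}_g$ is an open disk in $\mathbb{C}$ with $\partial D\subset K_g$, $K_g$ is locally compact, $\mu^g$ is a finite Borel measure on $K_g$ which is positive on every non-empty open subset of $K_g$,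 and for $u,v\in\mathcal{C}_g$ the integrals and the sum defining $\mathcal{E}^g(u,v)$ converge absolutely. The form $(\mathcal{E}^g,\mathcal{C}_g)$ is closable in $L^2(K_g,\mu^g)$, and its smallest closed extension $(\mathcal{E}^g,\mathcal{F}_g)$ in $L^2(K_g,\mu^g)$ is a strongly local, regular symmetric Dirichlet form on $L^2(K_g,\mu^g)$. Further, the inclusion map $\mathcal{F}_g\hookrightarrow L^2(K_g,\mu^g)$ is a compact linear operator under the norm $\|u\|_{\mathcal{F}_g}=\bigl(\mathcal{E}^g(u,u)+\int_{K_g}u^2\,d\mu^g\bigr)^{1/2}$ on $\mathcal{F}_g$. -/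

import Mathlib

open MeasureTheory Filter Set Topology
open scoped ENNReal NNReal Real ComplexConjugate

noncomputable section

/-! ## Symmetric Dirichlet forms on `L²(X, μ)` -/

namespace DirichletForm

/-- A symmetric form on `L²(X, μ)`: a nonnegative definite symmetric bilinear form
defined on a dense linear subspace. -/
structure SymmForm {X : Type*} [MeasurableSpace X] (μ : Measure X) where
  dom : Submodule ℝ (Lp ℝ 2 μ)
  form : dom →ₗ[ℝ] dom →ₗ[ℝ] ℝ
  dense : Dense (dom : Set (Lp ℝ 2 μ))
  symm : ∀ f g : dom, form f g = form g f
  nonneg : ∀ f : dom, 0 ≤ form f f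

variable {X : Type*} [MeasurableSpace X] {μ : Measure X}

/-- The square `𝓔(f, f) + ‖f‖²_{L²}` of the form norm `‖f‖_𝓕`. -/
def SymmForm.normSq (𝓔 : SymmForm μ) (f : 𝓔.dom) : ℝ :=
  𝓔.form f f + ‖(f : Lp ℝ 2 μ)‖ ^ 2

/-- Closedness: the domain is complete with respect to the form norm. -/
def SymmForm.IsClosedForm (𝓔 : SymmForm μ) : Prop :=
  ∀ f : ℕ → 𝓔.dom,
    (∀ ε : ℝ, 0 < ε → ∃ N : ℕ, ∀ m n : ℕ, N ≤ m → N ≤ n → 𝓔.normSq (f m - f n) < ε) →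
    ∃ h : 𝓔.dom, Tendsto (fun n => 𝓔.normSq (f n - h)) atTop (𝓝 0)

/-- `𝓔'` extends `𝓔`. -/
def SymmForm.IsExtendedBy (𝓔 𝓔' : SymmForm μ) : Prop :=
  ∃ h : 𝓔.dom ≤ 𝓔'.dom, ∀ f g : 𝓔.dom,
    𝓔'.form (Submodule.inclusion h f) (Submodule.inclusion h g) = 𝓔.form f g

/-- `𝓔` extends the form `E`, which is given on a linear space `C` of genuine functions:
the class of every `u ∈ C` lies in the domain, and the two forms agree on such classes. -/
def SymmForm.Extends (𝓔 : SymmForm μ) (C : Submodule ℝ (X → ℝ))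
    (E : (X → ℝ) → (X → ℝ) → ℝ) : Prop :=
  (∀ u ∈ C, ∃ f : 𝓔.dom, ((f : Lp ℝ 2 μ) : X → ℝ) =ᵐ[μ] u) ∧
    ∀ u ∈ C, ∀ v ∈ C, ∀ f g : 𝓔.dom,
      ((f : Lp ℝ 2 μ) : X → ℝ) =ᵐ[μ] u → ((g : Lp ℝ 2 μ) : X → ℝ) =ᵐ[μ] v →
        𝓔.form f g = E u v

/-- `𝓔` is the smallest closed extension in `L²(X, μ)` of `(E, C)`. -/
def SymmForm.IsSmallestClosedExtension (𝓔 : SymmForm μ) (C : Submodule ℝ (X → ℝ))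
    (E : (X → ℝ) → (X → ℝ) → ℝ) : Prop :=
  𝓔.IsClosedForm ∧ 𝓔.Extends C E ∧
    ∀ 𝓔' : SymmForm μ, 𝓔'.IsClosedForm → 𝓔'.Extends C E → 𝓔.IsExtendedBy 𝓔'

/-- Closability in `L²(X, μ)` of a form `E` on a linear space `C` of functions. Constant
sequences show that this contains that `E` depends only on `μ`-a.e. classes. -/
def Closable (μ : Measure X) (C : Submodule ℝ (X → ℝ)) (E : (X → ℝ) → (X → ℝ) → ℝ) : Prop :=
  (∀ u ∈ C, MemLp u 2 μ) ∧
    ∀ u : ℕ → X → ℝ, (∀ n, u n ∈ C) →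
      (∀ ε : ℝ, 0 < ε → ∃ N : ℕ, ∀ m n : ℕ, N ≤ m → N ≤ n → E (u m - u n) (u m - u n) < ε) →
      Tendsto (fun n => eLpNorm (u n) 2 μ) atTop (𝓝 0) →
      Tendsto (fun n => E (u n) (u n)) atTop (𝓝 0)

/-- The Markov property: the unit contraction operates on the form. -/
def SymmForm.IsMarkovian (𝓔 : SymmForm μ) : Prop :=
  ∀ (f : 𝓔.dom) (h : Lp ℝ 2 μ),
    ((h : X → ℝ) =ᵐ[μ] fun x => min (max ((f : Lp ℝ 2 μ) x) 0) 1) →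
      ∃ hh : h ∈ 𝓔.dom, 𝓔.form ⟨h, hh⟩ ⟨h, hh⟩ ≤ 𝓔.form f f

/-- A symmetric Dirichlet form: a closed Markovian symmetric form. -/
def SymmForm.IsDirichlet (𝓔 : SymmForm μ) : Prop :=
  𝓔.IsClosedForm ∧ 𝓔.IsMarkovian

/-- Compactness of the inclusion `𝓕 ↪ L²(X, μ)`: the image of the closed unit ball of the
form norm is relatively compact. -/
def SymmForm.HasCompactInclusion (𝓔 : SymmForm μ) : Prop :=
  IsCompact (closure ((fun f : 𝓔.dom => (f : Lp ℝ 2 μ)) '' {f | 𝓔.normSq f ≤ 1}))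

variable [TopologicalSpace X]

/-- Regularity: `𝓕 ∩ C_c(X)` is dense in `𝓕` with respect to the form norm and in `C_c(X)`
with respect to the uniform norm. -/
def SymmForm.IsRegular (𝓔 : SymmForm μ) : Prop :=
  (∀ f : 𝓔.dom, ∀ ε : ℝ, 0 < ε → ∃ (h : 𝓔.dom) (w : X → ℝ), Continuous w ∧
    HasCompactSupport w ∧ ((h : Lp ℝ 2 μ) : X → ℝ) =ᵐ[μ] w ∧ 𝓔.normSq (f - h) < ε) ∧
  (∀ w : X → ℝ, Continuous w → HasCompactSupport w → ∀ ε : ℝ, 0 < ε →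
    ∃ (h : 𝓔.dom) (w' : X → ℝ), Continuous w' ∧ HasCompactSupport w' ∧
      ((h : Lp ℝ 2 μ) : X → ℝ) =ᵐ[μ] w' ∧ ∀ x, |w x - w' x| < ε)

/-- The support of an `L²`-class: the complement of the largest open set
on which it vanishes almost everywhere. -/
def lpSupport (f : Lp ℝ 2 μ) : Set X :=
  {x | ∀ U ∈ 𝓝 x, μ {y | y ∈ U ∧ f y ≠ 0} ≠ 0}

/-- Strong locality: `𝓔(f, g) = 0` whenever `f, g ∈ 𝓕` have compact supports and `g` is
constant (a.e.) on a neighbourhood of the support of `f`. -/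
def SymmForm.IsStronglyLocal (𝓔 : SymmForm μ) : Prop :=
  ∀ f g : 𝓔.dom, IsCompact (lpSupport (f : Lp ℝ 2 μ)) → IsCompact (lpSupport (g : Lp ℝ 2 μ)) →
    (∃ (U : Set X) (c : ℝ), IsOpen U ∧ lpSupport (f : Lp ℝ 2 μ) ⊆ U ∧
      ∀ᵐ x ∂μ, x ∈ U → (g : Lp ℝ 2 μ) x = c) →
    𝓔.form f g = 0

end DirichletForm

/-! ## The reflection groups, their limit sets and the round carpets -/

namespace RoundCarpet

/-- Complex conjugation on the Riemann sphere `OnePoint ℂ`, with `∞ ↦ ∞`. -/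
def sphereConj : OnePoint ℂ → OnePoint ℂ := OnePoint.map (fun z => conj z)

/-- Möbius transformations of the Riemann sphere, orientation preserving or reversing:
`z ↦ (az + b)/(cz + d)` or `z ↦ (a z̄ + b)/(c z̄ + d)` with `ad - bc ≠ 0`. -/
def IsMobius (f : Equiv.Perm (OnePoint ℂ)) : Prop :=
  ∃ A : GL (Fin 2) ℂ, (∀ z, f z = A • z) ∨ (∀ z, f z = A • sphereConj z)

/-- Inversion in the circle with centre `c` and radius `s`. -/
def circleInvFun (c : ℂ) (s : ℝ) : OnePoint ℂ → OnePoint ℂ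
  | none => ((c : ℂ) : OnePoint ℂ)
  | some z => if z = c then OnePoint.infty else ((c + (s : ℂ) ^ 2 / conj (z - c) : ℂ) : OnePoint ℂ)

theorem circleInvFun_involutive (c : ℂ) {s : ℝ} (hs : 0 < s) :
    Function.Involutive (circleInvFun c s) := by
  have hs' : (s : ℂ) ≠ 0 := by exact_mod_cast hs.ne'
  intro z
  induction z using OnePoint.rec with
  | infty =>
    change circleInvFun c s (some c) = _
    simp [circleInvFun]
  | coe z =>
    change circleInvFun c s (circleInvFun c s (some z)) = some z
    by_cases hz : z = c
    · subst hz
      simp only [circleInvFun, if_true]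
      rfl
    · have h1 : z - c ≠ 0 := sub_ne_zero.mpr hz
      have h2 : conj (z - c) ≠ 0 := (map_ne_zero (starRingEnd ℂ)).mpr h1
      have h3 : (c + (s : ℂ) ^ 2 / conj (z - c) : ℂ) ≠ c := by
        intro h
        have : (s : ℂ) ^ 2 / conj (z - c) = 0 := by simpa using h
        exact (div_ne_zero (pow_ne_zero 2 hs') h2) this
      simp only [circleInvFun, if_neg hz]
      change circleInvFun c s (some (c + (s : ℂ) ^ 2 / conj (z - c))) = some z
      simp only [circleInvFun, if_neg h3]
      change some _ = some z
      congr 1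
      have h4 : conj (c + (s : ℂ) ^ 2 / conj (z - c) - c) = (s : ℂ) ^ 2 / (z - c) := by
        simp
      rw [h4]
      field_simp
      ring

/-- Inversion in the circle `|z - c| = s` as a bijection of the sphere
(a junk value for nonpositive radii, which do not occur). -/
def circleInv (c : ℂ) (s : ℝ) : Equiv.Perm (OnePoint ℂ) :=
  if hs : 0 < s then (circleInvFun_involutive c hs).toPerm else 1

/-- `z ↦ e^{2iα} z̄`: reflection in the line `{t e^{iα} | t ∈ ℝ}`. -/
def lineReflFun (α : ℝ) : OnePoint ℂ → OnePoint ℂ :=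
  OnePoint.map (fun z => Complex.exp (2 * α * Complex.I) * conj z)

theorem lineReflFun_involutive (α : ℝ) : Function.Involutive (lineReflFun α) := by
  intro z
  induction z using OnePoint.rec with
  | infty => rfl
  | coe z =>
    simp only [lineReflFun, OnePoint.map_some, map_mul, Complex.conj_conj, ← Complex.exp_conj]
    rw [← mul_assoc, ← Complex.exp_add]
    simp [Complex.conj_ofNat]

/-- Reflection in the line `{t e^{iα} | t ∈ ℝ}` as a bijection of the sphere. -/
def lineRefl (α : ℝ) : Equiv.Perm (OnePoint ℂ) := (lineReflFun_involutive α).toPerm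

/-- The number `t_q`: the circle `ℓ₂` has centre `t_q e^{iπ/q}`. -/
def tPar (q : ℕ) : ℝ := 1 / √(1 - 4 * Real.sin (π / q) ^ 2)

/-- The radius `s_q` of the circle `ℓ₂`. -/
def sPar (q : ℕ) : ℝ := 2 * Real.sin (π / q) / √(1 - 4 * Real.sin (π / q) ^ 2)

/-- The radius `r_q` of the circle `ℓ₄` with centre `0`. -/
def rPar (q : ℕ) : ℝ := (√(sPar q ^ 2 + 4) - sPar q) / 2

/-- The centre `t_q e^{iπ/q}` of `ℓ₂`. -/
def centre₂ (q : ℕ) : ℂ := tPar q * Complex.exp ((π / q : ℝ) * Complex.I)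

/-- The circles `|z - c₁| = r₁` and `|z - c₂| = r₂` intersect with angle `θ ∈ [0, π/2]`: at a
common point their normal lines form the angle `θ`. -/
def CirclesMeetAt (c₁ : ℂ) (r₁ : ℝ) (c₂ : ℂ) (r₂ : ℝ) (θ : ℝ) : Prop :=
  ∃ p : ℂ, ‖p - c₁‖ = r₁ ∧ ‖p - c₂‖ = r₂ ∧ |inner ℝ (p - c₁) (p - c₂)| = r₁ * r₂ * Real.cos θ

/-- The circle `|z - c| = s` intersects the real line with angle `θ ∈ [0, π/2]`. -/
def MeetsRealLineAt (c : ℂ) (s : ℝ) (θ : ℝ) : Prop :=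
  ∃ p : ℂ, p.im = 0 ∧ ‖p - c‖ = s ∧ |inner ℝ (p - c) Complex.I| = s * Real.cos θ

theorem circlesMeetAt_iff {c₁ c₂ : ℂ} {r₁ r₂ : ℝ} (hc : c₁ ≠ c₂) (h₁ : 0 < r₁) (h₂ : 0 < r₂)
    (θ : ℝ) : CirclesMeetAt c₁ r₁ c₂ r₂ θ ↔
      |r₁ ^ 2 + r₂ ^ 2 - ‖c₁ - c₂‖ ^ 2| = 2 * (r₁ * r₂ * Real.cos θ) := by
  have key : ∀ p : ℂ, ‖p - c₁‖ = r₁ → ‖p - c₂‖ = r₂ →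
      r₁ ^ 2 + r₂ ^ 2 - ‖c₁ - c₂‖ ^ 2 = 2 * inner ℝ (p - c₁) (p - c₂) := by
    intro p hp₁ hp₂
    have h := norm_sub_sq_real (p - c₁) (p - c₂)
    have e : p - c₁ - (p - c₂) = -(c₁ - c₂) := by ring
    rw [e, norm_neg, hp₁, hp₂] at h
    linarith
  constructor
  · rintro ⟨p, hp₁, hp₂, hp⟩
    rw [key p hp₁ hp₂, abs_mul, hp]
    norm_num
  · intro h
    have hd : 0 < ‖c₁ - c₂‖ := norm_pos_iff.mpr (sub_ne_zero.mpr hc)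
    set d := ‖c₁ - c₂‖ with hdd
    set a := (r₁ ^ 2 - r₂ ^ 2 + d ^ 2) / (2 * d) with ha
    have hda : 2 * d * a = r₁ ^ 2 - r₂ ^ 2 + d ^ 2 := by
      rw [ha]; field_simp
    have hb : 0 ≤ r₁ ^ 2 - a ^ 2 := by
      have h1 : |r₁ ^ 2 + r₂ ^ 2 - d ^ 2| ≤ 2 * (r₁ * r₂) := by
        rw [h]
        have := mul_le_mul_of_nonneg_left (Real.cos_le_one θ) (mul_pos h₁ h₂).le
        linarith
      have h2 : (r₁ ^ 2 + r₂ ^ 2 - d ^ 2) ^ 2 ≤ (2 * (r₁ * r₂)) ^ 2 :=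
        sq_le_sq' (by linarith [neg_abs_le (r₁ ^ 2 + r₂ ^ 2 - d ^ 2)])
          (le_trans (le_abs_self _) h1)
      have h3 : 0 ≤ 4 * d ^ 2 * (r₁ ^ 2 - a ^ 2) := by
        have : 4 * d ^ 2 * (r₁ ^ 2 - a ^ 2) = 4 * d ^ 2 * r₁ ^ 2 - (2 * d * a) ^ 2 := by ring
        rw [this, hda]
        nlinarith
      by_contra hneg
      push Not at hneg
      have : 4 * d ^ 2 * (r₁ ^ 2 - a ^ 2) < 0 := mul_neg_of_pos_of_neg (by positivity) hneg
      linarith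
    set b := √(r₁ ^ 2 - a ^ 2) with hbb
    have hb2 : b ^ 2 = r₁ ^ 2 - a ^ 2 := Real.sq_sqrt hb
    set e : ℂ := (c₂ - c₁) / d with he
    have hdc : (d : ℂ) ≠ 0 := by exact_mod_cast hd.ne'
    have he1 : ‖e‖ = 1 := by
      rw [he, norm_div, norm_sub_rev, ← hdd]
      simp [abs_of_pos hd, hd.ne']
    have hed : e * d = c₂ - c₁ := by rw [he]; field_simp
    have n1 : ‖c₁ + e * ⟨a, b⟩ - c₁‖ = r₁ := by
      rw [add_sub_cancel_left, norm_mul, he1, one_mul]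
      have : ‖(⟨a, b⟩ : ℂ)‖ ^ 2 = r₁ ^ 2 := by
        rw [← Complex.normSq_eq_norm_sq, Complex.normSq_mk]
        linarith [hb2]
      exact (pow_left_inj₀ (norm_nonneg _) h₁.le two_ne_zero).mp this
    have n2 : ‖c₁ + e * ⟨a, b⟩ - c₂‖ = r₂ := by
      have e2 : c₁ + e * ⟨a, b⟩ - c₂ = e * ⟨a - d, b⟩ := by
        have : (⟨a - d, b⟩ : ℂ) = ⟨a, b⟩ - d := by
          apply Complex.ext <;> simp
        rw [this, mul_sub, hed]; ring
      rw [e2, norm_mul, he1, one_mul]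
      have : ‖(⟨a - d, b⟩ : ℂ)‖ ^ 2 = r₂ ^ 2 := by
        rw [← Complex.normSq_eq_norm_sq, Complex.normSq_mk]
        nlinarith [hb2, hda]
      exact (pow_left_inj₀ (norm_nonneg _) h₂.le two_ne_zero).mp this
    refine ⟨_, n1, n2, ?_⟩
    rw [key _ n1 n2, abs_mul, abs_two] at h
    linarith

theorem meetsRealLineAt_iff {c : ℂ} {s : ℝ} (hs : 0 < s) (θ : ℝ) :
    MeetsRealLineAt c s θ ↔ |c.im| = s * Real.cos θ := by
  constructor
  · rintro ⟨p, hp, -, h⟩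
    simpa [Complex.inner, hp] using h
  · intro h
    have h1 : c.im ^ 2 ≤ s ^ 2 := by
      apply sq_le_sq'
      · have := mul_le_mul_of_nonneg_left (Real.cos_le_one θ) hs.le
        linarith [neg_abs_le c.im]
      · have := mul_le_mul_of_nonneg_left (Real.cos_le_one θ) hs.le
        linarith [le_abs_self c.im]
    refine ⟨⟨c.re + √(s ^ 2 - c.im ^ 2), 0⟩, rfl, ?_, ?_⟩
    · rw [← pow_left_inj₀ (norm_nonneg _) hs.le two_ne_zero, ← Complex.normSq_eq_norm_sq,
        Complex.normSq_apply]
      have := Real.sq_sqrt (sub_nonneg.mpr h1)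
      simp only [Complex.sub_re, Complex.sub_im]
      nlinarith
    · simpa [Complex.inner] using h

theorem four_sin_sq_lt {q : ℕ} (hq : 6 < q) :
    0 < Real.sin (π / q) ∧ 4 * Real.sin (π / q) ^ 2 < 1 := by
  have hq' : (6 : ℝ) < q := by exact_mod_cast hq
  have h1 : 0 < π / q := div_pos Real.pi_pos (by linarith)
  have h2 : π / q < π / 6 := div_lt_div_of_pos_left Real.pi_pos (by norm_num) hq'
  have h3 : 0 < Real.sin (π / q) :=
    Real.sin_pos_of_pos_of_lt_pi h1 (by linarith [Real.pi_pos])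
  have h4 : Real.sin (π / q) < 1 / 2 := by
    rw [← Real.sin_pi_div_six]
    exact Real.sin_lt_sin_of_lt_of_le_pi_div_two (by linarith [Real.pi_pos])
      (by linarith [Real.pi_pos]) h2
  exact ⟨h3, by nlinarith⟩

theorem par_pos {q : ℕ} (hq : 6 < q) :
    0 < tPar q ∧ 0 < sPar q ∧ 0 < rPar q ∧ rPar q < 1 := by
  obtain ⟨h1, h2⟩ := four_sin_sq_lt hq
  have h3 : 0 < √(1 - 4 * Real.sin (π / q) ^ 2) := Real.sqrt_pos.mpr (by linarith)
  have hs : 0 < sPar q := by unfold sPar; positivity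
  refine ⟨by unfold tPar; positivity, hs, ?_, ?_⟩
  · have : sPar q < √(sPar q ^ 2 + 4) := Real.lt_sqrt_of_sq_lt (by linarith)
    unfold rPar; linarith
  · have : √(sPar q ^ 2 + 4) < sPar q + 2 := by
      rw [Real.sqrt_lt' (by linarith)]; nlinarith
    unfold rPar; linarith

/-- The numbers above are the only positive ones, with `r_q < 1`, for which `ℓ₂` is orthogonal to
the unit circle and intersects the real line `ℓ₁` as well as `ℓ₄` with angle `π/3`. -/
theorem par_characterization {q : ℕ} (hq : 6 < q) {t s r : ℝ} (ht : 0 < t) (hs : 0 < s)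
    (hr : 0 < r) (hr1 : r < 1) :
    (CirclesMeetAt (t * Complex.exp ((π / q : ℝ) * Complex.I)) s 0 1 (π / 2) ∧
      MeetsRealLineAt (t * Complex.exp ((π / q : ℝ) * Complex.I)) s (π / 3) ∧
      CirclesMeetAt 0 r (t * Complex.exp ((π / q : ℝ) * Complex.I)) s (π / 3)) ↔
    t = tPar q ∧ s = sPar q ∧ r = rPar q := by
  obtain ⟨hσ, hσ2⟩ := four_sin_sq_lt hq
  have hc : (t * Complex.exp ((π / q : ℝ) * Complex.I) : ℂ) ≠ 0 :=
    mul_ne_zero (by exact_mod_cast ht.ne') (Complex.exp_ne_zero _)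
  have hn : ‖(t * Complex.exp ((π / q : ℝ) * Complex.I) : ℂ)‖ = t := by
    rw [norm_mul, Complex.norm_exp_ofReal_mul_I, mul_one, Complex.norm_real, Real.norm_eq_abs,
      abs_of_pos ht]
  have him : (t * Complex.exp ((π / q : ℝ) * Complex.I) : ℂ).im = t * Real.sin (π / q) := by
    rw [Complex.im_ofReal_mul, Complex.exp_ofReal_mul_I_im]
  rw [circlesMeetAt_iff hc hs one_pos, meetsRealLineAt_iff hs, circlesMeetAt_iff hc.symm hr hs,
    sub_zero, zero_sub, norm_neg, hn, him, Real.cos_pi_div_two, Real.cos_pi_div_three,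
    abs_of_pos (mul_pos ht hσ)]
  unfold rPar
  set σ := Real.sin (π / q) with hσd
  set w := √(1 - 4 * σ ^ 2) with hw
  have hw0 : 0 < w := Real.sqrt_pos.mpr (by linarith)
  have hw2 : w ^ 2 = 1 - 4 * σ ^ 2 := Real.sq_sqrt (by linarith)
  have htq : tPar q = 1 / w := rfl
  have hsq : sPar q = 2 * σ / w := rfl
  set z := √(sPar q ^ 2 + 4) with hz
  have hz2 : z ^ 2 = sPar q ^ 2 + 4 := Real.sq_sqrt (by positivity)
  have hz0 : 0 ≤ z := Real.sqrt_nonneg _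
  constructor
  · rintro ⟨h1, h2, h3⟩
    have h1' : s ^ 2 + 1 ^ 2 - t ^ 2 = 0 := by simpa using h1
    have hs2 : s = 2 * (t * σ) := by linarith
    have htw : t * w = 1 := by
      have : (t * w) ^ 2 = 1 ^ 2 := by
        rw [mul_pow, hw2]; subst hs2; nlinarith
      exact (pow_left_inj₀ (mul_pos ht hw0).le one_pos.le two_ne_zero).mp this
    have et : t = tPar q := by rw [htq]; field_simp; linarith
    have es : s = sPar q := by
      rw [hsq, hs2, et, htq]; ring
    refine ⟨et, es, ?_⟩
    rw [← es] at hz2 ⊢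
    have h5 : r ^ 2 + s ^ 2 - t ^ 2 = r ^ 2 - 1 := by linarith
    rw [h5, abs_of_neg (by nlinarith)] at h3
    have : (2 * r + s) ^ 2 = z ^ 2 := by rw [hz2]; nlinarith
    have := (pow_left_inj₀ (by positivity) hz0 two_ne_zero).mp this
    linarith
  · rintro ⟨et, es, er⟩
    have e1 : s ^ 2 + 1 - t ^ 2 = 0 := by
      rw [et, es, htq, hsq]; field_simp; nlinarith
    refine ⟨by simpa using e1, by rw [et, es, htq, hsq]; ring, ?_⟩
    rw [← es] at hz2 er
    have h5 : r ^ 2 + s ^ 2 - t ^ 2 = r ^ 2 - 1 := by linarith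
    rw [h5, abs_of_neg (by nlinarith)]
    have : z = 2 * r + s := by linarith
    rw [this] at hz2
    nlinarith

/-- The group `G_q` generated by the inversions in `ℓ₁ = ℝ`, `ℓ₂`, `ℓ₃ = ℝ e^{iπ/q}`
and `ℓ₄`. -/
def groupG (q : ℕ) : Subgroup (Equiv.Perm (OnePoint ℂ)) :=
  Subgroup.closure
    {lineRefl 0, circleInv (centre₂ q) (sPar q), lineRefl (π / q), circleInv 0 (rPar q)}

/-- The limit set: the smallest nonempty closed invariant subset of the sphere. -/
def limitSet (G : Subgroup (Equiv.Perm (OnePoint ℂ))) : Set (OnePoint ℂ) :=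
  ⋂₀ {A | IsClosed A ∧ A.Nonempty ∧ ∀ τ ∈ G, τ '' A ⊆ A}

/-- The open unit disk `𝔻`, as a subset of the sphere. -/
def unitDisk : Set (OnePoint ℂ) := (fun z : ℂ => (z : OnePoint ℂ)) '' Metric.ball 0 1

/-- The closed unit disk, as a subset of the sphere. -/
def closedUnitDisk : Set (OnePoint ℂ) :=
  (fun z : ℂ => (z : OnePoint ℂ)) '' Metric.closedBall 0 1

/-- The set `𝓖` of Möbius transformations `g` such that `g⁻¹(∞)` is outside the closed
unit disk. -/
def shapes : Set (Equiv.Perm (OnePoint ℂ)) :=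
  {g | IsMobius g ∧ g.symm OnePoint.infty ∉ closedUnitDisk}

/-- The family `𝓓_g` of disks. -/
def diskFamily (q : ℕ) (g : Equiv.Perm (OnePoint ℂ)) : Set (Set (OnePoint ℂ)) :=
  {D | ∃ τ ∈ groupG q, D = (fun z => g (τ z)) '' closedUnitDiskᶜ} \ {g '' closedUnitDiskᶜ}

/-- Centres and radii `(c, R)` of the disks in `𝓓_g`. -/
def diskParams (q : ℕ) (g : Equiv.Perm (OnePoint ℂ)) : Set (ℂ × ℝ) :=
  {p | 0 < p.2 ∧ (fun z : ℂ => (z : OnePoint ℂ)) '' Metric.ball p.1 p.2 ∈ diskFamily q g}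

/-- The carpet piece `K_g = g(𝔻 ∩ ∂_∞G_q)`, a subset of `ℂ`. -/
def carpet (q : ℕ) (g : Equiv.Perm (OnePoint ℂ)) : Set ℂ :=
  {z | (z : OnePoint ℂ) ∈ g '' (unitDisk ∩ limitSet (groupG q))}

/-- The length measure of the circle `|z - c| = R`, i.e. the image of `R dθ`, as a measure
on `ℂ`. -/
def circleLength (c : ℂ) (R : ℝ) : Measure ℂ :=
  ENNReal.ofReal R • (volume.restrict (Ioc 0 (2 * π))).map (circleMap c R)

/-- The measure `μ^g = ∑_D rad(D) 𝓗¹_{∂D}` on `K_g`. -/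
def carpetMeasure (q : ℕ) (g : Equiv.Perm (OnePoint ℂ)) : Measure (carpet q g) :=
  (Measure.sum fun p : diskParams q g =>
    ENNReal.ofReal p.1.2 • circleLength p.1.1 p.1.2).comap Subtype.val

/-- The gradient along the circle `|z - c| = R` of `u` at the point `x` of this circle: the
derivative with respect to arc length, times the unit tangent vector `i (x - c) / R`. -/
def circleGrad (c : ℂ) (R : ℝ) (u : ℂ → ℝ) (x : ℂ) : ℂ :=
  (deriv (fun φ : ℝ => u (c + (x - c) * Complex.exp (φ * Complex.I))) 0 / R) •
    (Complex.I * (x - c) / R)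

/-- A function on `A ⊆ ℂ`, extended to `ℂ` by `0`. -/
def extendZero {A : Set ℂ} (u : A → ℝ) : ℂ → ℝ := Function.extend Subtype.val u 0

/-- The density `⟨∇_{∂D} u, ∇_{∂D} v⟩ rad(D)` on the boundary of `D = {|z - c| < R}`. -/
def energyDensity {A : Set ℂ} (u v : A → ℝ) (c : ℂ) (R : ℝ) (x : ℂ) : ℝ :=
  inner ℝ (circleGrad c R (extendZero u) x) (circleGrad c R (extendZero v) x) * R

/-- The contribution `∫_{∂D} ⟨∇_{∂D} u, ∇_{∂D} v⟩ rad(D) d𝓗¹` of `D = {|z - c| < R}`. -/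
def circleEnergy {A : Set ℂ} (u v : A → ℝ) (c : ℂ) (R : ℝ) : ℝ :=
  ∫ x, energyDensity u v c R x ∂(circleLength c R)

/-- The form `𝓔^g(u, v) = ∑_D ∫_{∂D} ⟨∇_{∂D} u, ∇_{∂D} v⟩ rad(D) d𝓗¹`. -/
def carpetForm (q : ℕ) (g : Equiv.Perm (OnePoint ℂ)) (u v : carpet q g → ℝ) : ℝ :=
  ∑' p : diskParams q g, circleEnergy u v p.1.1 p.1.2

/-- The space `𝓒_g` of compactly supported Lipschitz functions on `K_g`. -/
def lipFunctions (q : ℕ) (g : Equiv.Perm (OnePoint ℂ)) : Submodule ℝ (carpet q g → ℝ) where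
  carrier := {u | HasCompactSupport u ∧ ∃ L : ℝ≥0, LipschitzWith L u}
  zero_mem' := ⟨HasCompactSupport.zero, 0, LipschitzWith.const 0⟩
  add_mem' := by
    rintro u v ⟨hu, L, hL⟩ ⟨hv, M, hM⟩
    exact ⟨hu.add hv, L + M, hL.add hM⟩
  smul_mem' := by
    rintro a u ⟨hu, L, hL⟩
    refine ⟨hu.smul_left (f := fun _ => a), ‖a‖₊ * L, ?_⟩
    exact (lipschitzWith_smul a).comp hL

end RoundCarpet
end

/-! The proof has two independent halves. Hyperbolic geometry shows that the disks of `diskFamily`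
form a packing (`IsDiskPacking`); every analytic assertion is then proved for an arbitrary packing.

Geometry. A circle is a spacelike vector of Lorentz space, a point of the sphere is a lightlike one,
and the sign of their pairing tells on which side the point lies. The normals of ℓ₁, ..., ℓ₄ have
Gram matrix `-cos (π / mᵢⱼ)`, so each element of `G_q` acts as an element of a Coxeter group.
Positivity of roots controls the orbit of `extVec`, which three of the four reflections fix
(`orbit_separated`, `rep_extVec`), and different disks get disjoint closures. Choosing a group
element that almost minimises the distance to a base point moves every hyperbolic point outside the
half spaces over the disks into a bounded region (`exists_bounded_of_outside`). Hence the set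
outside the disks is porous (`exists_near_disk`) and null by Lebesgue density (`volume_outerSet`),
and the circles are dense in the carpet. The same minimisation for the stabiliser of the unit circle
puts this circle, and so all its images, into the limit set (`circle_subset`). Möbius maps act by
Lorentz similarities, which transports everything to `K_g` (`carpet_isDiskPacking`).

Analysis. In the angle parameter the energy is `∑ ∫ u'² dθ` and the measure is `∑ R² dθ`, which is
finite because the disks have finite total area. A member of the closed graph of `u ↦ u'` is, on
each circle, a primitive of its second component (`exists_const`), and the derivative of an
absolutely continuous function vanishes a.e. on level sets (`ae_eq_zero_of_eq_const`). This yields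
closability, strong locality and the Markov property. Minimality and regularity hold because the
domain is the completion of the Lipschitz functions.

Compactness. On finitely many circles bounded energy gives equicontinuity, so finitely many sample
values suffice. The point is that small circles carry uniformly little `L²` mass (`tail_estimate`).
On almost every vertical or horizontal line the disks fill all but a null set, so a Lipschitz
function vanishing at the outer boundary is bounded, somewhere on each circle that the line meets,
by the sum of its oscillations on the circles met. Multiplying the vertical and the horizontal bound
and integrating gives `∑ area · (min v)² ≤ (∑ 2 R osc v)²` (`area_estimate`). For `v = u²` the right
side is controlled by the form norm, and Cauchy–Schwarz makes `∑ R² min u²` small over circles with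
small `∑ R²`. -/

/-! ## Positivity of roots for Coxeter groups acting by reflections -/

namespace CoxeterReflection

variable {ι V : Type*} [AddCommGroup V] [Module ℝ V]

/-- The reflection `v ↦ v - 2 B(a, v) a`. -/
noncomputable def refl (B : V →ₗ[ℝ] V →ₗ[ℝ] ℝ) (a : V) : Module.End ℝ V :=
  LinearMap.id - (2 : ℝ) • (B a).smulRight a

theorem refl_apply (B : V →ₗ[ℝ] V →ₗ[ℝ] ℝ) (a v : V) : refl B a v = v - (2 * B a v) • a := by
  simp [refl, smul_smul]

variable {B : V →ₗ[ℝ] V →ₗ[ℝ] ℝ}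

theorem refl_mul_self (a : V) (ha : B a a = 1) : refl B a * refl B a = 1 := by
  ext v
  simp only [Module.End.mul_apply, refl_apply, map_sub, map_smul, ha,
    Module.End.one_apply]
  module

theorem refl_mul_sq (hB : ∀ u v, B u v = B v u) {a b : V} (ha : B a a = 1) (hb : B b b = 1)
    (hab : B a b = 0) : (refl B a * refl B b) ^ 2 = 1 := by
  have hba : B b a = 0 := hB b a ▸ hab
  ext v
  simp only [pow_two, Module.End.mul_apply, refl_apply, map_sub, map_smul, ha, hb,
    hab, hba, Module.End.one_apply]
  module

theorem refl_mul_cube (hB : ∀ u v, B u v = B v u) {a b : V} (ha : B a a = 1) (hb : B b b = 1)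
    (hab : B a b = -(1 / 2)) : (refl B a * refl B b) ^ 3 = 1 := by
  have hba : B b a = -(1 / 2) := hB b a ▸ hab
  ext v
  simp only [pow_succ, pow_zero, one_mul, Module.End.mul_apply, refl_apply, map_sub, map_smul,
    ha, hb, hab, hba, Module.End.one_apply]
  module

theorem refl_isometry (hB : ∀ u v, B u v = B v u) {a : V} (ha : B a a = 1) (u v : V) :
    B (refl B a u) (refl B a v) = B u v := by
  simp only [refl_apply, map_sub, map_smul, smul_eq_mul, LinearMap.sub_apply,
    LinearMap.smul_apply, ha, hB u a]
  ring

variable {M : CoxeterMatrix ι} {α : ι → V} {W : Type*} [Group W] (cs : CoxeterSystem M W)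
  {ρ : W →* Module.End ℝ V}

/-- In the plane of two simple roots the product of their reflections is a rotation, so the
coefficients obey the recurrence of `sin (kθ)`. The factor `sin θ` on the left avoids a division. -/
theorem sin_smul_alternatingWord (hB : ∀ u v, B u v = B v u) (hα : ∀ i, B (α i) (α i) = 1)
    (hρ : ∀ i, ρ (cs.simple i) = refl B (α i)) {i j : ι} {θ : ℝ}
    (hij : B (α i) (α j) = -Real.cos θ) (k : ℕ) :
    Real.sin θ • ρ (cs.wordProd (CoxeterSystem.alternatingWord i j k)) (α i) =
      if Even k then Real.sin ((k + 1) * θ) • α i + Real.sin (k * θ) • α j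
      else Real.sin (k * θ) • α i + Real.sin ((k + 1) * θ) • α j := by
  have hji : B (α j) (α i) = -Real.cos θ := hB (α i) (α j) ▸ hij
  induction k with
  | zero => simp [CoxeterSystem.alternatingWord]
  | succ k ih =>
    have h2 : Real.sin ((k + 1 + 1) * θ) =
        2 * Real.cos θ * Real.sin ((k + 1) * θ) - Real.sin (k * θ) := by
      have e1 : ((k : ℝ) + 1 + 1) * θ = (k + 1) * θ + θ := by ring
      have e2 : (k : ℝ) * θ = (k + 1) * θ - θ := by ring
      rw [e1, e2, Real.sin_add, Real.sin_sub]; ring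
    rw [CoxeterSystem.alternatingWord_succ', CoxeterSystem.wordProd_cons, map_mul,
      Module.End.mul_apply, ← map_smul, ih, hρ]
    push_cast
    rw [h2]
    by_cases hk : Even k
    · have hk' : ¬ Even (k + 1) := by simpa [Nat.even_add_one] using hk
      simp only [hk, hk', if_true, if_false, refl_apply, map_add, map_smul, hα, hji]
      module
    · have hk' : Even (k + 1) := by simpa [Nat.even_add_one] using hk
      simp only [hk, hk', if_true, if_false, refl_apply, map_add, map_smul, hα, hij]
      module

/-- Tits' theorem: an element `ω` with `ℓ(ω sᵢ) > ℓ(ω)` maps the simple root `αᵢ` to a nonnegative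
combination of simple roots. -/
theorem root_mem_span_of_not_isRightDescent (hB : ∀ u v, B u v = B v u)
    (hα : ∀ i, B (α i) (α i) = 1) (hρ : ∀ i, ρ (cs.simple i) = refl B (α i))
    (hM : ∀ i j, i ≠ j → M i j ≠ 0 ∧ B (α i) (α j) = -Real.cos (π / M i j))
    (ω : W) (i : ι) (hi : ¬ cs.IsRightDescent ω i) :
    ρ ω (α i) ∈ Submodule.span ℝ≥0 (range α) := by
  induction hn : cs.length ω using Nat.strong_induction_on generalizing ω i with
  | _ n ih =>
  subst hn
  by_cases h1 : ω = 1
  · subst h1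
    simpa using Submodule.subset_span (mem_range_self i)
  obtain ⟨j, hj⟩ := cs.exists_rightDescent_of_ne_one h1
  have hji : j ≠ i := by rintro rfl; exact hi hj
  obtain ⟨hm0, hcos⟩ := hM i j hji.symm
  set m := M i j with hm
  set a : ℕ → W := fun k => cs.wordProd (CoxeterSystem.alternatingWord i j k) with ha
  have ha1 : ∀ k, a (k + 1) = cs.simple (if Even k then j else i) * a k := fun k => by
    simp [ha, CoxeterSystem.alternatingWord_succ', CoxeterSystem.wordProd_cons]
  have hlen : ∀ k, cs.length (a k) ≤ k := fun k => by
    simpa using cs.length_wordProd_le (CoxeterSystem.alternatingWord i j k)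
  -- `a k` ends in `s_j`. Its letters are stripped from the right end of `ω` for as long as each one
  -- shortens it; what remains is the shortest representative `v` of the coset of `ω` modulo the
  -- dihedral group of `i` and `j`.
  let P : ℕ → Prop := fun k => cs.length (ω * (a k)⁻¹) + k = cs.length ω
  have hex : ∃ k, ¬ P k := ⟨cs.length ω + 1, by simp only [P]; omega⟩
  classical
  set n0 := Nat.find hex with hn0
  have hnP : ¬ P n0 := Nat.find_spec hex
  have hP : ∀ k, k < n0 → P k := fun k hk => not_not.mp (Nat.find_min hex hk)
  have P0 : P 0 := by simp [P, ha, CoxeterSystem.alternatingWord]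
  have P1 : P 1 := by
    have := cs.isRightDescent_iff.mp hj
    simpa [P, ha, CoxeterSystem.alternatingWord] using this
  have hn2 : 2 ≤ n0 := by
    by_contra hlt
    interval_cases n0
    · exact hnP P0
    · exact hnP P1
  obtain ⟨k, hk⟩ : ∃ k, n0 = k + 1 := ⟨n0 - 1, by omega⟩
  rw [hk] at hnP
  have hPk : P k := hP k (by omega)
  -- Stripping `m` letters is impossible: the longest dihedral word can also be written with last
  -- letter `i`, which would make `i` a right descent of `ω`. Thus both angles `kπ/m` and `(k+1)π/m`
  -- stay in `[0, π]`, where the sine is nonnegative.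
  have hkm : k + 1 ≤ m := by
    by_contra hlt
    have hPm : P m := hP m (by omega)
    have hb : a m = cs.wordProd (CoxeterSystem.alternatingWord j i m) := by
      have := cs.prod_alternatingWord_eq_prod_alternatingWord_sub i j m (by omega)
      simp only [ha]; rw [this]; congr 2; rw [← hm]; omega
    obtain ⟨m', hm'⟩ : ∃ m', m = m' + 1 := ⟨m - 1, by omega⟩
    have hb2 : a m * cs.simple i = a m' := by
      rw [hb, hm', CoxeterSystem.alternatingWord_succ, CoxeterSystem.wordProd_concat]
      simp [ha]
    have : ω * cs.simple i = ω * (a m)⁻¹ * a m' := by rw [← hb2]; group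
    apply hi
    have h3 := cs.length_mul_le (ω * (a m)⁻¹) (a m')
    have h4 := hlen m'
    simp only [P] at hPm
    unfold CoxeterSystem.IsRightDescent
    rw [this]; omega
  obtain ⟨v, hv⟩ : ∃ v, v = ω * (a k)⁻¹ := ⟨_, rfl⟩
  have hvω : ω = v * a k := by simp [hv]
  have hPv : cs.length v + k = cs.length ω := hv ▸ hPk
  have hlt : cs.length v < cs.length ω := by omega
  have hx : ¬ cs.IsRightDescent v (if Even k then j else i) := by
    intro h
    apply hnP
    have := cs.isRightDescent_iff.mp h
    have e : ω * (a (k + 1))⁻¹ = v * cs.simple (if Even k then j else i) := by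
      rw [ha1, hv, mul_inv_rev, CoxeterSystem.inv_simple, mul_assoc]
    simp only [P]
    rw [e]; omega
  have hy : ¬ cs.IsRightDescent v (if Even k then i else j) := by
    intro h
    obtain ⟨k', rfl⟩ : ∃ k', k = k' + 1 := ⟨k - 1, by omega⟩
    have e1 : (if Even (k' + 1) then i else j) = (if Even k' then j else i) := by
      by_cases h : Even k' <;> simp [h, Nat.even_add_one]
    rw [e1] at h
    have h2 := cs.isRightDescent_iff.mp h
    have e : ω = v * cs.simple (if Even k' then j else i) * a k' := by
      nth_rewrite 1 [hvω]
      rw [ha1, mul_assoc]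
    have h3 := cs.length_mul_le (v * cs.simple (if Even k' then j else i)) (a k')
    rw [← e] at h3
    have h4 := hlen k'
    omega
  have hvi : ¬ cs.IsRightDescent v i := by
    by_cases h : Even k
    · simpa [h] using hy
    · simpa [h] using hx
  have hvj : ¬ cs.IsRightDescent v j := by
    by_cases h : Even k
    · simpa [h] using hx
    · simpa [h] using hy
  have hci := ih _ hlt v i hvi rfl
  have hcj := ih _ hlt v j hvj rfl
  have hm2 : 2 ≤ m := by omega
  have hmpos : (0 : ℝ) < m := by exact_mod_cast (by omega : 0 < m)
  have hs : 0 < Real.sin (π / m) := by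
    apply Real.sin_pos_of_pos_of_lt_pi (by positivity)
    rw [div_lt_iff₀ hmpos]
    have : (2 : ℝ) ≤ m := by exact_mod_cast hm2
    nlinarith [Real.pi_pos]
  have hnn : ∀ l : ℕ, l ≤ m → 0 ≤ Real.sin (l * (π / m)) := fun l hl => by
    apply Real.sin_nonneg_of_nonneg_of_le_pi (by positivity)
    rw [mul_div_assoc', div_le_iff₀ hmpos]
    have : (l : ℝ) ≤ m := by exact_mod_cast hl
    nlinarith [Real.pi_pos]
  have key := sin_smul_alternatingWord cs hB hα hρ hcos k
  have hS1 := hnn k (by omega)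
  have hS2 := hnn (k + 1) hkm
  push_cast at hS2
  have comb : ∀ x y : ℝ, 0 ≤ x → 0 ≤ y →
      x • ρ v (α i) + y • ρ v (α j) ∈ Submodule.span ℝ≥0 (range α) := fun x y hx hy => by
    have := add_mem (Submodule.smul_mem _ x.toNNReal hci) (Submodule.smul_mem _ y.toNNReal hcj)
    rwa [NNReal.smul_def, NNReal.smul_def, Real.coe_toNNReal x hx, Real.coe_toNNReal y hy] at this
  have hfin : Real.sin (π / m) • ρ ω (α i) ∈ Submodule.span ℝ≥0 (range α) := by
    rw [hvω, map_mul, Module.End.mul_apply, ← map_smul]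
    change ρ v (Real.sin (π / m) • ρ (cs.wordProd (CoxeterSystem.alternatingWord i j k)) (α i)) ∈ _
    rw [key]
    by_cases h : Even k
    · simp only [h, if_true, map_add, map_smul]; exact comb _ _ hS2 hS1
    · simp only [h, if_false, map_add, map_smul]; exact comb _ _ hS1 hS2
  have := Submodule.smul_mem _ (Real.sin (π / m))⁻¹.toNNReal hfin
  rwa [NNReal.smul_def, Real.coe_toNNReal _ (inv_nonneg.mpr hs.le), smul_smul, inv_mul_cancel₀ hs.ne', one_smul] at this

theorem rho_isometry (hB : ∀ u v, B u v = B v u) (hα : ∀ i, B (α i) (α i) = 1)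
    (hρ : ∀ i, ρ (cs.simple i) = refl B (α i)) (ω : W) (u v : V) :
    B (ρ ω u) (ρ ω v) = B u v := by
  induction ω using cs.simple_induction generalizing u v with
  | simple i => rw [hρ, refl_isometry hB (hα i)]
  | one => simp
  | mul w w' h h' => rw [map_mul, Module.End.mul_apply, Module.End.mul_apply, h, h']

/-- A dominant vector stays on the positive side of the wall of `αᵢ` under all `ω` with
`ℓ(sᵢ ω) > ℓ(ω)`. -/
theorem nonneg_of_not_isLeftDescent (hB : ∀ u v, B u v = B v u)
    (hα : ∀ i, B (α i) (α i) = 1) (hρ : ∀ i, ρ (cs.simple i) = refl B (α i))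
    (hM : ∀ i j, i ≠ j → M i j ≠ 0 ∧ B (α i) (α j) = -Real.cos (π / M i j))
    {v : V} (hv : ∀ i, 0 ≤ B (α i) v) (ω : W) (i : ι) (hi : ¬ cs.IsLeftDescent ω i) :
    0 ≤ B (α i) (ρ ω v) := by
  -- By invariance `ω` moves to the other side of the pairing, where it produces a positive root,
  -- and `v` is dominant.
  have h1 : ρ ω⁻¹ (α i) ∈ Submodule.span ℝ≥0 (range α) :=
    root_mem_span_of_not_isRightDescent cs hB hα hρ hM _ _ (by rwa [cs.isRightDescent_inv_iff])
  have h2 : B (α i) (ρ ω v) = B (ρ ω⁻¹ (α i)) v := by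
    rw [← rho_isometry cs hB hα hρ ω⁻¹ (α i), ← Module.End.mul_apply (ρ ω⁻¹), ← map_mul,
      inv_mul_cancel, map_one, Module.End.one_apply]
  rw [h2]
  generalize ρ ω⁻¹ (α i) = x at h1
  induction h1 using Submodule.span_induction with
  | mem x hx => obtain ⟨j, rfl⟩ := hx; exact hv j
  | zero => simp
  | add x y _ _ hx hy => rw [map_add, LinearMap.add_apply]; exact add_nonneg hx hy
  | smul c x _ hx =>
    change 0 ≤ B ((c : ℝ) • x) v
    rw [map_smul, LinearMap.smul_apply, smul_eq_mul]
    exact mul_nonneg c.2 hx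

/-- The orbit of a dominant unit vector that is fixed by all simple reflections but one. -/
theorem orbit_separated (hB : ∀ u v, B u v = B v u)
    (hα : ∀ i, B (α i) (α i) = 1) (hρ : ∀ i, ρ (cs.simple i) = refl B (α i))
    (hM : ∀ i j, i ≠ j → M i j ≠ 0 ∧ B (α i) (α j) = -Real.cos (π / M i j))
    {v : V} (hv1 : B v v = 1) {i₀ : ι} (hv : ∀ i, i ≠ i₀ → B (α i) v = 0)
    (hv0 : 0 ≤ B (α i₀) v) (ω : W) :
    ρ ω v = v ∨ B (ρ ω v) v ≤ 1 - 2 * B (α i₀) v ^ 2 := by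
  have hvn : ∀ i, 0 ≤ B (α i) v := fun i => by
    by_cases h : i = i₀
    · exact h ▸ hv0
    · exact (hv i h).ge
  -- Each left letter changes the pairing with `v` by `-2 B(αᵢ, u) B(αᵢ, v)`, with both factors
  -- nonnegative, so the pairing never increases. The first letter that moves `v` is `i₀`, and it
  -- already costs `2 B(α_{i₀}, v)²`.
  induction hn : cs.length ω using Nat.strong_induction_on generalizing ω with
  | _ n ih =>
  subst hn
  by_cases h1 : ω = 1
  · left; simp [h1]
  obtain ⟨i, hi⟩ := cs.exists_leftDescent_of_ne_one h1
  have hi' := cs.isLeftDescent_iff_not_isLeftDescent_mul.mp hi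
  have hpos := nonneg_of_not_isLeftDescent cs hB hα hρ hM hvn _ _ hi'
  have e : ρ ω v = refl B (α i) (ρ (cs.simple i * ω) v) := by
    rw [← hρ, ← Module.End.mul_apply, ← map_mul, cs.simple_mul_simple_cancel_left]
  have hle := ih _ hi _ rfl
  set u := ρ (cs.simple i * ω) v with hu
  rw [e, refl_apply]
  rcases hle with hle | hle
  · rw [hle]
    by_cases h : i = i₀
    · right
      subst h
      simp only [map_sub, map_smul, LinearMap.sub_apply, LinearMap.smul_apply, smul_eq_mul, hv1]
      nlinarith
    · left; rw [hv i h]; simp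
  · right
    simp only [map_sub, map_smul, LinearMap.sub_apply, LinearMap.smul_apply, smul_eq_mul]
    have := mul_nonneg hpos (hvn i)
    nlinarith

end CoxeterReflection

/-! ## The reflection group in Lorentz space -/

namespace RoundCarpet

open CoxeterReflection

/-- Lorentz space: `(a, b, c)` encodes the function `a|z|² + 2 Re (b̄ z) + c`. -/
abbrev Lorentz := ℝ × ℂ × ℝ

/-- The Lorentz form `Re (b̄ b') - (a c' + a' c) / 2`. -/
noncomputable def lor : Lorentz →ₗ[ℝ] Lorentz →ₗ[ℝ] ℝ :=
  LinearMap.mk₂ ℝ (fun u v => u.2.1.re * v.2.1.re + u.2.1.im * v.2.1.im -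
      (u.1 * v.2.2 + u.2.2 * v.1) / 2)
    (fun u u' v => by simp; ring) (fun c u v => by simp; ring)
    (fun u v v' => by simp; ring) (fun c u v => by simp; ring)

theorem lor_apply (u v : Lorentz) : lor u v = u.2.1.re * v.2.1.re + u.2.1.im * v.2.1.im -
    (u.1 * v.2.2 + u.2.2 * v.1) / 2 := rfl

theorem lor_comm (u v : Lorentz) : lor u v = lor v u := by
  simp only [lor_apply]; ring

/-- The vector of the exterior of the unit disk. -/
noncomputable def extVec : Lorentz := (1, 0, -1)

/-- The vector of the point of hyperbolic space at height `√h` above `x`. -/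
noncomputable def pt (x : ℂ) (h : ℝ) : Lorentz := (-2, 2 * x, -2 * (Complex.normSq x + h))

/-- For `h = 0` the pairing evaluates at `x` the function that `w` encodes. Its sign therefore tells
on which side of the circle of `w` the point lies; for `h > 0` it does the same for the hemisphere
over the circle. -/
theorem lor_pt (w : Lorentz) (x : ℂ) (h : ℝ) : lor w (pt x h) =
    w.1 * (Complex.normSq x + h) + 2 * (w.2.1.re * x.re + w.2.1.im * x.im) + w.2.2 := by
  simp [lor_apply, pt]; ring

/-- The lightlike vector of a point of the sphere. -/
noncomputable def lift : OnePoint ℂ → Lorentz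
  | none => (0, 0, -2)
  | some z => pt z 0

theorem lift_infty : lift OnePoint.infty = (0, 0, -2) := rfl

theorem lift_coe (z : ℂ) : lift (z : OnePoint ℂ) = pt z 0 := rfl

/-- The Coxeter matrix of the reflections in `ℓ₁, ℓ₂, ℓ₃, ℓ₄`. -/
def coxMatrix (q : ℕ) (hq : 6 < q) : CoxeterMatrix (Fin 4) where
  M := !![1, 3, q, 2; 3, 1, 2, 3; q, 2, 1, 2; 2, 3, 2, 1]
  isSymm := by ext i j; fin_cases i <;> fin_cases j <;> rfl
  diagonal i := by fin_cases i <;> rfl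
  off_diagonal i j h := by
    fin_cases i <;> fin_cases j <;> simp at h ⊢ <;> omega

/-- The simple roots: unit normal vectors of `ℓ₁, ℓ₂, ℓ₃, ℓ₄`. -/
noncomputable def root (q : ℕ) : Fin 4 → Lorentz :=
  ![(0, Complex.I, 0), (sPar q)⁻¹ • (1, -centre₂ q, 1),
    (0, -Complex.I * Complex.exp ((π / q : ℝ) * Complex.I), 0),
    (rPar q)⁻¹ • (1, 0, -rPar q ^ 2)]

/-- The relations between the parameters. -/
theorem par_relations {q : ℕ} (hq : 6 < q) :
    sPar q ^ 2 + 1 = tPar q ^ 2 ∧ 2 * (tPar q * Real.sin (π / q)) = sPar q ∧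
      1 - rPar q ^ 2 = rPar q * sPar q := by
  obtain ⟨-, h2⟩ := four_sin_sq_lt hq
  have hw0 : 0 < √(1 - 4 * Real.sin (π / q) ^ 2) := Real.sqrt_pos.mpr (by linarith)
  have hw2 := Real.sq_sqrt (show 0 ≤ 1 - 4 * Real.sin (π / q) ^ 2 by linarith)
  refine ⟨?_, ?_, ?_⟩
  · unfold sPar tPar
    have hne : 1 - 4 * Real.sin (π / q) ^ 2 ≠ 0 := by linarith
    rw [div_pow, div_pow, hw2, div_add_one hne]
    ring_nf
  · unfold sPar tPar; ring
  · have := Real.sq_sqrt (show 0 ≤ sPar q ^ 2 + 4 by positivity)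
    unfold rPar
    nlinarith

theorem centre_re (q : ℕ) : (centre₂ q).re = tPar q * Real.cos (π / q) := by
  unfold centre₂; rw [Complex.re_ofReal_mul, Complex.exp_ofReal_mul_I_re]

theorem centre_im (q : ℕ) : (centre₂ q).im = tPar q * Real.sin (π / q) := by
  unfold centre₂; rw [Complex.im_ofReal_mul, Complex.exp_ofReal_mul_I_im]

theorem lor_root_zero (q : ℕ) (v : Lorentz) : lor (root q 0) v = v.2.1.im := by
  simp [root, lor_apply]

theorem lor_root_one (q : ℕ) (v : Lorentz) : lor (root q 1) v = (sPar q)⁻¹ *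
    (-(tPar q * (Real.cos (π / q) * v.2.1.re + Real.sin (π / q) * v.2.1.im))
      - (v.1 + v.2.2) / 2) := by
  simp [root, lor_apply, centre_re, centre_im]; ring

theorem lor_root_two (q : ℕ) (v : Lorentz) : lor (root q 2) v =
    Real.sin (π / q) * v.2.1.re - Real.cos (π / q) * v.2.1.im := by
  have e1 := Complex.exp_ofReal_mul_I_re (π / q)
  have e2 := Complex.exp_ofReal_mul_I_im (π / q)
  simp [root, lor_apply] at *
  simp [e1, e2]; ring

theorem lor_root_three (q : ℕ) (v : Lorentz) : lor (root q 3) v = (rPar q)⁻¹ *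
    ((rPar q ^ 2 * v.1 - v.2.2) / 2) := by
  simp [root, lor_apply]; ring

theorem root_fst (q : ℕ) : (root q 0).1 = 0 ∧ (root q 1).1 = (sPar q)⁻¹ ∧ (root q 2).1 = 0 ∧
    (root q 3).1 = (rPar q)⁻¹ := by
  simp [root]

theorem root_snd (q : ℕ) : (root q 0).2.1 = Complex.I ∧
    (root q 1).2.1 = ((sPar q)⁻¹ : ℝ) • (-centre₂ q) ∧
    (root q 2).2.1 = -Complex.I * Complex.exp ((π / q : ℝ) * Complex.I) ∧
    (root q 3).2.1 = 0 := by
  simp [root]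

theorem root_thd (q : ℕ) : (root q 0).2.2 = 0 ∧ (root q 1).2.2 = (sPar q)⁻¹ ∧
    (root q 2).2.2 = 0 ∧ (root q 3).2.2 = (rPar q)⁻¹ * (-rPar q ^ 2) := by
  simp [root]

theorem root_two_re_im (q : ℕ) : (root q 2).2.1.re = Real.sin (π / q) ∧
    (root q 2).2.1.im = -Real.cos (π / q) := by
  have e1 := Complex.exp_ofReal_mul_I_re (π / q)
  have e2 := Complex.exp_ofReal_mul_I_im (π / q)
  rw [(root_snd q).2.2.1]
  constructor
  · rw [← e2]; simp
  · rw [← e1]; simp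

theorem root_one_re_im (q : ℕ) :
    (root q 1).2.1.re = -(sPar q)⁻¹ * (tPar q * Real.cos (π / q)) ∧
    (root q 1).2.1.im = -(sPar q)⁻¹ * (tPar q * Real.sin (π / q)) := by
  rw [(root_snd q).2.1, Complex.smul_re, Complex.smul_im, Complex.neg_re, Complex.neg_im,
    centre_re, centre_im]
  simp

/-- The off-diagonal entries are minus the cosines of the angles between the circles;
`par_relations` is exactly what the rows of ℓ₂ and ℓ₄ require. -/
theorem root_gram {q : ℕ} (hq : 6 < q) (i j : Fin 4) :
    lor (root q i) (root q j) =
      !![1, -(1/2), -Real.cos (π / q), 0; -(1/2), 1, 0, -(1/2);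
        -Real.cos (π / q), 0, 1, 0; 0, -(1/2), 0, 1] i j := by
  obtain ⟨h1, h2, h3⟩ := par_relations hq
  obtain ⟨ht, hs, hr, hr1⟩ := par_pos hq
  have hcs := Real.sin_sq_add_cos_sq (π / q)
  have a00 : lor (root q 0) (root q 0) = 1 := by rw [lor_root_zero, (root_snd q).1]; simp
  have a01 : lor (root q 0) (root q 1) = -(1 / 2) := by
    rw [lor_root_zero, (root_one_re_im q).2]; field_simp; linarith
  have a02 : lor (root q 0) (root q 2) = -Real.cos (π / q) := by
    rw [lor_root_zero, (root_two_re_im q).2]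
  have a03 : lor (root q 0) (root q 3) = 0 := by
    rw [lor_root_zero, (root_snd q).2.2.2]; simp
  have a11 : lor (root q 1) (root q 1) = 1 := by
    rw [lor_root_one, (root_one_re_im q).1, (root_one_re_im q).2, (root_fst q).2.1,
      (root_thd q).2.1]
    field_simp
    have : tPar q ^ 2 * (Real.sin (π / q) ^ 2 + Real.cos (π / q) ^ 2) = sPar q ^ 2 + 1 := by
      rw [hcs, h1]; ring
    nlinarith
  have a12 : lor (root q 1) (root q 2) = 0 := by
    rw [lor_root_one, (root_two_re_im q).1, (root_two_re_im q).2, (root_fst q).2.2.1,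
      (root_thd q).2.2.1]
    ring
  have a13 : lor (root q 1) (root q 3) = -(1 / 2) := by
    rw [lor_root_one, (root_snd q).2.2.2, (root_fst q).2.2.2, (root_thd q).2.2.2]
    simp
    field_simp
    linarith
  have a22 : lor (root q 2) (root q 2) = 1 := by
    rw [lor_root_two, (root_two_re_im q).1, (root_two_re_im q).2]; nlinarith
  have a23 : lor (root q 2) (root q 3) = 0 := by
    rw [lor_root_two, (root_snd q).2.2.2]; simp
  have a33 : lor (root q 3) (root q 3) = 1 := by
    rw [lor_root_three, (root_fst q).2.2.2, (root_thd q).2.2.2]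
    field_simp; ring
  fin_cases i <;> fin_cases j <;>
    simp only [Fin.zero_eta, Fin.mk_one, Fin.reduceFinMk, Matrix.of_apply, Matrix.cons_val] <;>
    first
    | assumption
    | (rw [lor_comm]; assumption)

theorem lor_root_self {q : ℕ} (hq : 6 < q) (i : Fin 4) : lor (root q i) (root q i) = 1 := by
  rw [root_gram hq]; fin_cases i <;> rfl

theorem root_cos {q : ℕ} (hq : 6 < q) (i j : Fin 4) (hij : i ≠ j) :
    coxMatrix q hq i j ≠ 0 ∧
      lor (root q i) (root q j) = -Real.cos (π / coxMatrix q hq i j) := by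
  rw [root_gram hq]
  change (!![1, 3, q, 2; 3, 1, 2, 3; q, 2, 1, 2; 2, 3, 2, 1] : Matrix (Fin 4) (Fin 4) ℕ) i j ≠ 0 ∧
    _ = -Real.cos
      (π / (!![1, 3, q, 2; 3, 1, 2, 3; q, 2, 1, 2; 2, 3, 2, 1] : Matrix (Fin 4) (Fin 4) ℕ) i j)
  fin_cases i <;> fin_cases j <;> simp at hij ⊢ <;> omega

theorem refl_root_zero (q : ℕ) (v : Lorentz) :
    refl lor (root q 0) v = (v.1, conj v.2.1, v.2.2) := by
  rw [refl_apply, lor_root_zero]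
  refine Prod.ext ?_ (Prod.ext (Complex.ext ?_ ?_) ?_) <;> simp [root]; ring

theorem refl_root_two (q : ℕ) (v : Lorentz) :
    refl lor (root q 2) v =
      (v.1, Complex.exp ((2 * (π / q) : ℝ) * Complex.I) * conj v.2.1, v.2.2) := by
  have hcs := Real.sin_sq_add_cos_sq (π / q)
  have e1 := Complex.exp_ofReal_mul_I_re (2 * (π / q))
  have e2 := Complex.exp_ofReal_mul_I_im (2 * (π / q))
  rw [Real.cos_two_mul] at e1
  rw [Real.sin_two_mul] at e2
  rw [refl_apply, lor_root_two]
  refine Prod.ext ?_ (Prod.ext (Complex.ext ?_ ?_) ?_)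
  · simp [root]
  · rw [Complex.mul_re, e1, e2]
    simp only [Prod.snd_sub, Prod.smul_snd, Prod.fst_sub, Prod.smul_fst, Complex.sub_re,
      Complex.smul_re, (root_two_re_im q).1, smul_eq_mul, Complex.conj_re, Complex.conj_im]
    linear_combination (-2 * v.2.1.re) * hcs
  · rw [Complex.mul_im, e1, e2]
    simp only [Prod.snd_sub, Prod.smul_snd, Prod.fst_sub, Prod.smul_fst, Complex.sub_im,
      Complex.smul_im, (root_two_re_im q).2, smul_eq_mul, Complex.conj_re, Complex.conj_im]
    ring
  · simp [root]

theorem refl_zero_two (q : ℕ) (v : Lorentz) (n : ℕ) :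
    ((refl lor (root q 0) * refl lor (root q 2)) ^ n) v =
      (v.1, Complex.exp (-(n * (2 * (π / q)) : ℝ) * Complex.I) * v.2.1, v.2.2) := by
  induction n with
  | zero => simp
  | succ n ih =>
    rw [pow_succ', Module.End.mul_apply, ih, Module.End.mul_apply, refl_root_two, refl_root_zero]
    refine Prod.ext rfl (Prod.ext ?_ rfl)
    simp only [map_mul, Complex.conj_conj, ← Complex.exp_conj, Complex.conj_ofReal,
      Complex.conj_I, map_neg]
    rw [← mul_assoc, ← Complex.exp_add]
    congr 2
    push_cast; ring

/-- The relations of order 2 and 3 follow from the Gram entries alone. For the two lines the product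
is an explicit rotation by `2π/q`, whose `q`-th power is the identity. -/
theorem isLiftable {q : ℕ} (hq : 6 < q) :
    (coxMatrix q hq).IsLiftable fun i => refl lor (root q i) := by
  have hsw : ∀ (i j : Fin 4) (n : ℕ),
      (refl lor (root q i) * refl lor (root q j)) ^ n = 1 →
      (refl lor (root q j) * refl lor (root q i)) ^ n = 1 := by
    intro i j n h
    have hi := refl_mul_self (B := lor) (root q i) (lor_root_self hq i)
    have e : refl lor (root q j) * refl lor (root q i) = refl lor (root q i) *
        (refl lor (root q i) * refl lor (root q j)) * refl lor (root q i) := by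
      rw [← mul_assoc, hi, one_mul]
    have key : ∀ n, (refl lor (root q j) * refl lor (root q i)) ^ n = refl lor (root q i) *
        (refl lor (root q i) * refl lor (root q j)) ^ n * refl lor (root q i) := by
      intro n
      induction n with
      | zero => simp [hi]
      | succ n ih =>
        rw [pow_succ, ih, e, pow_succ]
        simp only [mul_assoc]
        rw [← mul_assoc (refl lor (root q i)) (refl lor (root q i)) (_ * _), hi, one_mul]
    rw [key, h, mul_one, hi]
  have d : ∀ i, (refl lor (root q i) * refl lor (root q i)) ^ 1 = 1 := fun i => by
    rw [pow_one, refl_mul_self _ (lor_root_self hq i)]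
  have h01 : (refl lor (root q 0) * refl lor (root q 1)) ^ 3 = 1 :=
    refl_mul_cube lor_comm (lor_root_self hq _) (lor_root_self hq _) (root_gram hq 0 1)
  have h02 : (refl lor (root q 0) * refl lor (root q 2)) ^ q = 1 := by
    refine LinearMap.ext fun v => ?_
    rw [refl_zero_two]
    have hq0 : (q : ℝ) ≠ 0 := by exact_mod_cast (by omega : q ≠ 0)
    have : Complex.exp (-((q : ℝ) * (2 * (π / q)) : ℝ) * Complex.I) = 1 := by
      rw [show (q : ℝ) * (2 * (π / q)) = 2 * π by field_simp]
      rw [neg_mul, Complex.exp_neg]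
      push_cast
      rw [Complex.exp_two_pi_mul_I, inv_one]
    rw [this, one_mul, Module.End.one_apply]
  have h03 : (refl lor (root q 0) * refl lor (root q 3)) ^ 2 = 1 :=
    refl_mul_sq lor_comm (lor_root_self hq _) (lor_root_self hq _) (root_gram hq 0 3)
  have h12 : (refl lor (root q 1) * refl lor (root q 2)) ^ 2 = 1 :=
    refl_mul_sq lor_comm (lor_root_self hq _) (lor_root_self hq _) (root_gram hq 1 2)
  have h13 : (refl lor (root q 1) * refl lor (root q 3)) ^ 3 = 1 :=
    refl_mul_cube lor_comm (lor_root_self hq _) (lor_root_self hq _) (root_gram hq 1 3)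
  have h23 : (refl lor (root q 2) * refl lor (root q 3)) ^ 2 = 1 :=
    refl_mul_sq lor_comm (lor_root_self hq _) (lor_root_self hq _) (root_gram hq 2 3)
  intro i j
  fin_cases i <;> fin_cases j
  exacts [d 0, h01, h02, h03, hsw _ _ _ h01, d 1, h12, h13, hsw _ _ _ h02, hsw _ _ _ h12, d 2, h23,
    hsw _ _ _ h03, hsw _ _ _ h13, hsw _ _ _ h23, d 3]

/-- The abstract Coxeter group. -/
abbrev CoxGroup (q : ℕ) (hq : 6 < q) := (coxMatrix q hq).Group

/-- The Coxeter system of the Coxeter group. -/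
def coxSystem (q : ℕ) (hq : 6 < q) : CoxeterSystem (coxMatrix q hq) (CoxGroup q hq) :=
  (coxMatrix q hq).toCoxeterSystem

/-- The representation of the Coxeter group by Lorentz transformations. -/
noncomputable def rep {q : ℕ} (hq : 6 < q) : CoxGroup q hq →* Module.End ℝ Lorentz :=
  (coxSystem q hq).lift ⟨_, isLiftable hq⟩

theorem rep_simple {q : ℕ} (hq : 6 < q) (i : Fin 4) :
    rep hq ((coxSystem q hq).simple i) = refl lor (root q i) :=
  (coxSystem q hq).lift_apply_simple (isLiftable hq) i

theorem lor_rep {q : ℕ} (hq : 6 < q) (ω : CoxGroup q hq) (u v : Lorentz) :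
    lor (rep hq ω u) (rep hq ω v) = lor u v :=
  rho_isometry (coxSystem q hq) lor_comm (lor_root_self hq) (rep_simple hq) ω u v

theorem rep_inv_apply {q : ℕ} (hq : 6 < q) (ω : CoxGroup q hq) (u : Lorentz) :
    rep hq ω⁻¹ (rep hq ω u) = u := by
  rw [← Module.End.mul_apply, ← map_mul, inv_mul_cancel, map_one, Module.End.one_apply]

theorem rep_apply_inv {q : ℕ} (hq : 6 < q) (ω : CoxGroup q hq) (u : Lorentz) :
    rep hq ω (rep hq ω⁻¹ u) = u := by
  rw [← Module.End.mul_apply, ← map_mul, mul_inv_cancel, map_one, Module.End.one_apply]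

theorem lor_rep_left {q : ℕ} (hq : 6 < q) (ω : CoxGroup q hq) (u v : Lorentz) :
    lor (rep hq ω u) v = lor u (rep hq ω⁻¹ v) := by
  rw [← lor_rep hq ω⁻¹, rep_inv_apply]

/-- The unit circle is orthogonal to ℓ₁, ℓ₂ and ℓ₃, so three simple reflections fix `extVec`, and
the last entry makes it dominant. This is the situation of `orbit_separated`. -/
theorem lor_root_extVec {q : ℕ} (hq : 6 < q) (i : Fin 4) :
    lor (root q i) extVec = ![0, 0, 0, (1 + rPar q ^ 2) / (2 * rPar q)] i := by
  obtain ⟨ht, hs, hr, hr1⟩ := par_pos hq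
  fin_cases i
  · simp [lor_root_zero, extVec]
  · simp [lor_root_one, extVec]
  · simp [lor_root_two, extVec]
  · simp [lor_root_three, extVec]; field_simp; ring

theorem lor_extVec_self : lor extVec extVec = 1 := by simp [lor_apply, extVec]

/-- Every image of the exterior of the unit disk is the exterior itself or
a disk whose closure lies in the open unit disk. -/
theorem rep_extVec {q : ℕ} (hq : 6 < q) (ω : CoxGroup q hq) :
    rep hq ω extVec = extVec ∨
      ((rep hq ω extVec).1 < 0 ∧ ‖(rep hq ω extVec).2.1‖ + 1 < -(rep hq ω extVec).1) := by
  obtain ⟨ht, hs, hr, hr1⟩ := par_pos hq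
  have hi : ∀ i : Fin 4, i ≠ 3 → lor (root q i) extVec = 0 := by
    intro i hi; rw [lor_root_extVec hq]; fin_cases i <;> simp at hi ⊢
  have h3 : lor (root q 3) extVec = (1 + rPar q ^ 2) / (2 * rPar q) := lor_root_extVec hq 3
  -- A pairing above 1 with the last root turns `1 - 2 B²` into a number below `-1`, the Lorentz
  -- form of strict separation of two circles.
  have h30 : 1 < lor (root q 3) extVec := by
    rw [h3, lt_div_iff₀ (by positivity)]; nlinarith
  have hp : ∀ i : Fin 4, 0 ≤ lor (root q i) (pt 0 1) := by
    intro i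
    fin_cases i
    · simp [lor_root_zero, pt]
    · simp [lor_root_one, pt]; positivity
    · simp [lor_root_two, pt]
    · simp [lor_root_three, pt]
      apply mul_nonneg (by positivity)
      nlinarith
  rcases orbit_separated (coxSystem q hq) lor_comm (lor_root_self hq) (rep_simple hq)
    (root_cos hq) lor_extVec_self hi (by linarith) ω with h | h
  · exact Or.inl h
  right
  have hext : ∀ i, 0 ≤ lor (root q i) extVec := fun i => by
    by_cases h : i = 3
    · subst h; linarith
    · rw [hi i h]
  -- The pairing with `extVec` does not settle the orientation. The point `pt 0 1` lies in the
  -- closed chamber and on the wall of `extVec`, so each left letter can only lower its pairing with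
  -- the image of `extVec`, starting from 0.
  have hle : lor (rep hq ω extVec) (pt 0 1) ≤ 0 := by
    have : ∀ n ω, (coxSystem q hq).length ω = n → lor (rep hq ω extVec) (pt 0 1) ≤ 0 := by
      intro n
      induction n with
      | zero =>
        intro ω hω
        rw [(coxSystem q hq).length_eq_zero_iff] at hω
        subst hω
        simp [lor_apply, extVec, pt]
      | succ n ih =>
        intro ω hω
        have h1 : ω ≠ 1 := by rintro rfl; simp at hω
        obtain ⟨i, hi⟩ := (coxSystem q hq).exists_leftDescent_of_ne_one h1
        have hi' := (coxSystem q hq).isLeftDescent_iff_not_isLeftDescent_mul.mp hi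
        have hpos := nonneg_of_not_isLeftDescent (coxSystem q hq) lor_comm (lor_root_self hq)
          (rep_simple hq) (root_cos hq) hext _ _ hi'
        have hl := (coxSystem q hq).isLeftDescent_iff.mp hi
        have e : rep hq ω extVec =
            refl lor (root q i) (rep hq ((coxSystem q hq).simple i * ω) extVec) := by
          rw [← rep_simple hq, ← Module.End.mul_apply, ← map_mul,
            (coxSystem q hq).simple_mul_simple_cancel_left]
        rw [e, refl_apply, map_sub, map_smul, LinearMap.sub_apply, LinearMap.smul_apply,
          smul_eq_mul]
        have := ih _ (by omega : (coxSystem q hq).length ((coxSystem q hq).simple i * ω) = n)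
        have := mul_nonneg hpos (hp i)
        linarith
    exact this _ ω rfl
  have h1 := lor_rep hq ω extVec extVec
  rw [lor_extVec_self] at h1
  set w := rep hq ω extVec
  have e1 : lor w extVec = (w.1 - w.2.2) / 2 := by simp [lor_apply, extVec]; ring
  rw [lor_pt] at hle
  simp at hle
  rw [e1] at h
  rw [lor_apply] at h1
  have hk : w.1 + 2 < w.2.2 := by nlinarith
  have ha : w.1 < -1 := by linarith
  refine ⟨by linarith, ?_⟩
  have hb : ‖w.2.1‖ ^ 2 < (-w.1 - 1) ^ 2 := by
    rw [← Complex.normSq_eq_norm_sq, Complex.normSq_apply]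
    have := mul_pos (sub_pos.mpr hk) (neg_pos.mpr (by linarith : w.1 < 0))
    linarith
  have := lt_of_pow_lt_pow_left₀ 2 (by linarith) hb
  linarith

end RoundCarpet

/-! ## The action on the sphere -/

namespace RoundCarpet

open CoxeterReflection

theorem refl_inv_smul (s : ℝ) (u v : Lorentz) :
    refl lor (s⁻¹ • u) v = v - (2 * lor u v / s ^ 2) • u := by
  rw [refl_apply, map_smul, LinearMap.smul_apply, smul_smul, smul_eq_mul]
  congr 2
  ring

/-- A point of the sphere determines its lightlike vector only up to a positive factor, so inversion
and Lorentz reflection agree only up to `l`. Positivity of `l` is what matters, since all later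
arguments use signs of pairings. -/
theorem lift_circleInv (c : ℂ) {s : ℝ} (hs : 0 < s) (z : OnePoint ℂ) :
    ∃ l : ℝ, 0 < l ∧ lift (circleInv c s z) =
      l • refl lor (s⁻¹ • ((1, -c, Complex.normSq c - s ^ 2) : Lorentz)) (lift z) := by
  have hs0 : s ≠ 0 := hs.ne'
  have e : circleInv c s z = circleInvFun c s z := by
    unfold circleInv; rw [dif_pos hs]; rfl
  rw [e, refl_inv_smul]
  induction z using OnePoint.rec with
  | infty =>
    refine ⟨s ^ 2, by positivity, ?_⟩
    change lift ((c : ℂ) : OnePoint ℂ) = _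
    have h1 : lor ((1, -c, Complex.normSq c - s ^ 2) : Lorentz) (0, 0, -2) = 1 := by
      simp [lor_apply]
    rw [lift_infty, lift_coe, h1]
    refine Prod.ext ?_ (Prod.ext ?_ ?_) <;> simp [pt] <;> field_simp
    · rw [mul_div_cancel_right₀]
      exact_mod_cast hs0
    · ring
  | coe z =>
    have h1 : lor ((1, -c, Complex.normSq c - s ^ 2) : Lorentz) (pt z 0) =
        Complex.normSq (z - c) - s ^ 2 := by
      simp [lor_pt, Complex.normSq_apply]; ring
    by_cases hz : z = c
    · subst hz
      refine ⟨(s ^ 2)⁻¹, by positivity, ?_⟩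
      have : circleInvFun z s (z : OnePoint ℂ) = OnePoint.infty := by
        change circleInvFun z s (some z) = _
        simp [circleInvFun]
      rw [this, lift_infty, lift_coe, h1]
      have h2 : 2 * (Complex.normSq (z - z) - s ^ 2) / s ^ 2 = -2 := by
        rw [sub_self, map_zero]; field_simp; ring
      rw [h2]
      refine Prod.ext ?_ (Prod.ext ?_ ?_) <;> simp [pt]
      field_simp; ring
    · have h3 : z - c ≠ 0 := sub_ne_zero.mpr hz
      have hn : 0 < Complex.normSq (z - c) := Complex.normSq_pos.mpr h3
      have e1 : (s : ℂ) ^ 2 / conj (z - c) = ((s ^ 2 / Complex.normSq (z - c) : ℝ) : ℂ) * (z - c) := by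
        have h2 : conj (z - c) ≠ 0 := (map_ne_zero (starRingEnd ℂ)).mpr h3
        rw [div_eq_iff h2, mul_assoc, Complex.mul_conj, Complex.ofReal_div]
        have : (Complex.normSq (z - c) : ℂ) ≠ 0 := by exact_mod_cast hn.ne'
        field_simp; push_cast; rfl
      have : circleInvFun c s (z : OnePoint ℂ) =
          ((c + ((s ^ 2 / Complex.normSq (z - c) : ℝ) : ℂ) * (z - c) : ℂ) : OnePoint ℂ) := by
        change circleInvFun c s (some z) = _
        simp only [circleInvFun, if_neg hz, e1]
      refine ⟨s ^ 2 / Complex.normSq (z - c), by positivity, ?_⟩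
      rw [this, lift_coe, lift_coe, h1]
      have hl : s ^ 2 / Complex.normSq (z - c) * Complex.normSq (z - c) = s ^ 2 := by field_simp
      have hlk : s ^ 2 / Complex.normSq (z - c) *
          (2 * (Complex.normSq (z - c) - s ^ 2) / s ^ 2) =
          2 - 2 * (s ^ 2 / Complex.normSq (z - c)) := by field_simp
      generalize s ^ 2 / Complex.normSq (z - c) = l at *
      generalize 2 * (Complex.normSq (z - c) - s ^ 2) / s ^ 2 = k at *
      rw [Complex.normSq_apply (z - c), Complex.sub_re, Complex.sub_im] at hl
      refine Prod.ext ?_ (Prod.ext (Complex.ext ?_ ?_) ?_)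
      · simp [pt]; linear_combination hlk
      · simp [pt]; linear_combination (-c.re) * hlk
      · simp [pt]; linear_combination (-c.im) * hlk
      · simp [pt, Complex.normSq_apply]
        linear_combination (c.re * c.re + c.im * c.im - s ^ 2) * hlk + (2 - 2 * l) * hl

theorem lift_lineRefl_zero (q : ℕ) (z : OnePoint ℂ) :
    lift (lineRefl 0 z) = refl lor (root q 0) (lift z) := by
  rw [refl_root_zero]
  induction z using OnePoint.rec with
  | infty =>
    change lift OnePoint.infty = _
    simp [lift_infty]
  | coe z =>
    change lift ((Complex.exp (2 * (0 : ℝ) * Complex.I) * conj z : ℂ) : OnePoint ℂ) = _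
    simp [lift_coe, pt, Complex.conj_ofNat]

theorem lift_lineRefl (q : ℕ) (z : OnePoint ℂ) :
    lift (lineRefl (π / q) z) = refl lor (root q 2) (lift z) := by
  rw [refl_root_two]
  induction z using OnePoint.rec with
  | infty =>
    change lift OnePoint.infty = _
    simp [lift_infty]
  | coe z =>
    change lift ((Complex.exp (2 * ((π / q : ℝ) : ℂ) * Complex.I) * conj z : ℂ) : OnePoint ℂ) = _
    have hn : Complex.normSq (Complex.exp (2 * ((π / q : ℝ) : ℂ) * Complex.I)) = 1 := by
      rw [Complex.normSq_eq_norm_sq]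
      have : (2 * ((π / q : ℝ) : ℂ)) * Complex.I = ((2 * (π / q) : ℝ) : ℂ) * Complex.I := by
        push_cast; rfl
      rw [this, Complex.norm_exp_ofReal_mul_I]; norm_num
    rw [lift_coe, lift_coe]
    refine Prod.ext rfl (Prod.ext ?_ ?_)
    · simp [pt, Complex.conj_ofNat]; ring
    · simp only [pt, map_mul, hn, Complex.normSq_conj]; ring

/-- The permutation `τ` acts on lightlike vectors as `ω`. -/
def ActsAs {q : ℕ} (hq : 6 < q) (τ : Equiv.Perm (OnePoint ℂ)) (ω : CoxGroup q hq) : Prop :=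
  ∀ z, ∃ l : ℝ, 0 < l ∧ lift (τ z) = l • rep hq ω (lift z)

variable {q : ℕ} {hq : 6 < q}

theorem ActsAs.one : ActsAs hq 1 1 := fun z => ⟨1, one_pos, by simp⟩

theorem ActsAs.mul {τ τ' : Equiv.Perm (OnePoint ℂ)} {ω ω' : CoxGroup q hq} (h : ActsAs hq τ ω)
    (h' : ActsAs hq τ' ω') : ActsAs hq (τ * τ') (ω * ω') := fun z => by
  obtain ⟨l', hl', e'⟩ := h' z
  obtain ⟨l, hl, e⟩ := h (τ' z)
  refine ⟨l * l', mul_pos hl hl', ?_⟩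
  rw [Equiv.Perm.mul_apply, e, e', map_smul, map_mul, Module.End.mul_apply, smul_smul]

theorem ActsAs.inv {τ : Equiv.Perm (OnePoint ℂ)} {ω : CoxGroup q hq} (h : ActsAs hq τ ω) :
    ActsAs hq τ⁻¹ ω⁻¹ := fun z => by
  obtain ⟨l, hl, e⟩ := h (τ⁻¹ z)
  refine ⟨l⁻¹, inv_pos.mpr hl, ?_⟩
  rw [← Equiv.Perm.mul_apply, mul_inv_cancel, Equiv.Perm.one_apply] at e
  rw [e, map_smul, rep_inv_apply, smul_smul, inv_mul_cancel₀ hl.ne', one_smul]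

/-- The generators of `G_q`. -/
noncomputable def gen (q : ℕ) : Fin 4 → Equiv.Perm (OnePoint ℂ) :=
  ![lineRefl 0, circleInv (centre₂ q) (sPar q), lineRefl (π / q), circleInv 0 (rPar q)]

theorem gen_actsAs (i : Fin 4) : ActsAs hq (gen q i) ((coxSystem q hq).simple i) := by
  obtain ⟨ht, hs, hr, hr1⟩ := par_pos hq
  obtain ⟨h1, -, -⟩ := par_relations hq
  have hn : Complex.normSq (centre₂ q) - sPar q ^ 2 = 1 := by
    rw [Complex.normSq_apply, centre_re, centre_im]
    nlinarith [Real.sin_sq_add_cos_sq (π / q)]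
  intro z
  rw [rep_simple]
  fin_cases i
  · exact ⟨1, one_pos, by rw [one_smul]; exact lift_lineRefl_zero q z⟩
  · have := lift_circleInv (centre₂ q) hs z
    rwa [hn] at this
  · exact ⟨1, one_pos, by rw [one_smul]; exact lift_lineRefl q z⟩
  · have := lift_circleInv 0 hr z
    rwa [neg_zero, map_zero, zero_sub] at this

theorem gen_mem (i : Fin 4) : gen q i ∈ groupG q := by
  apply Subgroup.subset_closure
  fin_cases i <;> simp [gen]

/-- Uniqueness of `ω`, that is faithfulness of the representation, plays no role: this and
`exists_perm` only provide some partner in each direction. -/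
theorem exists_actsAs {τ : Equiv.Perm (OnePoint ℂ)} (hτ : τ ∈ groupG q) :
    ∃ ω, ActsAs hq τ ω := by
  induction hτ using Subgroup.closure_induction with
  | mem x hx =>
    rcases hx with rfl | rfl | rfl | rfl
    exacts [⟨_, gen_actsAs 0⟩, ⟨_, gen_actsAs 1⟩, ⟨_, gen_actsAs 2⟩, ⟨_, gen_actsAs 3⟩]
  | one => exact ⟨1, ActsAs.one⟩
  | mul x y _ _ hx hy => exact ⟨_, hx.choose_spec.mul hy.choose_spec⟩
  | inv x _ hx => exact ⟨_, hx.choose_spec.inv⟩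

theorem exists_perm (ω : CoxGroup q hq) : ∃ τ ∈ groupG q, ActsAs hq τ ω := by
  induction ω using (coxSystem q hq).simple_induction with
  | simple i => exact ⟨_, gen_mem i, gen_actsAs i⟩
  | one => exact ⟨1, one_mem _, ActsAs.one⟩
  | mul w w' h h' =>
    obtain ⟨τ, hτ, e⟩ := h
    obtain ⟨τ', hτ', e'⟩ := h'
    exact ⟨_, mul_mem hτ hτ', e.mul e'⟩

theorem ActsAs.lor_pos_iff {τ : Equiv.Perm (OnePoint ℂ)} {ω : CoxGroup q hq} (h : ActsAs hq τ ω)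
    (w : Lorentz) (z : OnePoint ℂ) :
    ∃ l : ℝ, 0 < l ∧ lor (rep hq ω w) (lift (τ z)) = l * lor w (lift z) := by
  obtain ⟨l, hl, e⟩ := h z
  exact ⟨l, hl, by rw [e, map_smul, lor_rep, smul_eq_mul]⟩

/-! ## Reduction to bounded regions -/

/-- Rotations and reflections move every vector into the sector between `ℓ₁` and `ℓ₃`. -/
theorem exists_sector (hq : 6 < q) (N : Lorentz) : ∃ ω : CoxGroup q hq,
    rep hq ω extVec = extVec ∧ (rep hq ω N).1 = N.1 ∧ (rep hq ω N).2.2 = N.2.2 ∧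
      0 ≤ lor (root q 0) (rep hq ω N) ∧ 0 ≤ lor (root q 2) (rep hq ω N) := by
  set φ := π / q with hφ
  have hq0 : (0 : ℝ) < q := by exact_mod_cast (by omega : 0 < q)
  have hφ0 : 0 < φ := div_pos Real.pi_pos hq0
  have hφ1 : φ ≤ π / 2 := by
    apply div_le_div_of_nonneg_left Real.pi_pos.le (by norm_num)
    exact_mod_cast (by omega : 2 ≤ q)
  have hqφ : q * φ = π := by rw [hφ]; field_simp
  set b := N.2.1
  -- Rotating by the nearest multiple of `2φ` brings the argument of `b` into `[-φ, φ]`; reduction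
  -- modulo `q` turns this multiple into a natural power. A negative argument is finally reflected
  -- by `s0`.
  set k : ℤ := round (b.arg / (2 * φ)) with hk
  set n : ℕ := (k % q).toNat with hn
  have hqz : (q : ℤ) ≠ 0 := by omega
  have hnk : (n : ℤ) = k - q * (k / q) := by
    rw [hn, Int.toNat_of_nonneg (Int.emod_nonneg _ hqz), Int.emod_def]
  have hnk' : (n : ℝ) = k - q * ((k / q : ℤ) : ℝ) := by exact_mod_cast hnk
  set β := b.arg - 2 * φ * k with hβ
  have hβ1 : |β| ≤ φ := by
    have := abs_sub_round (b.arg / (2 * φ))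
    have e : β = 2 * φ * (b.arg / (2 * φ) - k) := by rw [hβ]; field_simp
    rw [e, abs_mul, abs_of_pos (by positivity : 0 < 2 * φ)]
    nlinarith
  obtain ⟨hβa, hβb⟩ := abs_le.mp hβ1
  set s0 := (coxSystem q hq).simple 0
  set s2 := (coxSystem q hq).simple 2
  have hrep : ∀ v, rep hq ((s0 * s2) ^ n) v =
      (v.1, Complex.exp (-(n * (2 * φ) : ℝ) * Complex.I) * v.2.1, v.2.2) := fun v => by
    rw [map_pow, map_mul, rep_simple, rep_simple, refl_zero_two]
  have hb : Complex.exp (-(n * (2 * φ) : ℝ) * Complex.I) * b =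
      ((‖b‖ * Real.cos β : ℝ) : ℂ) + ((‖b‖ * Real.sin β : ℝ) : ℂ) * Complex.I := by
    have h1 : (-(n * (2 * φ) : ℝ) : ℂ) * Complex.I + (b.arg : ℂ) * Complex.I =
        (β : ℂ) * Complex.I + ((k / q : ℤ) : ℂ) * (2 * π * Complex.I) := by
      have : -(n * (2 * φ)) + b.arg = β + ((k / q : ℤ) : ℝ) * (2 * π) := by
        rw [hβ, hnk', ← hqφ]; ring
      have h2 : ((-(n * (2 * φ)) + b.arg : ℝ) : ℂ) = ((β + ((k / q : ℤ) : ℝ) * (2 * π) : ℝ) : ℂ) := by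
        rw [this]
      push_cast at h2 ⊢
      linear_combination Complex.I * h2
    nth_rewrite 1 [← Complex.norm_mul_exp_arg_mul_I b]
    rw [mul_left_comm, ← Complex.exp_add, h1, Complex.exp_add, Complex.exp_int_mul_two_pi_mul_I,
      mul_one, Complex.exp_mul_I]
    push_cast; ring
  have hb_re : (Complex.exp (-(n * (2 * φ) : ℝ) * Complex.I) * b).re = ‖b‖ * Real.cos β := by
    rw [hb, Complex.add_re, Complex.ofReal_re, Complex.re_ofReal_mul, Complex.I_re, mul_zero, add_zero]
  have hb_im : (Complex.exp (-(n * (2 * φ) : ℝ) * Complex.I) * b).im = ‖b‖ * Real.sin β := by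
    rw [hb, Complex.add_im, Complex.ofReal_im, Complex.im_ofReal_mul, Complex.I_im, mul_one, zero_add]
  have hb0 := norm_nonneg b
  rcases le_total 0 β with h0 | h0
  · refine ⟨(s0 * s2) ^ n, by rw [hrep]; simp [extVec], by rw [hrep], by rw [hrep], ?_, ?_⟩
    · rw [lor_root_zero, hrep]
      change 0 ≤ (_ * b).im
      rw [hb_im]
      exact mul_nonneg hb0 (Real.sin_nonneg_of_nonneg_of_le_pi h0 (by linarith))
    · rw [lor_root_two, hrep]
      change 0 ≤ Real.sin φ * (_ * b).re - Real.cos φ * (_ * b).im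
      rw [hb_im, hb_re]
      have : 0 ≤ Real.sin (φ - β) := Real.sin_nonneg_of_nonneg_of_le_pi (by linarith) (by linarith)
      rw [Real.sin_sub] at this
      nlinarith [mul_nonneg hb0 this]
  · have hrep' : ∀ v, rep hq (s0 * (s0 * s2) ^ n) v = (v.1,
        conj (Complex.exp (-(n * (2 * φ) : ℝ) * Complex.I) * v.2.1), v.2.2) := fun v => by
      rw [map_mul, Module.End.mul_apply, hrep, rep_simple, refl_root_zero]
    refine ⟨s0 * (s0 * s2) ^ n, by rw [hrep']; simp [extVec], by rw [hrep'], by rw [hrep'], ?_, ?_⟩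
    · rw [lor_root_zero, hrep']
      change 0 ≤ (conj (_ * b)).im
      rw [Complex.conj_im, hb_im]
      have := Real.sin_nonpos_of_nonpos_of_neg_pi_le h0 (by linarith)
      nlinarith
    · rw [lor_root_two, hrep']
      change 0 ≤ Real.sin φ * (conj (_ * b)).re - Real.cos φ * (conj (_ * b)).im
      rw [Complex.conj_im, Complex.conj_re, hb_im, hb_re]
      have : 0 ≤ Real.sin (φ + β) := Real.sin_nonneg_of_nonneg_of_le_pi (by linarith) (by linarith)
      rw [Real.sin_add] at this
      nlinarith [mul_nonneg hb0 this]

/-- In the sector, the distance to the wall of `ℓ₂` bounds the modulus. -/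
theorem sector_bound (hq : 6 < q) {v : Lorentz} (h0 : 0 ≤ lor (root q 0) v)
    (h2 : 0 ≤ lor (root q 2) v) (h1 : -1 ≤ lor (root q 1) v) :
    (4 + 3 * sPar q ^ 2) * Complex.normSq v.2.1 ≤ (-(v.1 + v.2.2) + 2 * sPar q) ^ 2 := by
  obtain ⟨ht, hs, hr, hr1⟩ := par_pos hq
  obtain ⟨e1, e2, e3⟩ := par_relations hq
  obtain ⟨hσ, hσ2⟩ := four_sin_sq_lt hq
  rw [lor_root_zero] at h0
  rw [lor_root_two] at h2
  rw [lor_root_one, inv_mul_eq_div, le_div_iff₀ hs] at h1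
  have hcs := Real.sin_sq_add_cos_sq (π / q)
  set σ := Real.sin (π / q)
  set γ := Real.cos (π / q)
  have hγ : 0 < γ := by
    have : 0 ≤ γ := by
      apply Real.cos_nonneg_of_neg_pi_div_two_le_of_le
      · have : 0 ≤ π / (q : ℝ) := by positivity
        linarith [Real.pi_pos]
      · apply div_le_div_of_nonneg_left Real.pi_pos.le (by norm_num)
        exact_mod_cast (by omega : 2 ≤ q)
    rcases this.lt_or_eq with h | h
    · exact h
    · rw [← h] at hcs; nlinarith
  -- `X` and `Y` are the components along the line ℓ₃ and normal to it. The sector makes `Y` at most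
  -- `X tan (π/q)`, and the wall of ℓ₂ bounds `X`.
  set X := γ * v.2.1.re + σ * v.2.1.im with hX
  set Y := σ * v.2.1.re - γ * v.2.1.im with hY
  have hn : Complex.normSq v.2.1 = X ^ 2 + Y ^ 2 := by
    rw [Complex.normSq_apply, hX, hY]
    linear_combination (-(v.2.1.re ^ 2 + v.2.1.im ^ 2)) * hcs
  have him : v.2.1.im = σ * X - γ * Y := by
    rw [hX, hY]; linear_combination (-v.2.1.im) * hcs
  rw [him] at h0
  have hX0 : 0 ≤ X := by
    by_contra h
    push Not at h
    nlinarith [mul_nonneg hγ.le h2]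
  have hXY : (γ * Y) ^ 2 ≤ (σ * X) ^ 2 :=
    pow_le_pow_left₀ (mul_nonneg hγ.le h2) (by linarith) 2
  have h3 : γ ^ 2 * (X ^ 2 + Y ^ 2) ≤ X ^ 2 := by nlinarith
  have hκ : 4 * (tPar q ^ 2 * γ ^ 2) = 4 + 3 * sPar q ^ 2 := by
    have : tPar q ^ 2 * γ ^ 2 = tPar q ^ 2 - (tPar q * σ) ^ 2 := by
      linear_combination (tPar q ^ 2) * hcs
    rw [this]
    have : tPar q * σ = sPar q / 2 := by linarith
    rw [this, ← e1]; ring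
  rw [← hκ, hn]
  calc 4 * (tPar q ^ 2 * γ ^ 2) * (X ^ 2 + Y ^ 2) = 4 * tPar q ^ 2 * (γ ^ 2 * (X ^ 2 + Y ^ 2)) := by
        ring
    _ ≤ 4 * tPar q ^ 2 * X ^ 2 := mul_le_mul_of_nonneg_left h3 (by positivity)
    _ = (2 * (tPar q * X)) ^ 2 := by ring
    _ ≤ _ := pow_le_pow_left₀ (by positivity) (by linarith) 2

/-- Timelike vectors pointing to the future, normalised. -/
def IsFuture (N : Lorentz) : Prop := N.1 < 0 ∧ lor N N = -4

theorem IsFuture.snd_neg {N : Lorentz} (h : IsFuture N) : N.2.2 < 0 := by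
  obtain ⟨h1, h2⟩ := h
  rw [lor_apply] at h2
  nlinarith [mul_self_nonneg N.2.1.re, mul_self_nonneg N.2.1.im]

/-- Simple reflections preserve the future cone. The only delicate one is ℓ₂: the new first
coordinate times the old one is a sum of two squares plus 4, up to a positive factor, by the
normalisation `lor N N = -4`. -/
theorem IsFuture.rep {N : Lorentz} (h : IsFuture N) (ω : CoxGroup q hq) :
    IsFuture (rep hq ω N) := by
  refine ⟨?_, by rw [lor_rep]; exact h.2⟩
  obtain ⟨ht, hs, hr, hr1⟩ := par_pos hq
  obtain ⟨e1, e2, e3⟩ := par_relations hq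
  induction ω using (coxSystem q hq).simple_induction_left with
  | one => simpa using h.1
  | mul_simple_left w i ih =>
    have hv : IsFuture (RoundCarpet.rep hq w N) := ⟨ih, by rw [lor_rep]; exact h.2⟩
    rw [map_mul, Module.End.mul_apply, rep_simple]
    set v := RoundCarpet.rep hq w N
    have hv3 := hv.snd_neg
    obtain ⟨hv1, hv2⟩ := hv
    fin_cases i
    · change (refl lor (root q 0) v).1 < 0
      rw [refl_root_zero]; exact hv1
    · change (refl lor (root q 1) v).1 < 0
      rw [refl_apply, lor_root_one, Prod.fst_sub, Prod.smul_fst, (root_fst q).2.1, smul_eq_mul]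
      rw [lor_apply] at hv2
      have hcs := Real.sin_sq_add_cos_sq (π / q)
      set σ := Real.sin (π / q)
      set γ := Real.cos (π / q)
      have key : 0 < v.1 * (v.1 * (sPar q ^ 2 + 1) +
          2 * (tPar q * (γ * v.2.1.re + σ * v.2.1.im)) + v.2.2) := by
        rw [e1]
        have : v.1 * (v.1 * tPar q ^ 2 +
          2 * (tPar q * (γ * v.2.1.re + σ * v.2.1.im)) + v.2.2) =
          (v.1 * tPar q * γ + v.2.1.re) ^ 2 + (v.1 * tPar q * σ + v.2.1.im) ^ 2 + 4 := by
          linear_combination (-(v.1 * tPar q) ^ 2) * hcs - hv2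
        rw [this]; positivity
      have key2 := neg_of_mul_pos_right key hv1.le
      have : v.1 - 2 * ((sPar q)⁻¹ * (-(tPar q * (γ * v.2.1.re + σ * v.2.1.im)) -
          (v.1 + v.2.2) / 2)) * (sPar q)⁻¹ = (v.1 * (sPar q ^ 2 + 1) +
          2 * (tPar q * (γ * v.2.1.re + σ * v.2.1.im)) + v.2.2) / sPar q ^ 2 := by
        field_simp; ring
      rw [this]
      exact div_neg_of_neg_of_pos key2 (by positivity)
    · change (refl lor (root q 2) v).1 < 0
      rw [refl_root_two]; exact hv1
    · change (refl lor (root q 3) v).1 < 0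
      rw [refl_apply, lor_root_three, Prod.fst_sub, Prod.smul_fst, (root_fst q).2.2.2, smul_eq_mul]
      have : v.1 - 2 * ((rPar q)⁻¹ * ((rPar q ^ 2 * v.1 - v.2.2) / 2)) * (rPar q)⁻¹ =
          v.2.2 / rPar q ^ 2 := by field_simp; ring
      rw [this]
      exact div_neg_of_neg_of_pos hv3 (by positivity)

/-- The quantity `-(a + c)/2` is `-1/2` times the pairing with `pt 0 1`, so on `IsFuture` vectors it
is twice the hyperbolic cosine of the distance to that point. If reflecting hardly lowers it, the
pairing with the root is almost nonnegative. -/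
theorem height_simple_one (hq : 6 < q) (v : Lorentz) :
    -((rep hq ((coxSystem q hq).simple 1) v).1 + (rep hq ((coxSystem q hq).simple 1) v).2.2) / 2 =
      -(v.1 + v.2.2) / 2 + 2 / sPar q * lor (root q 1) v := by
  rw [rep_simple, refl_apply]
  simp only [Prod.snd_sub, Prod.smul_snd, Prod.fst_sub, Prod.smul_fst, (root_fst q).2.1,
    (root_thd q).2.1, smul_eq_mul]
  ring

theorem height_simple_three (hq : 6 < q) (v : Lorentz) :
    -((rep hq ((coxSystem q hq).simple 3) v).1 + (rep hq ((coxSystem q hq).simple 3) v).2.2) / 2 =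
      -(v.1 + v.2.2) / 2 + sPar q * lor (root q 3) v := by
  obtain ⟨ht, hs, hr, hr1⟩ := par_pos hq
  obtain ⟨e1, e2, e3⟩ := par_relations hq
  rw [rep_simple, refl_apply]
  simp only [Prod.snd_sub, Prod.smul_snd, Prod.fst_sub, Prod.smul_fst, (root_fst q).2.2.2,
    (root_thd q).2.2.2, smul_eq_mul]
  have : sPar q = (rPar q)⁻¹ * (1 - rPar q ^ 2) := by rw [e3]; field_simp
  rw [this]; ring

/-- Here `A = -a` and `C = -c` for a nearly minimal vector: `hCA` says that it is outside the half
space of `extVec`, `h3` is the wall of ℓ₄, and `hsec` is `sector_bound` with `|b|² = AC - 4`. Since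
`1 - r² = r s`, the quadratic part of `hsec` has a definite surplus `2 s² r² A²`, which a linear
term cannot match for large `A`. -/
theorem outside_bound_aux {s r A C : ℝ} (hs : 0 < s) (hr : 0 < r) (hr1 : r < 1)
    (e3 : 1 - r ^ 2 = r * s) (hA0 : 0 < A) (hC0 : 0 < C) (hCA : C ≤ A)
    (h3 : r ^ 2 * A - 2 * r ≤ C) (hsec : (4 + 3 * s ^ 2) * (A * C - 4) ≤ (A + C + 2 * s) ^ 2) :
    A ≤ 1 + (8 * s + 2 * r * (4 + 3 * s ^ 2) + 4 * (4 + 3 * s ^ 2) + 4 * s ^ 2) /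
      (2 * s ^ 2 * r ^ 2) := by
  have hG : 2 * s ^ 2 * r ^ 2 * A ^ 2 - 2 * r * (4 + 3 * s ^ 2) * A ≤
      (4 + 3 * s ^ 2) * (A * C) - (A + C) ^ 2 := by
    have hr2 : (1 + r ^ 2) ^ 2 = (r * s) ^ 2 + 4 * r ^ 2 := by rw [← e3]; ring
    rcases le_total (r ^ 2 * A) C with hcase | hcase
    · have h5 : 0 ≤ (C - r ^ 2 * A) * (A - C) := mul_nonneg (by linarith) (by linarith)
      have h6 : (4 + 3 * s ^ 2) * (A * C) - (A + C) ^ 2 = (C - r ^ 2 * A) * (A - C) +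
          (3 * s ^ 2 * A * C - (1 - r ^ 2) * (A * (A - C))) := by ring
      have h9 : A - C ≤ r * s * A := by rw [← e3]; linarith
      have h8 : r * s * (A * (A - C)) ≤ s ^ 2 * r ^ 2 * A ^ 2 := by
        have := mul_le_mul_of_nonneg_left h9 (by positivity : 0 ≤ r * s * A)
        linarith
      have h10 : 3 * (s ^ 2 * r ^ 2 * A ^ 2) ≤ 3 * s ^ 2 * A * C := by
        have := mul_le_mul_of_nonneg_left hcase (by positivity : 0 ≤ 3 * s ^ 2 * A)
        linarith
      have h11 : 0 ≤ 2 * r * (4 + 3 * s ^ 2) * A := by positivity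
      rw [h6, e3]; linarith
    · have h5 : (A + C) ^ 2 ≤ (A + r ^ 2 * A) ^ 2 :=
        pow_le_pow_left₀ (by linarith) (by linarith) 2
      have h6 : (A + r ^ 2 * A) ^ 2 = A ^ 2 * ((r * s) ^ 2 + 4 * r ^ 2) := by rw [← hr2]; ring
      have h7 : (4 + 3 * s ^ 2) * A * (r ^ 2 * A - 2 * r) ≤ (4 + 3 * s ^ 2) * A * C :=
        mul_le_mul_of_nonneg_left h3 (by positivity)
      linarith
  have hsA : s * (A + C) ≤ s * (2 * A) := mul_le_mul_of_nonneg_left (by linarith) hs.le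
  have hfin : 2 * s ^ 2 * r ^ 2 * A ^ 2 ≤
      (8 * s + 2 * r * (4 + 3 * s ^ 2)) * A + (4 * (4 + 3 * s ^ 2) + 4 * s ^ 2) := by linarith
  have hδ0 : 0 < 2 * s ^ 2 * r ^ 2 := by positivity
  rcases le_total A 1 with h | h
  · have : 0 ≤ (8 * s + 2 * r * (4 + 3 * s ^ 2) + 4 * (4 + 3 * s ^ 2) + 4 * s ^ 2) /
      (2 * s ^ 2 * r ^ 2) := by positivity
    linarith
  · have : A ≤ (8 * s + 2 * r * (4 + 3 * s ^ 2) + 4 * (4 + 3 * s ^ 2) + 4 * s ^ 2) /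
        (2 * s ^ 2 * r ^ 2) := by
      rw [le_div_iff₀ hδ0]
      have h5 : (4 * (4 + 3 * s ^ 2) + 4 * s ^ 2) ≤ (4 * (4 + 3 * s ^ 2) + 4 * s ^ 2) * A :=
        le_mul_of_one_le_right (by positivity) h
      refine le_of_mul_le_mul_left ?_ hA0
      linarith
    linarith

/-- Points of hyperbolic space outside all half spaces over the disks can be moved
into a bounded region. -/
theorem exists_bounded_of_outside (hq : 6 < q) : ∃ M : ℝ, 0 < M ∧ ∀ N : Lorentz, IsFuture N →
    (∀ ω : CoxGroup q hq, lor extVec (rep hq ω N) ≤ 0) →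
    ∃ ω : CoxGroup q hq, -((rep hq ω N).1 + (rep hq ω N).2.2) / 2 ≤ M := by
  obtain ⟨ht, hs, hr, hr1⟩ := par_pos hq
  obtain ⟨e1, e2, e3⟩ := par_relations hq
  set s := sPar q
  set r := rPar q
  refine ⟨1 + (8 * s + 2 * r * (4 + 3 * s ^ 2) + 4 * (4 + 3 * s ^ 2) + 4 * s ^ 2) /
      (2 * s ^ 2 * r ^ 2), by positivity, fun N hN hout => ?_⟩
  set Φ : CoxGroup q hq → ℝ := fun ω => -((rep hq ω N).1 + (rep hq ω N).2.2) / 2 with hΦ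
  have hΦ0 : ∀ ω, 0 ≤ Φ ω := fun ω => by
    have h := hN.rep ω
    have h1 := h.1
    have h2 := h.snd_neg
    simp only [hΦ]; linarith
  have hbdd : BddBelow (range Φ) := ⟨0, by rintro _ ⟨ω, rfl⟩; exact hΦ0 ω⟩
  have hd : 0 < min (2 / s) s := lt_min (by positivity) hs
  -- An almost minimiser is enough, so no discreteness is needed. The tolerance `min (2/s) s` is the
  -- one for which the pairings with the roots of ℓ₂ and ℓ₄ stay at least `-1`.
  obtain ⟨_, ⟨ω₀, rfl⟩, hω₀⟩ := Real.lt_sInf_add_pos (range_nonempty Φ) hd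
  obtain ⟨ω₁, -, ha, hc, h0, h2⟩ := exists_sector hq (rep hq ω₀ N)
  have hmul : ∀ ω ω' : CoxGroup q hq, rep hq (ω * ω') N = rep hq ω (rep hq ω' N) := fun ω ω' => by
    rw [map_mul, Module.End.mul_apply]
  set v := rep hq ω₁ (rep hq ω₀ N) with hv
  have hΦv : -(v.1 + v.2.2) / 2 = Φ ω₀ := by rw [ha, hc]
  have h1 : -1 ≤ lor (root q 1) v := by
    have h3 : sInf (range Φ) ≤ Φ ((coxSystem q hq).simple 1 * (ω₁ * ω₀)) :=
      csInf_le hbdd (mem_range_self _)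
    simp only [hΦ] at h3
    rw [hmul, hmul, ← hv, height_simple_one hq v, hΦv] at h3
    have h4 : -(2 / s) < 2 / s * lor (root q 1) v := by
      linarith [min_le_left (2 / s) s]
    have : 0 < 2 / s := by positivity
    nlinarith
  have h3 : -1 ≤ lor (root q 3) v := by
    have h3 : sInf (range Φ) ≤ Φ ((coxSystem q hq).simple 3 * (ω₁ * ω₀)) :=
      csInf_le hbdd (mem_range_self _)
    simp only [hΦ] at h3
    rw [hmul, hmul, ← hv, height_simple_three hq v, hΦv] at h3
    have h4 : -s < s * lor (root q 3) v := by
      linarith [min_le_right (2 / s) s]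
    nlinarith
  have hfut : IsFuture v := (hN.rep ω₀).rep ω₁
  have hout' := hout (ω₁ * ω₀)
  rw [hmul, ← hv] at hout'
  refine ⟨ω₀, ?_⟩
  change Φ ω₀ ≤ _
  rw [← hΦv]
  have hsec := sector_bound hq h0 h2 h1
  rw [lor_root_three, inv_mul_eq_div, le_div_iff₀ hr] at h3
  have hv3 := hfut.snd_neg
  obtain ⟨hv1, hvv⟩ := hfut
  have hvo : v.1 ≤ v.2.2 := by
    have : lor extVec v = (v.1 - v.2.2) / 2 := by simp [lor_apply, extVec]; ring
    linarith
  have hnn : Complex.normSq v.2.1 = v.1 * v.2.2 - 4 := by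
    rw [Complex.normSq_apply]; rw [lor_apply] at hvv; linarith
  rw [hnn] at hsec
  obtain ⟨A, hA⟩ : ∃ A, A = -v.1 := ⟨_, rfl⟩
  obtain ⟨C, hC⟩ : ∃ C, C = -v.2.2 := ⟨_, rfl⟩
  have hv1' : v.1 = -A := by linarith
  have hv3' : v.2.2 = -C := by linarith
  rw [hv1', hv3'] at hsec h3 hvo ⊢
  have hA0 : 0 < A := by linarith
  have hC0 : 0 < C := by linarith
  have hsec' : (4 + 3 * s ^ 2) * (A * C - 4) ≤ (A + C + 2 * s) ^ 2 := by
    have : (4 + 3 * s ^ 2) * (-A * -C - 4) ≤ (-(-A + -C) + 2 * s) ^ 2 := hsec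
    linarith
  have := outside_bound_aux hs hr hr1 e3 hA0 hC0 (by linarith) (by linarith) hsec'
  linarith

end RoundCarpet

/-! ## The limit set -/

namespace RoundCarpet

open CoxeterReflection

variable {q : ℕ} {hq : 6 < q}

theorem lift_nonpos (z : OnePoint ℂ) : (lift z).1 ≤ 0 ∧ (lift z).2.2 ≤ 0 := by
  induction z using OnePoint.rec with
  | infty => simp [lift_infty]
  | coe z => simp [lift_coe, pt, Complex.normSq_nonneg]

theorem lor_extVec (v : Lorentz) : lor extVec v = (v.1 - v.2.2) / 2 := by
  simp [lor_apply, extVec]; ring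

theorem lor_extVec_pt (z : ℂ) (h : ℝ) : lor extVec (pt z h) = Complex.normSq z + h - 1 := by
  rw [lor_extVec, pt]; ring

theorem lor_pt_pt (z w : ℂ) : lor (pt z 0) (pt w 0) = -2 * Complex.normSq (z - w) := by
  rw [lor_pt]; simp [pt, Complex.normSq_apply]; ring

theorem rep_pt_nonpos (hq : 6 < q) (ω : CoxGroup q hq) (z : ℂ) :
    (rep hq ω (pt z 0)).1 ≤ 0 ∧ (rep hq ω (pt z 0)).2.2 ≤ 0 := by
  obtain ⟨τ, -, hτ⟩ := exists_perm ω
  obtain ⟨l, hl, e⟩ := hτ (z : OnePoint ℂ)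
  have h := lift_nonpos (τ z)
  rw [e, Prod.smul_fst, Prod.smul_snd, Prod.smul_snd, smul_eq_mul, smul_eq_mul] at h
  exact ⟨nonpos_of_mul_nonpos_right h.1 hl, nonpos_of_mul_nonpos_right h.2 hl⟩

theorem null_bound_aux {s A : ℝ} (hs : 0 < s) (hA : 2 ≤ A)
    (h : (4 + 3 * s ^ 2) * (A * (A - 2)) ≤ (A + (A - 2) + 2 * s) ^ 2) :
    A ≤ (10 * s ^ 2 + 8 * s + 4) / (3 * s ^ 2) := by
  rw [le_div_iff₀ (by positivity)]
  have h2 : 3 * s ^ 2 * A ^ 2 ≤ (6 * s ^ 2 + 8 * s) * A + 4 * (s - 1) ^ 2 := by linarith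
  have h3 : 4 * (s - 1) ^ 2 ≤ 4 * (1 + s ^ 2) * A := by nlinarith
  have : A * (A * (3 * s ^ 2)) ≤ A * (10 * s ^ 2 + 8 * s + 4) := by linarith
  exact le_of_mul_le_mul_left this (by linarith)

/-- The triangle group moves every point of the disk into a fixed compact set. -/
theorem exists_bounded_of_disk (hq : 6 < q) : ∃ M : ℝ, ∀ z : ℂ, Complex.normSq z < 1 →
    ∃ ω : CoxGroup q hq, rep hq ω extVec = extVec ∧
      -((rep hq ω (pt z 0)).1 + (rep hq ω (pt z 0)).2.2) / 2 ≤ M * (1 - Complex.normSq z) := by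
  obtain ⟨ht, hs, hr, hr1⟩ := par_pos hq
  refine ⟨(10 * sPar q ^ 2 + 8 * sPar q + 4) / (3 * sPar q ^ 2), fun z hz => ?_⟩
  set d := 1 - Complex.normSq z with hd
  have hd0 : 0 < d := by linarith
  set Ω := {ω : CoxGroup q hq // rep hq ω extVec = extVec}
  set Φ : Ω → ℝ := fun ω => -((rep hq ω (pt z 0)).1 + (rep hq ω (pt z 0)).2.2) / 2 with hΦ
  have : Nonempty Ω := ⟨1, by simp⟩
  have hbdd : BddBelow (range Φ) := ⟨0, by
    rintro _ ⟨ω, rfl⟩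
    have := rep_pt_nonpos hq ω z
    simp only [hΦ]; linarith⟩
  -- Only group elements fixing `extVec` compete here, so the pairing `-d` with `extVec` is kept.
  -- The tolerance is proportional to `d`, so that it becomes a constant after rescaling.
  obtain ⟨_, ⟨⟨ω₀, hω₀e⟩, rfl⟩, hω₀⟩ := Real.lt_sInf_add_pos (range_nonempty Φ)
    (by positivity : 0 < 2 / sPar q * d)
  obtain ⟨ω₁, hω₁e, ha, hc, h0, h2⟩ := exists_sector hq (rep hq ω₀ (pt z 0))
  have hmul : ∀ (ω ω' : CoxGroup q hq) v, rep hq (ω * ω') v = rep hq ω (rep hq ω' v) :=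
    fun ω ω' v => by rw [map_mul, Module.End.mul_apply]
  have hnull := lor_rep hq (ω₁ * ω₀) (pt z 0) (pt z 0)
  have hext := lor_rep hq (ω₁ * ω₀) extVec (pt z 0)
  have hneg := rep_pt_nonpos hq (ω₁ * ω₀) z
  rw [hmul] at hnull hneg
  rw [hmul, hω₀e, hω₁e, hmul, lor_extVec_pt, lor_extVec] at hext
  rw [lor_pt_pt, sub_self, map_zero, mul_zero] at hnull
  set v := rep hq ω₁ (rep hq ω₀ (pt z 0)) with hv
  have hΦv : -(v.1 + v.2.2) / 2 = Φ ⟨ω₀, hω₀e⟩ := by rw [ha, hc]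
  have h1 : -d ≤ lor (root q 1) v := by
    have hst : rep hq ((coxSystem q hq).simple 1 * (ω₁ * ω₀)) extVec = extVec := by
      rw [hmul, hmul, hω₀e, hω₁e, rep_simple, refl_apply, lor_root_extVec hq]; simp
    have h3 : sInf (range Φ) ≤ Φ ⟨(coxSystem q hq).simple 1 * (ω₁ * ω₀), hst⟩ :=
      csInf_le hbdd (mem_range_self _)
    simp only [hΦ] at h3
    rw [hmul, hmul, ← hv, height_simple_one hq v, hΦv] at h3
    have h5 : 0 < 2 / sPar q := by positivity
    have h4 : 2 / sPar q * (-d) < 2 / sPar q * lor (root q 1) v := by linarith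
    exact (lt_of_mul_lt_mul_left h4 h5.le).le
  refine ⟨ω₀, hω₀e, ?_⟩
  change Φ ⟨ω₀, hω₀e⟩ ≤ _
  rw [← hΦv]
  have hsc : ∀ i, lor (root q i) (d⁻¹ • v) = d⁻¹ * lor (root q i) v := fun i => by
    rw [map_smul, smul_eq_mul]
  -- Division by `d` normalises the lightlike vector to pairing `-1` with `extVec`; in the notation
  -- below its coordinates are then `-A` and `-(A - 2)`, and a single unknown is left to bound.
  have hsec := sector_bound hq (v := d⁻¹ • v) (by rw [hsc]; positivity) (by rw [hsc]; positivity)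
    (by rw [hsc, inv_mul_eq_div, le_div_iff₀ hd0]; linarith)
  have hn : Complex.normSq v.2.1 = v.1 * v.2.2 := by
    rw [lor_apply] at hnull; rw [Complex.normSq_apply]; linarith
  rw [Prod.smul_fst, Prod.smul_snd, Prod.smul_snd, Prod.smul_fst, Complex.real_smul, map_mul,
    Complex.normSq_ofReal, hn, smul_eq_mul, smul_eq_mul] at hsec
  obtain ⟨A, hA⟩ : ∃ A, A = -(d⁻¹ * v.1) := ⟨_, rfl⟩
  have hv1 : v.1 = -(d * A) := by rw [hA]; field_simp
  have hv3 : d⁻¹ * v.2.2 = -(A - 2) := by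
    have : v.2.2 = 2 * d + v.1 := by linarith
    rw [this, hA]; field_simp; ring
  have hA2 : 2 ≤ A := by
    have : d⁻¹ * v.2.2 ≤ 0 := mul_nonpos_of_nonneg_of_nonpos (by positivity) hneg.2
    linarith
  have hsec' : (4 + 3 * sPar q ^ 2) * (A * (A - 2)) ≤ (A + (A - 2) + 2 * sPar q) ^ 2 := by
    have e1 : d⁻¹ * d⁻¹ * (v.1 * v.2.2) = A * (A - 2) := by
      have : d⁻¹ * d⁻¹ * (v.1 * v.2.2) = (d⁻¹ * v.1) * (d⁻¹ * v.2.2) := by ring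
      rw [this, hv3, hA]; ring
    have e2 : d⁻¹ * v.1 = -A := by rw [hA]; ring
    rw [e1, hv3, e2] at hsec
    linarith
  have hfin := null_bound_aux hs hA2 hsec'
  have hv3' : v.2.2 = d * -(A - 2) := by rw [← hv3]; field_simp
  calc -(v.1 + v.2.2) / 2 = A * d - d := by rw [hv1, hv3']; ring
    _ ≤ A * d := by linarith
    _ ≤ _ := mul_le_mul_of_nonneg_right hfin hd0.le

/-- A point that is not in the open unit disk is thrown into it by the inversion in ℓ₄, because `r <
1`. -/
theorem exists_mem_disk (hq : 6 < q) {A : Set (OnePoint ℂ)} (hne : A.Nonempty)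
    (hA : ∀ τ ∈ groupG q, τ '' A ⊆ A) : ∃ a : ℂ, Complex.normSq a < 1 ∧ (a : OnePoint ℂ) ∈ A := by
  obtain ⟨ht, hs, hr, hr1⟩ := par_pos hq
  obtain ⟨x, hx⟩ := hne
  have h4 : gen q 3 x ∈ A := hA _ (gen_mem 3) (mem_image_of_mem _ hx)
  obtain ⟨l, hl, e⟩ := gen_actsAs (hq := hq) 3 x
  have key : ∀ y : OnePoint ℂ, lor extVec (lift y) < 0 → y ∈ A →
      ∃ a : ℂ, Complex.normSq a < 1 ∧ (a : OnePoint ℂ) ∈ A := by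
    intro y hy hyA
    induction y using OnePoint.rec with
    | infty => rw [lift_infty, lor_extVec] at hy; norm_num at hy
    | coe z => rw [lift_coe, lor_extVec_pt] at hy; exact ⟨z, by linarith, hyA⟩
  rcases lt_or_ge (lor extVec (lift x)) 0 with h | h
  · exact key x h hx
  · refine key _ ?_ h4
    rw [e, map_smul, smul_eq_mul]
    refine mul_neg_of_pos_of_neg hl ?_
    rw [rep_simple, refl_apply, map_sub, map_smul, lor_comm extVec (root q 3),
      lor_root_extVec hq, lor_root_three]
    simp only [Matrix.cons_val, smul_eq_mul]
    obtain ⟨h1, h2⟩ := lift_nonpos x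
    have hns : (lift x).1 - (lift x).2.2 ≥ 0 := by rw [lor_extVec] at h; linarith
    have h0 : (lift x).2.2 < 0 := by
      rcases h2.lt_or_eq with h | h
      · exact h
      · exfalso
        induction x using OnePoint.rec with
        | infty => rw [lift_infty] at h; norm_num at h
        | coe z =>
          rw [h, lift_coe] at hns
          simp [pt] at hns
          linarith
    rw [lor_extVec]
    have : ((lift x).1 - (lift x).2.2) / 2 - 2 * ((rPar q)⁻¹ *
        ((rPar q ^ 2 * (lift x).1 - (lift x).2.2) / 2)) * ((1 + rPar q ^ 2) / (2 * rPar q)) =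
        ((lift x).2.2 - rPar q ^ 4 * (lift x).1) / (2 * rPar q ^ 2) := by
      field_simp; ring
    rw [this]
    apply div_neg_of_neg_of_pos _ (by positivity)
    have hr4 : rPar q ^ 4 < 1 := pow_lt_one₀ hr.le hr1 (by norm_num)
    nlinarith [pow_pos hr 4]

/-- Cauchy–Schwarz together with `|b|² = a c ≤ ((a + c)/2)²`, which holds for lightlike vectors. -/
theorem lor_pt_ge {a : ℂ} (ha : Complex.normSq a ≤ 1) {v : Lorentz} (hv : lor v v = 0)
    (h1 : v.1 ≤ 0) (h3 : v.2.2 ≤ 0) : 2 * (v.1 + v.2.2) ≤ lor v (pt a 0) := by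
  rw [lor_pt]
  rw [lor_apply] at hv
  have hc : (v.2.1.re * a.re + v.2.1.im * a.im) ^ 2 ≤ (-(v.1 + v.2.2) / 2) ^ 2 := by
    rw [Complex.normSq_apply] at ha
    have e : (v.2.1.re * a.re + v.2.1.im * a.im) ^ 2 ≤
        (v.2.1.re * v.2.1.re + v.2.1.im * v.2.1.im) * (a.re * a.re + a.im * a.im) := by
      nlinarith [sq_nonneg (v.2.1.re * a.im - v.2.1.im * a.re)]
    have e2 : (v.2.1.re * v.2.1.re + v.2.1.im * v.2.1.im) * (a.re * a.re + a.im * a.im) ≤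
        (v.2.1.re * v.2.1.re + v.2.1.im * v.2.1.im) * 1 :=
      mul_le_mul_of_nonneg_left ha (add_nonneg (mul_self_nonneg _) (mul_self_nonneg _))
    nlinarith [sq_nonneg (v.1 - v.2.2)]
  have := (abs_le_of_sq_le_sq' hc (by linarith)).1
  have h4 : v.1 ≤ v.1 * (Complex.normSq a + 0) := by nlinarith [Complex.normSq_nonneg a]
  linarith

/-- Every nonempty closed invariant set contains the unit circle. -/
theorem circle_subset (hq : 6 < q) {A : Set (OnePoint ℂ)} (hcl : IsClosed A) (hne : A.Nonempty)
    (hA : ∀ τ ∈ groupG q, τ '' A ⊆ A) {ζ : ℂ} (hζ : ‖ζ‖ = 1) : (ζ : OnePoint ℂ) ∈ A := by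
  obtain ⟨a, ha, haA⟩ := exists_mem_disk hq hne hA
  obtain ⟨M, hM⟩ := exists_bounded_of_disk hq
  have hcl' : IsClosed ((fun z : ℂ => (z : OnePoint ℂ)) ⁻¹' A) :=
    hcl.preimage OnePoint.continuous_coe
  -- The group element that moves `z` into a compact part of the disk has an inverse that moves the
  -- fixed point `a` close to `z`, with squared distance of order `1 - |z|²`. Letting `z` tend to
  -- `ζ` shows that the orbit of `a` accumulates at `ζ`.
  have key : ∀ z : ℂ, Complex.normSq z < 1 → ∃ a' : ℂ, (a' : OnePoint ℂ) ∈ A ∧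
      Complex.normSq (z - a') ≤ 2 * M / (1 - Complex.normSq a) * (1 - Complex.normSq z) := by
    intro z hz
    obtain ⟨ω, hωe, hω⟩ := hM z hz
    obtain ⟨τ, hτ, hact⟩ := exists_perm ω⁻¹
    obtain ⟨l, hl, e⟩ := hact (a : OnePoint ℂ)
    have hωe' : rep hq ω⁻¹ extVec = extVec := by
      nth_rewrite 1 [← hωe]; rw [rep_inv_apply]
    have e1 : lor extVec (lift (τ a)) = l * (Complex.normSq a - 1) := by
      rw [e, map_smul, lift_coe]
      nth_rewrite 1 [← hωe']
      rw [lor_rep, lor_extVec_pt, smul_eq_mul, add_zero]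
    have hmem : τ a ∈ A := hA _ hτ (mem_image_of_mem _ haA)
    obtain ⟨a', ha'⟩ : ∃ a' : ℂ, τ a = (a' : OnePoint ℂ) := by
      generalize τ a = y at e1
      induction y using OnePoint.rec with
      | infty =>
        rw [lift_infty, lor_extVec] at e1
        nlinarith
      | coe y => exact ⟨y, rfl⟩
    rw [ha', lift_coe, lor_extVec_pt, add_zero] at e1
    refine ⟨a', ha' ▸ hmem, ?_⟩
    have e2 : lor (pt z 0) (lift (τ a)) = l * lor (rep hq ω (pt z 0)) (pt a 0) := by
      rw [e, map_smul, lift_coe, smul_eq_mul, lor_rep_left]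
    rw [ha', lift_coe, lor_pt_pt] at e2
    have hneg := rep_pt_nonpos hq ω z
    have h3 := lor_pt_ge ha.le (v := rep hq ω (pt z 0))
      (by rw [lor_rep, lor_pt_pt, sub_self]; simp) hneg.1 hneg.2
    have hl1 : l ≤ 1 / (1 - Complex.normSq a) := by
      rw [le_div_iff₀ (by linarith)]
      have := Complex.normSq_nonneg a'
      nlinarith
    have h4 := mul_le_mul_of_nonneg_left h3 hl.le
    have h5 : Complex.normSq (z - a') ≤ l * (2 * (M * (1 - Complex.normSq z))) := by
      have := mul_le_mul_of_nonneg_left hω hl.le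
      linarith
    have h6 : 0 ≤ M * (1 - Complex.normSq z) := le_trans (by linarith) hω
    calc _ ≤ l * (2 * (M * (1 - Complex.normSq z))) := h5
      _ ≤ 1 / (1 - Complex.normSq a) * (2 * (M * (1 - Complex.normSq z))) :=
        mul_le_mul_of_nonneg_right hl1 (by positivity)
      _ = _ := by ring
  choose! f hfA hf using key
  set z : ℕ → ℂ := fun n => ((1 - 1 / ((n : ℝ) + 1) : ℝ) : ℂ) * ζ with hz
  have hζn : Complex.normSq ζ = 1 := by rw [Complex.normSq_eq_norm_sq, hζ, one_pow]
  have hlim0 : Tendsto (fun n : ℕ => (1 - 1 / ((n : ℝ) + 1) : ℝ)) atTop (𝓝 1) := by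
    simpa using tendsto_one_div_add_atTop_nhds_zero_nat.const_sub (1 : ℝ)
  have hzlim : Tendsto z atTop (𝓝 ζ) := by
    have := ((Complex.continuous_ofReal.tendsto _).comp hlim0).mul_const ζ
    simpa [hz] using this
  have hzn : ∀ n, Complex.normSq (z n) < 1 := fun n => by
    simp only [hz, map_mul, hζn, mul_one, Complex.normSq_ofReal]
    have h1 : 0 < 1 / ((n : ℝ) + 1) := by positivity
    have h2 : 1 / ((n : ℝ) + 1) ≤ 1 := by
      rw [div_le_one (by positivity)]; linarith [(Nat.cast_nonneg n : (0 : ℝ) ≤ n)]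
    nlinarith
  have hsq : Tendsto (fun n => Complex.normSq (z n - f (z n))) atTop (𝓝 0) := by
    have h1 : Tendsto (fun n => 2 * M / (1 - Complex.normSq a) * (1 - Complex.normSq (z n))) atTop
        (𝓝 0) := by
      have := (((Complex.continuous_normSq.tendsto _).comp hzlim).const_sub 1).const_mul
        (2 * M / (1 - Complex.normSq a))
      simpa [hζn] using this
    exact squeeze_zero (fun n => Complex.normSq_nonneg _) (fun n => hf _ (hzn n)) h1
  have hdiff : Tendsto (fun n => z n - f (z n)) atTop (𝓝 0) := by
    rw [tendsto_zero_iff_norm_tendsto_zero]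
    have := (Real.continuous_sqrt.tendsto _).comp hsq
    simp only [Real.sqrt_zero] at this
    refine this.congr fun n => ?_
    simp only [Function.comp, Complex.normSq_eq_norm_sq]
    rw [Real.sqrt_sq (norm_nonneg _)]
  have hflim : Tendsto (fun n => f (z n)) atTop (𝓝 ζ) := by
    have := hzlim.sub hdiff
    simpa using this
  exact hcl'.mem_of_tendsto hflim (Eventually.of_forall fun n => hfA _ (hzn n))

theorem circle_subset_limitSet (hq : 6 < q) {ζ : ℂ} (hζ : ‖ζ‖ = 1) :
    (ζ : OnePoint ℂ) ∈ limitSet (groupG q) := by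
  rintro A ⟨hcl, hne, hA⟩
  exact circle_subset hq hcl hne hA hζ

theorem isClosed_limitSet (G : Subgroup (Equiv.Perm (OnePoint ℂ))) : IsClosed (limitSet G) :=
  isClosed_sInter fun _ hA => hA.1

theorem limitSet_invariant {G : Subgroup (Equiv.Perm (OnePoint ℂ))} {τ : Equiv.Perm (OnePoint ℂ)}
    (hτ : τ ∈ G) {x : OnePoint ℂ} (hx : x ∈ limitSet G) : τ x ∈ limitSet G := by
  rintro A hA
  exact hA.2.2 τ hτ (mem_image_of_mem _ (hx A hA))

/-! ## Disks -/

/-- The centre of the disk of `w`. -/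
noncomputable def ctr (w : Lorentz) : ℂ := (-w.1⁻¹ : ℝ) • w.2.1

/-- The radius of the disk of `w`. -/
noncomputable def rad (w : Lorentz) : ℝ := √(lor w w) / (-w.1)

/-- Completing the square. As `w.1` is negative, positive pairing means being inside the disk. -/
theorem lor_pt_eq_disk {w : Lorentz} (h1 : w.1 < 0) (h2 : 0 < lor w w) (z : ℂ) (h : ℝ) :
    lor w (pt z h) = w.1 * (‖z - ctr w‖ ^ 2 + h - rad w ^ 2) := by
  have hR : rad w ^ 2 = lor w w / w.1 ^ 2 := by
    rw [rad, div_pow, Real.sq_sqrt h2.le, neg_sq]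
  rw [hR, ← Complex.normSq_eq_norm_sq, lor_pt]
  rw [lor_apply]
  simp only [ctr, Complex.normSq_apply, Complex.sub_re, Complex.sub_im, Complex.smul_re,
    Complex.smul_im, smul_eq_mul]
  have := h1.ne
  field_simp
  ring

theorem rad_pos {w : Lorentz} (h1 : w.1 < 0) (h2 : 0 < lor w w) : 0 < rad w :=
  div_pos (Real.sqrt_pos.mpr h2) (by linarith)

theorem lor_lift_pos_iff {w : Lorentz} (h1 : w.1 < 0) (h2 : 0 < lor w w) (z : OnePoint ℂ) :
    0 < lor w (lift z) ↔ z ∈ (fun z : ℂ => (z : OnePoint ℂ)) '' Metric.ball (ctr w) (rad w) := by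
  induction z using OnePoint.rec with
  | infty =>
    rw [lift_infty, lor_apply]
    simp
    linarith
  | coe z =>
    rw [lift_coe, lor_pt_eq_disk h1 h2, add_zero, OnePoint.coe_injective.mem_set_image,
      mem_ball_iff_norm]
    constructor
    · intro h
      have := neg_of_mul_pos_right h h1.le
      exact lt_of_pow_lt_pow_left₀ 2 (rad_pos h1 h2).le (by linarith)
    · intro h
      have := pow_lt_pow_left₀ h (norm_nonneg _) two_ne_zero
      exact mul_pos_of_neg_of_neg h1 (by linarith)

theorem lor_pt_nonneg_iff {w : Lorentz} (h1 : w.1 < 0) (h2 : 0 < lor w w) (z : ℂ) :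
    0 ≤ lor w (pt z 0) ↔ z ∈ Metric.closedBall (ctr w) (rad w) := by
  rw [lor_pt_eq_disk h1 h2, add_zero, mem_closedBall_iff_norm]
  constructor
  · intro h
    have : ‖z - ctr w‖ ^ 2 - rad w ^ 2 ≤ 0 := by
      by_contra hc
      push Not at hc
      have := mul_neg_of_neg_of_pos h1 hc
      linarith
    exact le_of_sq_le_sq (by linarith) (rad_pos h1 h2).le
  · intro h
    have := pow_le_pow_left₀ (norm_nonneg _) h 2
    exact mul_nonneg_of_nonpos_of_nonpos h1.le (by linarith)

theorem lor_pt_zero_iff {w : Lorentz} (h1 : w.1 < 0) (h2 : 0 < lor w w) (z : ℂ) :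
    lor w (pt z 0) = 0 ↔ z ∈ Metric.sphere (ctr w) (rad w) := by
  rw [lor_pt_eq_disk h1 h2, add_zero, mem_sphere_iff_norm, mul_eq_zero, or_iff_right h1.ne,
    sub_eq_zero]
  exact pow_left_inj₀ (norm_nonneg _) (rad_pos h1 h2).le two_ne_zero

theorem lor_rep_extVec_self (hq : 6 < q) (ω : CoxGroup q hq) :
    0 < lor (rep hq ω extVec) (rep hq ω extVec) := by
  rw [lor_rep, lor_extVec_self]; exact one_pos

theorem mem_exterior_iff (z : OnePoint ℂ) : z ∈ closedUnitDiskᶜ ↔ 0 < lor extVec (lift z) := by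
  induction z using OnePoint.rec with
  | infty =>
    rw [lift_infty, lor_extVec]
    simp [closedUnitDisk]
  | coe z =>
    rw [lift_coe, lor_extVec_pt, mem_compl_iff, closedUnitDisk,
      OnePoint.coe_injective.mem_set_image, mem_closedBall_zero_iff, Complex.normSq_eq_norm_sq,
      not_le]
    constructor
    · intro h; nlinarith
    · intro h
      by_contra hc
      push Not at hc
      nlinarith [norm_nonneg z]

/-- The points outside all images of the exterior of the unit disk. -/
def outerSet (hq : 6 < q) : Set (OnePoint ℂ) :=
  {z | ∀ ω : CoxGroup q hq, lor (rep hq ω extVec) (lift z) ≤ 0}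

theorem isOpen_exterior : IsOpen (closedUnitDiskᶜ : Set (OnePoint ℂ)) := by
  rw [closedUnitDisk, OnePoint.isOpen_compl_image_coe]
  exact ⟨Metric.isClosed_closedBall, isCompact_closedBall _ _⟩

theorem isClosed_outerSet (hq : 6 < q) : IsClosed (outerSet hq) := by
  have : outerSet hq = ⋂ ω : CoxGroup q hq, {z | 0 < lor (rep hq ω extVec) (lift z)}ᶜ := by
    ext z; simp [outerSet]
  rw [this]
  refine isClosed_iInter fun ω => ?_
  rw [isClosed_compl_iff]
  rcases rep_extVec hq ω with h | ⟨h, -⟩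
  · rw [h]
    convert isOpen_exterior using 1
    ext z; exact (mem_exterior_iff z).symm
  · have : {z | 0 < lor (rep hq ω extVec) (lift z)} = (fun z : ℂ => (z : OnePoint ℂ)) ''
        Metric.ball (ctr (rep hq ω extVec)) (rad (rep hq ω extVec)) := by
      ext z; exact lor_lift_pos_iff h (lor_rep_extVec_self hq ω) z
    rw [this]
    exact OnePoint.isOpenEmbedding_coe.isOpenMap _ Metric.isOpen_ball

/-- The outer set is one of the competitors in the definition of the limit set. It is invariant
because the group permutes the vectors `rep hq ω extVec`, and it contains the point 1 because the
remaining disks lie strictly inside the unit circle. -/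
theorem limitSet_subset_outerSet (hq : 6 < q) : limitSet (groupG q) ⊆ outerSet hq := by
  refine sInter_subset_of_mem ⟨isClosed_outerSet hq, ⟨((1 : ℂ) : OnePoint ℂ), fun ω => ?_⟩, ?_⟩
  · rcases rep_extVec hq ω with h | ⟨h, h'⟩
    · rw [h, lift_coe, lor_extVec_pt]; simp
    · have := Complex.abs_re_le_norm (rep hq ω extVec).2.1
      have h4 := lor_rep hq ω extVec extVec
      rw [lor_extVec_self, lor_apply] at h4
      set w := rep hq ω extVec
      rw [lift_coe, lor_pt]
      simp only [map_one, Complex.one_re, Complex.one_im, mul_one, mul_zero, add_zero]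
      have h5 : w.2.1.re * w.2.1.re + w.2.1.im * w.2.1.im = ‖w.2.1‖ ^ 2 := by
        rw [← Complex.normSq_eq_norm_sq, Complex.normSq_apply]
      rw [h5] at h4
      have h6 : w.2.1.re ≤ ‖w.2.1‖ := le_trans (le_abs_self _) this
      have h7 : w.1 * (w.1 + 2 * ‖w.2.1‖ + w.2.2) = (w.1 + ‖w.2.1‖) ^ 2 - 1 := by linarith
      have h8 : 0 < (w.1 + ‖w.2.1‖) ^ 2 - 1 := by nlinarith
      rw [← h7] at h8
      have := neg_of_mul_pos_right h8 h.le
      linarith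
  · rintro τ hτ _ ⟨z, hz, rfl⟩ ω
    obtain ⟨ω', hω'⟩ := exists_actsAs (hq := hq) hτ
    obtain ⟨l, hl, e⟩ := hω' z
    rw [e, map_smul, smul_eq_mul, lor_comm, lor_rep_left, lor_comm, ← Module.End.mul_apply,
      ← map_mul]
    exact mul_nonpos_of_nonneg_of_nonpos hl.le (hz _)

end RoundCarpet

/-! ## Porosity and area of the limit set -/

namespace RoundCarpet

open CoxeterReflection

variable {q : ℕ} {hq : 6 < q}

/-- Near every point of the disk outside all disks there are disks of comparable size at all
small scales. -/
theorem exists_near_disk (hq : 6 < q) : ∃ M : ℝ, 0 < M ∧ ∀ z : ℂ, ‖z‖ < 1 →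
    (z : OnePoint ℂ) ∈ outerSet hq → ∃ r₀ : ℝ, 0 < r₀ ∧ ∀ r : ℝ, 0 < r → r < r₀ →
      ∃ ω : CoxGroup q hq, rep hq ω extVec ≠ extVec ∧ r / M ≤ rad (rep hq ω extVec) ∧
        rad (rep hq ω extVec) ≤ ‖z - ctr (rep hq ω extVec)‖ ∧
        ‖z - ctr (rep hq ω extVec)‖ ≤ rad (rep hq ω extVec) + M * r := by
  obtain ⟨M, hM0, hM⟩ := exists_bounded_of_outside hq
  refine ⟨M, hM0, fun z hz hout => ?_⟩
  have hz2 : ‖z‖ ^ 2 < 1 := by nlinarith [norm_nonneg z]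
  -- This bound on `r` pushes the pairing of the point over `z` with `extVec` below `-M r`, so the
  -- disk found below cannot be the exterior itself.
  refine ⟨min 1 ((1 - ‖z‖ ^ 2) / (M + 1)),
    lt_min one_pos (div_pos (by linarith) (by linarith)), fun r hr hr0 => ?_⟩
  have hr1 : r < 1 := lt_of_lt_of_le hr0 (min_le_left _ _)
  have hr2 : r * (M + 1) < 1 - ‖z‖ ^ 2 := by
    rw [← lt_div_iff₀ (by linarith)]; exact lt_of_lt_of_le hr0 (min_le_right _ _)
  have hrr : r ^ 2 ≤ r := by nlinarith
  have hneg : lor extVec (pt z (r ^ 2)) < -(M * r) := by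
    rw [lor_extVec_pt, Complex.normSq_eq_norm_sq]; linarith
  have hsmul : ∀ u : Lorentz, lor u (r⁻¹ • pt z (r ^ 2)) = r⁻¹ * lor u (pt z (r ^ 2)) := fun u => by
    rw [map_smul, smul_eq_mul]
  have hlow : ∀ u : Lorentz, lor u (pt z (r ^ 2)) = lor u (pt z 0) + u.1 * r ^ 2 := fun u => by
    rw [lor_pt, lor_pt]; ring
  -- The normalised vector of the point of hyperbolic space at Euclidean height `r` over `z`. It is
  -- outside all half spaces over the disks because `z` is outside all disks, so
  -- `exists_bounded_of_outside` applies to it.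
  have hfut : IsFuture (r⁻¹ • pt z (r ^ 2)) := by
    constructor
    · rw [Prod.smul_fst, smul_eq_mul]
      exact mul_neg_of_pos_of_neg (by positivity) (by simp [pt])
    · rw [hsmul, map_smul, LinearMap.smul_apply, smul_eq_mul, lor_apply]
      simp [pt, Complex.normSq_apply]
      field_simp
      ring
  obtain ⟨ω, hω⟩ := hM _ hfut (fun ω => by
    rw [lor_comm, lor_rep_left, lor_comm, hsmul]
    refine mul_nonpos_of_nonneg_of_nonpos (by positivity) ?_
    rcases rep_extVec hq ω⁻¹ with h | ⟨h, -⟩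
    · rw [h]; nlinarith
    · rw [hlow]
      have := hout ω⁻¹
      rw [lift_coe] at this
      nlinarith)
  have h3 := (hfut.rep (hq := hq) ω).snd_neg
  -- After the move the point is at bounded depth below the half space of `extVec`. Transported back
  -- by `ω⁻¹` this says that a disk of radius at least `r/M` comes within `M r` of `z`.
  have h4 : -M ≤ lor extVec (rep hq ω (r⁻¹ • pt z (r ^ 2))) := by
    rw [lor_extVec]; linarith
  rw [lor_comm, lor_rep_left, lor_comm, hsmul, inv_mul_eq_div, le_div_iff₀ hr] at h4
  refine ⟨ω⁻¹, fun h => ?_, ?_⟩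
  · rw [h] at h4; linarith
  obtain h | ⟨h, h'⟩ := rep_extVec hq ω⁻¹
  · rw [h] at h4; linarith
  have hpos := lor_rep_extVec_self hq ω⁻¹
  have h1 : lor (rep hq ω⁻¹ extVec) (rep hq ω⁻¹ extVec) = 1 := by rw [lor_rep, lor_extVec_self]
  have hz0 := hout ω⁻¹
  rw [lift_coe] at hz0
  rw [lor_pt_eq_disk h hpos] at h4 hz0
  set w := rep hq ω⁻¹ extVec with hw
  have hR := rad_pos h hpos
  have hRa : rad w * (-w.1) = 1 := by
    rw [rad, h1, Real.sqrt_one]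
    have : -w.1 ≠ 0 := by linarith
    rw [one_div, inv_mul_cancel₀ this]
  have hRz : rad w ≤ ‖z - ctr w‖ := by
    have : 0 ≤ ‖z - ctr w‖ ^ 2 + 0 - rad w ^ 2 := by
      by_contra hc
      push Not at hc
      have := mul_pos_of_neg_of_neg h hc
      linarith
    exact le_of_sq_le_sq (by linarith) (norm_nonneg _)
  have h5 : ‖z - ctr w‖ ^ 2 + r ^ 2 - rad w ^ 2 ≤ rad w * (M * r) := by
    have := mul_le_mul_of_nonneg_left h4 hR.le
    have e : rad w * (w.1 * (‖z - ctr w‖ ^ 2 + r ^ 2 - rad w ^ 2)) =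
        -(rad w * (-w.1)) * (‖z - ctr w‖ ^ 2 + r ^ 2 - rad w ^ 2) := by ring
    rw [e, hRa] at this
    linarith
  refine ⟨?_, hRz, ?_⟩
  · rw [div_le_iff₀ hM0]
    have : rad w ^ 2 ≤ ‖z - ctr w‖ ^ 2 := pow_le_pow_left₀ hR.le hRz 2
    have : r * r ≤ r * (rad w * M) := by linarith
    exact le_of_mul_le_mul_left this hr
  · refine le_of_sq_le_sq ?_ (by positivity)
    nlinarith [mul_pos hR (mul_pos hM0 hr), sq_nonneg (M * r), sq_nonneg r]

/-- The part of the disk outside all disks has area zero. -/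
theorem volume_outerSet (hq : 6 < q) :
    volume {z : ℂ | ‖z‖ < 1 ∧ (z : OnePoint ℂ) ∈ outerSet hq} = 0 := by
  obtain ⟨M, hM0, hM⟩ := exists_near_disk hq
  set S := {z : ℂ | ‖z‖ < 1 ∧ (z : OnePoint ℂ) ∈ outerSet hq} with hS
  have hdens := Besicovitch.ae_tendsto_measure_inter_div (volume : Measure ℂ) S
  have hfalse : ∀ z ∈ S, ¬ Tendsto (fun r => volume (S ∩ Metric.closedBall z r) /
      volume (Metric.closedBall z r)) (𝓝[>] 0) (𝓝 1) := by
    rintro z ⟨hz1, hz2⟩ hlim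
    obtain ⟨r₀, hr₀, hr⟩ := hM z hz1 hz2
    -- A ball of radius `r/M` inside the disk has its centre within `M r + r/M` of `z`, so it fits
    -- into the ball of radius `K r` about `z`; `θ` is the ratio of the two areas.
    set K := M + 2 / M with hK
    have hK0 : 0 < K := by positivity
    set θ : ℝ := (1 / (M * K)) ^ 2 with hθ
    have hθ0 : 0 < θ := by positivity
    have hev : ∀ᶠ r in 𝓝[>] (0 : ℝ), volume (S ∩ Metric.closedBall z r) /
        volume (Metric.closedBall z r) ≤ ENNReal.ofReal (1 - θ) := by
      have : Ioo (0 : ℝ) (K * r₀) ∈ 𝓝[>] (0 : ℝ) := Ioo_mem_nhdsGT (by positivity)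
      filter_upwards [this] with t ht
      set r := t / K with hrt
      have hr0 : 0 < r := div_pos ht.1 hK0
      have htK : t = K * r := by rw [hrt]; field_simp
      obtain ⟨ω, hω, h1, h2, h3⟩ := hr r hr0 (by rw [hrt, div_lt_iff₀ hK0]; linarith [ht.2])
      obtain h | ⟨h, -⟩ := rep_extVec hq ω
      · exact absurd h hω
      have hpos := lor_rep_extVec_self hq ω
      set w := rep hq ω extVec with hw
      set R := rad w
      set m := ctr w
      have hR : 0 < R := rad_pos h hpos
      set D := ‖z - m‖ with hD
      have hD0 : 0 < D := lt_of_lt_of_le hR h2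
      have hrM : 0 < r / M := by positivity
      -- a ball of radius `r / M` inside the disk, close to `z`
      set c : ℂ := m + ((R - r / M) / D : ℝ) • (z - m) with hc
      have hcm : ‖c - m‖ = R - r / M := by
        rw [hc, add_sub_cancel_left, norm_smul, Real.norm_eq_abs, abs_div, abs_of_pos hD0,
          abs_of_nonneg (by linarith), ← hD]
        field_simp
      have hcz : ‖c - z‖ ≤ M * r + r / M := by
        have : c - z = ((R - r / M) / D - 1 : ℝ) • (z - m) := by
          rw [hc, sub_smul, one_smul]; ring
        rw [this, norm_smul, Real.norm_eq_abs, ← hD]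
        have hle : (R - r / M) / D - 1 ≤ 0 := by
          rw [sub_nonpos, div_le_one hD0]; linarith
        rw [abs_of_nonpos hle]
        have : -((R - r / M) / D - 1) * D = D - (R - r / M) := by field_simp; ring
        rw [this]; linarith
      have hsub : Metric.ball c (r / M) ⊆ Metric.closedBall z t := by
        intro y hy
        rw [mem_ball_iff_norm] at hy
        rw [mem_closedBall_iff_norm, htK, hK]
        have : ‖y - z‖ ≤ ‖y - c‖ + ‖c - z‖ := by
          have := norm_add_le (y - c) (c - z); rwa [sub_add_sub_cancel] at this
        have e : (M + 2 / M) * r = M * r + r / M + r / M := by ring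
        rw [e]; linarith
      have hdis : Disjoint (Metric.ball c (r / M)) (S ∩ Metric.closedBall z t) := by
        rw [Set.disjoint_left]
        rintro y hy ⟨⟨-, hyS⟩, -⟩
        have h5 := hyS ω
        rw [← hw] at h5
        have : (y : OnePoint ℂ) ∈ (fun z : ℂ => (z : OnePoint ℂ)) '' Metric.ball m R := by
          refine mem_image_of_mem _ ?_
          rw [mem_ball_iff_norm] at hy ⊢
          have := norm_add_le (y - c) (c - m)
          rw [sub_add_sub_cancel] at this
          linarith
        have := (lor_lift_pos_iff h hpos _).mpr this
        linarith
      have hvol : volume (Metric.ball c (r / M)) =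
          ENNReal.ofReal θ * volume (Metric.closedBall z t) := by
        rw [Complex.volume_ball, Complex.volume_closedBall, ← mul_assoc,
          ← ENNReal.ofReal_pow hrM.le, ← ENNReal.ofReal_pow ht.1.le, ← ENNReal.ofReal_mul hθ0.le]
        congr 2
        rw [hθ, htK]; field_simp
      have hfin : volume (Metric.closedBall z t) ≠ ⊤ := measure_closedBall_lt_top.ne
      have hpos' : volume (Metric.closedBall z t) ≠ 0 := (Metric.measure_closedBall_pos _ _ ht.1).ne'
      rw [ENNReal.div_le_iff hpos' hfin]
      have hle : volume (Metric.ball c (r / M)) + volume (S ∩ Metric.closedBall z t) ≤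
          volume (Metric.closedBall z t) := by
        rw [← measure_union' hdis Metric.isOpen_ball.measurableSet]
        exact measure_mono (union_subset hsub inter_subset_right)
      rw [hvol] at hle
      have hθ1 : θ ≤ 1 := by
        by_contra hcon
        push Not at hcon
        have h6 : ENNReal.ofReal θ * volume (Metric.closedBall z t) ≤
          volume (Metric.closedBall z t) := le_trans le_self_add hle
        have h7 : 1 < ENNReal.ofReal θ := by rwa [ENNReal.one_lt_ofReal]
        have := ENNReal.mul_lt_mul_left hpos' hfin h7
        rw [one_mul] at this
        exact absurd h6 (not_le.mpr this)
      rw [ENNReal.ofReal_sub _ hθ0.le, ENNReal.ofReal_one, ENNReal.sub_mul (fun _ _ => hfin),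
        one_mul]
      exact ENNReal.le_sub_of_add_le_left (ENNReal.mul_ne_top ENNReal.ofReal_ne_top hfin) hle
    have h8 := le_of_tendsto hlim hev
    rw [ENNReal.one_le_ofReal] at h8
    linarith
  rw [← Measure.restrict_eq_zero]
  rw [← ae_eq_bot, ← Filter.empty_mem_iff_bot]
  have hnot : ∀ᵐ z ∂(volume.restrict S), z ∉ S := by
    filter_upwards [hdens] with z hz hzS using hfalse z hzS hz
  have hmeas : NullMeasurableSet S := by
    have e : S = Metric.ball 0 1 ∩ ((fun z : ℂ => (z : OnePoint ℂ)) ⁻¹' outerSet hq) := by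
      ext z; simp [hS]
    rw [e]
    exact (Metric.isOpen_ball.measurableSet.inter
      ((isClosed_outerSet hq).preimage OnePoint.continuous_coe).measurableSet).nullMeasurableSet
  filter_upwards [hnot, ae_restrict_mem₀ hmeas] with z h1 h2 using h1 h2

end RoundCarpet

/-! ## Möbius images and the geometry of the carpets -/

namespace RoundCarpet

open CoxeterReflection

variable {q : ℕ} {hq : 6 < q}

/-- The action on Lorentz space of the matrix with entries `a, b, c, d`. -/
noncomputable def mobVec (a b c d : ℂ) (u : Lorentz) : Lorentz :=
  (Complex.normSq c * u.2.2 - 2 * (c * conj d * u.2.1).re + Complex.normSq d * u.1,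
    -(a * conj c * u.2.2) + a * conj d * u.2.1 + b * conj c * conj u.2.1 - b * conj d * u.1,
    Complex.normSq a * u.2.2 - 2 * (a * conj b * u.2.1).re + Complex.normSq b * u.1)

theorem lor_mobVec (a b c d : ℂ) (u v : Lorentz) : lor (mobVec a b c d u) (mobVec a b c d v) =
    Complex.normSq (a * d - b * c) * lor u v := by
  simp only [lor_apply, mobVec, Complex.normSq_apply, Complex.mul_re, Complex.mul_im,
    Complex.conj_re, Complex.conj_im, Complex.add_re, Complex.add_im, Complex.sub_re,
    Complex.sub_im, Complex.neg_re, Complex.neg_im, Complex.ofReal_re, Complex.ofReal_im]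
  ring

open Classical in
theorem lift_ite {x y : ℂ} (h : y = 0 → x ≠ 0) : ∃ l : ℝ, 0 < l ∧
    lift (if y = 0 then OnePoint.infty else ((x / y : ℂ) : OnePoint ℂ)) =
      l • ((-2 * Complex.normSq y, 2 * x * conj y, -2 * Complex.normSq x) : Lorentz) := by
  by_cases hy : y = 0
  · refine ⟨(Complex.normSq x)⁻¹, inv_pos.mpr (Complex.normSq_pos.mpr (h hy)), ?_⟩
    have : Complex.normSq x ≠ 0 := (Complex.normSq_pos.mpr (h hy)).ne'
    rw [if_pos hy, lift_infty]
    refine Prod.ext ?_ (Prod.ext ?_ ?_) <;> simp [hy]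
    field_simp
  · have hn : Complex.normSq y ≠ 0 := (Complex.normSq_pos.mpr hy).ne'
    refine ⟨(Complex.normSq y)⁻¹, inv_pos.mpr (Complex.normSq_pos.mpr hy), ?_⟩
    rw [if_neg hy, lift_coe]
    refine Prod.ext ?_ (Prod.ext ?_ ?_)
    · simp [pt]; field_simp
    · simp [pt, ← Complex.mul_conj]
      have : conj y ≠ 0 := (map_ne_zero (starRingEnd ℂ)).mpr hy
      field_simp
    · simp [pt]; field_simp

theorem lift_smul (A : GL (Fin 2) ℂ) (z : OnePoint ℂ) : ∃ l : ℝ, 0 < l ∧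
    lift (A • z) = l • mobVec (A 0 0) (A 0 1) (A 1 0) (A 1 1) (lift z) := by
  have hdet : A 0 0 * A 1 1 - A 0 1 * A 1 0 ≠ 0 := by
    have := A.det_ne_zero
    rwa [Matrix.det_fin_two] at this
  induction z using OnePoint.rec with
  | infty =>
    rw [OnePoint.smul_infty_eq_ite]
    obtain ⟨l, hl, e⟩ := lift_ite (x := A 0 0) (y := A 1 0)
      (fun h h' => hdet (by rw [h, h']; ring))
    refine ⟨l, hl, ?_⟩
    convert e using 2
    rw [lift_infty, mobVec]
    refine Prod.ext ?_ (Prod.ext ?_ ?_) <;> simp <;> ring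
  | coe z =>
    rw [OnePoint.smul_some_eq_ite]
    obtain ⟨l, hl, e⟩ := lift_ite (x := A 0 0 * z + A 0 1) (y := A 1 0 * z + A 1 1)
      (fun h h' => hdet (by
        linear_combination (A 0 0 - (A 0 0 - A 0 0)) * h - A 1 0 * h'))
    refine ⟨l, hl, ?_⟩
    convert e using 2
    rw [lift_coe, mobVec, pt]
    refine Prod.ext ?_ (Prod.ext ?_ ?_)
    · simp [Complex.normSq_apply]; ring
    · apply Complex.ext <;> simp [Complex.normSq_apply] <;> ring
    · simp [Complex.normSq_apply]; ring

/-- Real differentiability serves to carry null sets through `g`; the maps are treated over `ℝ` so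
that the orientation reversing ones are included later. -/
theorem smul_eq_coe (A : GL (Fin 2) ℂ) : ∃ f : ℂ → ℂ, ∀ z : ℂ, A • (z : OnePoint ℂ) ≠ OnePoint.infty →
    A • (z : OnePoint ℂ) = (f z : OnePoint ℂ) ∧ DifferentiableAt ℝ f z := by
  refine ⟨fun z => (A 0 0 * z + A 0 1) / (A 1 0 * z + A 1 1), fun z hz => ?_⟩
  rw [OnePoint.smul_some_eq_ite] at hz ⊢
  by_cases h : A 1 0 * z + A 1 1 = 0
  · simp [h] at hz
  · rw [if_neg h]
    refine ⟨rfl, ?_⟩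
    have : DifferentiableAt ℂ (fun z => (A 0 0 * z + A 0 1) / (A 1 0 * z + A 1 1)) z := by
      exact DifferentiableAt.fun_div (by fun_prop) (by fun_prop) h
    exact this.restrictScalars ℝ

theorem sphereConj_coe (z : ℂ) : sphereConj (z : OnePoint ℂ) = ((conj z : ℂ) : OnePoint ℂ) := rfl

theorem sphereConj_sphereConj (z : OnePoint ℂ) : sphereConj (sphereConj z) = z := by
  induction z using OnePoint.rec with
  | infty => rfl
  | coe z => rw [sphereConj_coe, sphereConj_coe, Complex.conj_conj]

theorem lift_sphereConj (z : OnePoint ℂ) :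
    lift (sphereConj z) = ((lift z).1, conj (lift z).2.1, (lift z).2.2) := by
  induction z using OnePoint.rec with
  | infty => change lift OnePoint.infty = _; simp [lift_infty]
  | coe z => rw [sphereConj_coe, lift_coe, lift_coe]; simp [pt, Complex.conj_ofNat]

theorem differentiable_conj : Differentiable ℝ (fun z : ℂ => conj z) :=
  Complex.conjCLE.differentiable

/-- Matrices act on Hermitian forms, which are the Lorentz vectors, multiplying the form by
`|det|²`; conjugation is an isometry. So sides of circles can be compared before and after `g`. -/
theorem IsMobius.exists_lorentz {g : Equiv.Perm (OnePoint ℂ)} (hg : IsMobius g) :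
    ∃ (T : Lorentz → Lorentz) (κ : ℝ), 0 < κ ∧ (∀ u v, lor (T u) (T v) = κ * lor u v) ∧
      ∀ z, ∃ l : ℝ, 0 < l ∧ lift (g z) = l • T (lift z) := by
  obtain ⟨A, hA⟩ := hg
  have hdet : 0 < Complex.normSq (A 0 0 * A 1 1 - A 0 1 * A 1 0) := by
    have := A.det_ne_zero
    rw [Matrix.det_fin_two] at this
    exact Complex.normSq_pos.mpr this
  rcases hA with hA | hA
  · refine ⟨mobVec (A 0 0) (A 0 1) (A 1 0) (A 1 1), _, hdet, lor_mobVec _ _ _ _, fun z => ?_⟩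
    rw [hA]; exact lift_smul A z
  · refine ⟨fun u => mobVec (A 0 0) (A 0 1) (A 1 0) (A 1 1) (u.1, conj u.2.1, u.2.2), _, hdet,
      fun u v => ?_, fun z => ?_⟩
    · rw [lor_mobVec]; simp [lor_apply]
    · have := lift_smul A (sphereConj z)
      rw [lift_sphereConj] at this
      rw [hA]; exact this

theorem IsMobius.exists_coe {g : Equiv.Perm (OnePoint ℂ)} (hg : IsMobius g) :
    ∃ f : ℂ → ℂ, ∀ z : ℂ, g z ≠ OnePoint.infty →
      g z = (f z : OnePoint ℂ) ∧ DifferentiableAt ℝ f z := by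
  obtain ⟨A, hA | hA⟩ := hg
  · obtain ⟨f, hf⟩ := smul_eq_coe A
    exact ⟨f, fun z hz => by rw [hA] at hz ⊢; exact hf z hz⟩
  · obtain ⟨f, hf⟩ := smul_eq_coe A
    refine ⟨fun z => f (conj z), fun z hz => ?_⟩
    rw [hA, sphereConj_coe] at hz ⊢
    obtain ⟨h1, h2⟩ := hf _ hz
    exact ⟨h1, h2.comp z (differentiable_conj z)⟩

theorem IsMobius.symm_exists_coe {g : Equiv.Perm (OnePoint ℂ)} (hg : IsMobius g) :
    ∃ f : ℂ → ℂ, ∀ z : ℂ, g.symm z ≠ OnePoint.infty →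
      g.symm z = (f z : OnePoint ℂ) ∧ DifferentiableAt ℝ f z := by
  obtain ⟨A, hA | hA⟩ := hg
  · have hs : ∀ z, g.symm z = A⁻¹ • z := fun z => by
      rw [Equiv.symm_apply_eq, hA, smul_inv_smul]
    obtain ⟨f, hf⟩ := smul_eq_coe A⁻¹
    exact ⟨f, fun z hz => by rw [hs] at hz ⊢; exact hf z hz⟩
  · have hs : ∀ z, g.symm z = sphereConj (A⁻¹ • z) := fun z => by
      rw [Equiv.symm_apply_eq, hA, sphereConj_sphereConj, smul_inv_smul]
    obtain ⟨f, hf⟩ := smul_eq_coe A⁻¹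
    refine ⟨fun z => conj (f z), fun z hz => ?_⟩
    rw [hs] at hz ⊢
    have hz' : A⁻¹ • (z : OnePoint ℂ) ≠ OnePoint.infty := fun h => hz (by rw [h]; rfl)
    obtain ⟨h1, h2⟩ := hf _ hz'
    exact ⟨by rw [h1, sphereConj_coe], (differentiable_conj _).comp z h2⟩

/-- Test the inclusion on points of the smaller ball in the direction `c - c'`. Its consequence
`ball_injective` ensures that the pairs in `diskParams` list every disk exactly once. -/
theorem dist_add_le_of_ball_subset {c c' : ℂ} {r r' : ℝ} (hr : 0 < r)
    (h : Metric.ball c r ⊆ Metric.ball c' r') : ‖c - c'‖ + r ≤ r' := by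
  obtain ⟨u, hu, hcu⟩ : ∃ u : ℂ, ‖u‖ = 1 ∧ c - c' = ‖c - c'‖ • u := by
    by_cases hc : c - c' = 0
    · exact ⟨1, by simp, by simp [hc]⟩
    · have : ‖c - c'‖ ≠ 0 := norm_ne_zero_iff.mpr hc
      refine ⟨‖c - c'‖⁻¹ • (c - c'), by rw [norm_smul, norm_inv, norm_norm, inv_mul_cancel₀ this], ?_⟩
      rw [smul_smul, mul_inv_cancel₀ this, one_smul]
  refine le_of_forall_lt fun x hx => ?_
  obtain ⟨t, ht0, htr, ht⟩ : ∃ t, 0 ≤ t ∧ t < r ∧ x < ‖c - c'‖ + t := by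
    refine ⟨max 0 ((x - ‖c - c'‖ + r) / 2), le_max_left _ _, max_lt hr (by linarith), ?_⟩
    have := le_max_right 0 ((x - ‖c - c'‖ + r) / 2)
    linarith
  have hmem : c + t • u ∈ Metric.ball c r := by
    rw [mem_ball_iff_norm, add_sub_cancel_left, norm_smul, hu, Real.norm_of_nonneg ht0]; linarith
  have h2 := h hmem
  rw [mem_ball_iff_norm] at h2
  have e : c + t • u - c' = (‖c - c'‖ + t) • u := by
    rw [add_smul, ← hcu]; ring
  rw [e, norm_smul, hu, mul_one, Real.norm_of_nonneg (by positivity)] at h2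
  linarith

theorem ball_injective {c c' : ℂ} {r r' : ℝ} (hr : 0 < r) (hr' : 0 < r')
    (h : Metric.ball c r = Metric.ball c' r') : c = c' ∧ r = r' := by
  have h1 := dist_add_le_of_ball_subset hr h.subset
  have h2 := dist_add_le_of_ball_subset hr' h.superset
  rw [norm_sub_rev] at h2
  have h3 := norm_nonneg (c - c')
  have h4 : ‖c - c'‖ = 0 := by linarith
  exact ⟨sub_eq_zero.mp (norm_eq_zero.mp h4), by linarith⟩

/-- By `rep_extVec` the closed disk of the image lies in the open unit disk. The strict sign under a
weak hypothesis encodes disjointness of closures. -/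
theorem lor_lift_neg_of_ne {ω : CoxGroup q hq} (hω : rep hq ω extVec ≠ extVec) {x : OnePoint ℂ}
    (hx : 0 ≤ lor extVec (lift x)) : lor (rep hq ω extVec) (lift x) < 0 := by
  obtain h | ⟨h, h'⟩ := rep_extVec hq ω
  · exact absurd h hω
  induction x using OnePoint.rec with
  | infty => rw [lift_infty, lor_apply]; simp; linarith
  | coe z =>
    rw [lift_coe, lor_extVec_pt, Complex.normSq_eq_norm_sq] at hx
    have hz : 1 ≤ ‖z‖ := by
      by_contra hc
      push Not at hc
      nlinarith [norm_nonneg z]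
    have h1 : lor (rep hq ω extVec) (rep hq ω extVec) = 1 := by rw [lor_rep, lor_extVec_self]
    rw [lift_coe, lor_pt_eq_disk h (lor_rep_extVec_self hq ω)]
    set w := rep hq ω extVec
    have hpos : 0 < -w.1 := by linarith
    have hR : rad w = 1 / (-w.1) := by rw [rad, h1, Real.sqrt_one]
    have hc : ‖ctr w‖ = ‖w.2.1‖ / (-w.1) := by
      rw [ctr, norm_smul, norm_neg, norm_inv, Real.norm_of_nonpos h.le]; ring
    have hlt : ‖ctr w‖ + rad w < 1 := by
      rw [hR, hc, ← add_div, div_lt_one hpos]; exact h'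
    have h5 : rad w < ‖z - ctr w‖ := by
      have := norm_sub_norm_le z (ctr w); linarith
    have hR0 : 0 ≤ rad w := by rw [hR]; positivity
    have h6 : rad w ^ 2 < ‖z - ctr w‖ ^ 2 := pow_lt_pow_left₀ h5 hR0 two_ne_zero
    exact mul_neg_of_neg_of_pos h (by linarith)

/-- Applying `ω₁⁻¹` turns the first disk into the exterior of the unit disk, which is the previous
case. -/
theorem lor_lift_neg_of_rep_ne {ω₁ ω₂ : CoxGroup q hq} (hω : rep hq ω₁ extVec ≠ rep hq ω₂ extVec)
    {x : OnePoint ℂ} (hx : 0 ≤ lor (rep hq ω₁ extVec) (lift x)) :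
    lor (rep hq ω₂ extVec) (lift x) < 0 := by
  obtain ⟨τ, -, hτ⟩ := exists_perm ω₁⁻¹
  obtain ⟨l, hl, e⟩ := hτ x
  have h1 : ∀ u, lor (rep hq ω₁ u) (lift x) = l⁻¹ * lor u (lift (τ x)) := fun u => by
    rw [e, map_smul, smul_eq_mul, lor_rep_left]; field_simp
  have h2 : rep hq (ω₁⁻¹ * ω₂) extVec ≠ extVec := fun h => hω (by
    rw [map_mul, Module.End.mul_apply] at h
    nth_rewrite 1 [← h]
    rw [rep_apply_inv])
  rw [h1] at hx
  have h3 := lor_lift_neg_of_ne h2 (x := τ x) (by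
    have := mul_nonneg hl.le hx
    rwa [← mul_assoc, mul_inv_cancel₀ hl.ne', one_mul] at this)
  have h4 := h1 (rep hq (ω₁⁻¹ * ω₂) extVec)
  rw [map_mul, Module.End.mul_apply, rep_apply_inv, ← Module.End.mul_apply (rep hq ω₁⁻¹),
    ← map_mul] at h4
  rw [h4]
  exact mul_neg_of_pos_of_neg (by positivity) h3

theorem mem_unitDisk_iff (z : OnePoint ℂ) : z ∈ unitDisk ↔ lor extVec (lift z) < 0 := by
  induction z using OnePoint.rec with
  | infty => rw [lift_infty, lor_extVec]; simp [unitDisk]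
  | coe z =>
    rw [lift_coe, lor_extVec_pt, unitDisk, OnePoint.coe_injective.mem_set_image,
      mem_ball_zero_iff, Complex.normSq_eq_norm_sq]
    constructor
    · intro h; nlinarith [norm_nonneg z]
    · intro h
      by_contra hc
      push Not at hc
      nlinarith [norm_nonneg z]

theorem ActsAs.image_exterior {τ : Equiv.Perm (OnePoint ℂ)} {ω : CoxGroup q hq}
    (h : ActsAs hq τ ω) (z : OnePoint ℂ) :
    z ∈ τ '' closedUnitDiskᶜ ↔ 0 < lor (rep hq ω extVec) (lift z) := by
  obtain ⟨l, hl, e⟩ := h.lor_pos_iff extVec (τ.symm z)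
  rw [Equiv.apply_symm_apply] at e
  rw [Equiv.image_eq_preimage_symm, mem_preimage, mem_exterior_iff, e]
  exact (mul_pos_iff_of_pos_left hl).symm

end RoundCarpet

/-! ### Disk packings, and the carpets as packings -/

namespace RoundCarpet

/-- A family `P` of disks (given by centres and radii) with disjoint closures fills the disk
`|z - m₀| < R₀` up to a null set; `K` is a relatively closed subset of this disk in which the
boundary circles of the family are dense. -/
structure IsDiskPacking (m₀ : ℂ) (R₀ : ℝ) (P : Set (ℂ × ℝ)) (K : Set ℂ) : Prop where
  radius_pos : ∀ p ∈ P, 0 < p.2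
  closedBall_subset : ∀ p ∈ P, Metric.closedBall p.1 p.2 ⊆ Metric.ball m₀ R₀
  disjoint : ∀ p ∈ P, ∀ p' ∈ P, p ≠ p' →
    Disjoint (Metric.closedBall p.1 p.2) (Metric.closedBall p'.1 p'.2)
  null : volume (Metric.ball m₀ R₀ \ ⋃ p ∈ P, Metric.ball p.1 p.2) = 0
  sphere_subset : ∀ p ∈ P, Metric.sphere p.1 p.2 ⊆ K
  exists_isClosed : ∃ F, IsClosed F ∧ K = Metric.ball m₀ R₀ ∩ F
  dense : K ⊆ closure (⋃ p ∈ P, Metric.sphere p.1 p.2)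

open CoxeterReflection

variable {q : ℕ} {hq : 6 < q} {g : Equiv.Perm (OnePoint ℂ)}

theorem IsMobius.exists_lor (hg : IsMobius g) :
    ∃ (T : Lorentz → Lorentz) (κ : ℝ), 0 < κ ∧ (∀ u, lor (T u) (T u) = κ * lor u u) ∧
      ∀ z, ∃ l : ℝ, 0 < l ∧ ∀ u, lor (T u) (lift z) = l * lor u (lift (g.symm z)) := by
  obtain ⟨T, κ, hκ, h1, h2⟩ := hg.exists_lorentz
  refine ⟨T, κ, hκ, fun u => h1 u u, fun z => ?_⟩
  obtain ⟨l, hl, e⟩ := h2 (g.symm z)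
  refine ⟨l * κ, mul_pos hl hκ, fun u => ?_⟩
  rw [Equiv.apply_symm_apply] at e
  rw [e, map_smul, h1, smul_eq_mul, mul_assoc]

theorem lor_lift_infty (w : Lorentz) : lor w (lift OnePoint.infty) = w.1 := by
  rw [lift_infty, lor_apply]; simp; ring

/-- The disks of a carpet are those of the vectors `T (rep ω extVec)`. -/
theorem exists_lorentz_description (hq : 6 < q) (hg : g ∈ shapes) :
    ∃ W : CoxGroup q hq → Lorentz, ∃ u₀ : Lorentz, u₀.1 < 0 ∧ 0 < lor u₀ u₀ ∧
      (∀ z, 0 < lor u₀ (lift z) ↔ g.symm z ∈ unitDisk) ∧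
      (∀ ω, rep hq ω extVec ≠ extVec → (W ω).1 < 0 ∧ 0 < lor (W ω) (W ω)) ∧
      (∀ ω z, ∃ l : ℝ, 0 < l ∧
        lor (W ω) (lift z) = l * lor (rep hq ω extVec) (lift (g.symm z))) := by
  obtain ⟨T, κ, hκ, h1, h2⟩ := hg.1.exists_lor
  have hinf : 0 < lor extVec (lift (g.symm OnePoint.infty)) := (mem_exterior_iff _).mp hg.2
  -- The sign in `-T extVec` selects the image of the unit disk instead of that of its exterior. It
  -- is bounded because `g⁻¹(∞)` lies in the exterior.
  refine ⟨fun ω => T (rep hq ω extVec), -T extVec, ?_, ?_, fun z => ?_, fun ω hω => ⟨?_, ?_⟩,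
    fun ω z => ?_⟩
  · obtain ⟨l, hl, e⟩ := h2 OnePoint.infty
    have := e extVec
    rw [lor_lift_infty] at this
    rw [Prod.fst_neg, this]
    exact neg_neg_of_pos (mul_pos hl hinf)
  · rw [map_neg, map_neg, LinearMap.neg_apply, neg_neg, h1, lor_extVec_self]; linarith
  · obtain ⟨l, hl, e⟩ := h2 z
    rw [mem_unitDisk_iff, map_neg, LinearMap.neg_apply, e, ← mul_neg,
      mul_pos_iff_of_pos_left hl, neg_pos]
  · obtain ⟨l, hl, e⟩ := h2 OnePoint.infty
    rw [← lor_lift_infty, e]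
    exact mul_neg_of_pos_of_neg hl (lor_lift_neg_of_ne hω hinf.le)
  · rw [h1]; exact mul_pos hκ (lor_rep_extVec_self hq ω)
  · obtain ⟨l, hl, e⟩ := h2 z
    exact ⟨l, hl, e _⟩

theorem mem_carpet_iff (z : ℂ) :
    z ∈ carpet q g ↔ g.symm z ∈ unitDisk ∧ g.symm z ∈ limitSet (groupG q) := by
  rw [carpet, mem_ofPred_eq, Equiv.image_eq_preimage_symm]; rfl

/-- The boundary circle of the disk of `ω` is an image of the unit circle, which lies in the
invariant limit set; it stays inside the open disk by `lor_lift_neg_of_ne`. -/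
theorem exists_sphere_preimage {x : OnePoint ℂ} {ω : CoxGroup q hq}
    (hω : rep hq ω extVec ≠ extVec) (hx : lor (rep hq ω extVec) (lift x) = 0) :
    x ∈ unitDisk ∧ x ∈ limitSet (groupG q) := by
  constructor
  · rw [mem_unitDisk_iff]
    by_contra h
    push Not at h
    exact (lor_lift_neg_of_ne hω h).ne hx
  · obtain ⟨τ, hτ, e⟩ := exists_perm ω
    obtain ⟨l, hl, e'⟩ := e.lor_pos_iff extVec (τ.symm x)
    rw [Equiv.apply_symm_apply, hx] at e'
    have h0 : lor extVec (lift (τ.symm x)) = 0 := by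
      rcases mul_eq_zero.mp e'.symm with h | h
      · exact absurd h hl.ne'
      · exact h
    have : τ.symm x ∈ limitSet (groupG q) := by
      generalize τ.symm x = y at h0
      induction y using OnePoint.rec with
      | infty => rw [lor_lift_infty] at h0; simp [extVec] at h0
      | coe y =>
        refine circle_subset_limitSet hq ?_
        rw [lift_coe, lor_extVec_pt, add_zero, Complex.normSq_eq_norm_sq] at h0
        have : ‖y‖ ^ 2 = 1 ^ 2 := by linarith
        exact (pow_left_inj₀ (norm_nonneg _) one_pos.le two_ne_zero).mp this
    have := limitSet_invariant hτ this
    rwa [Equiv.apply_symm_apply] at this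

/-- The set removed in `diskFamily` is the only image that contains `∞`, so removing the set amounts
to excluding the group elements that fix `extVec`. -/
theorem mem_diskFamily_iff (hq : 6 < q) (hg : g ∈ shapes) (D : Set (OnePoint ℂ)) :
    D ∈ diskFamily q g ↔ ∃ ω : CoxGroup q hq, rep hq ω extVec ≠ extVec ∧
      D = {z | 0 < lor (rep hq ω extVec) (lift (g.symm z))} := by
  have key : ∀ τ (ω : CoxGroup q hq), ActsAs hq τ ω →
      (fun z => g (τ z)) '' closedUnitDiskᶜ =
        {z | 0 < lor (rep hq ω extVec) (lift (g.symm z))} := by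
    intro τ ω h
    ext z
    rw [show (fun z => g (τ z)) = g ∘ τ from rfl, image_comp, Equiv.image_eq_preimage_symm g,
      mem_preimage, h.image_exterior]
    rfl
  have key1 : g '' closedUnitDiskᶜ = {z | 0 < lor extVec (lift (g.symm z))} := by
    ext z
    rw [Equiv.image_eq_preimage_symm g, mem_preimage, mem_exterior_iff]; rfl
  constructor
  · rintro ⟨⟨τ, hτ, rfl⟩, h⟩
    obtain ⟨ω, hω⟩ := exists_actsAs (hq := hq) hτ
    refine ⟨ω, fun h' => h ?_, key τ ω hω⟩
    rw [mem_singleton_iff, key τ ω hω, h', key1]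
  · rintro ⟨ω, hω, rfl⟩
    obtain ⟨τ, hτ, e⟩ := exists_perm ω
    refine ⟨⟨τ, hτ, (key τ ω e).symm⟩, fun h => ?_⟩
    rw [mem_singleton_iff, key1] at h
    have hinf : 0 < lor extVec (lift (g.symm OnePoint.infty)) := (mem_exterior_iff _).mp hg.2
    have : OnePoint.infty ∈ {z | 0 < lor extVec (lift (g.symm z))} := hinf
    rw [← h] at this
    exact lt_asymm this (lor_lift_neg_of_ne hω hinf.le)

/-- Every member of `𝓓_g` is a disk whose boundary lies in the carpet, and the carpet comes with
a packing. -/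
theorem carpet_isDiskPacking (hq : 6 < q) (hg : g ∈ shapes) :
    (∀ D ∈ diskFamily q g, ∃ (c : ℂ) (R : ℝ), 0 < R ∧
      D = (fun z : ℂ => (z : OnePoint ℂ)) '' Metric.ball c R ∧
      Metric.sphere c R ⊆ carpet q g) ∧
    ∃ m₀ R₀, IsDiskPacking m₀ R₀ (diskParams q g) (carpet q g) := by
  obtain ⟨W, u₀, hu1, hu2, hu, hW, hWl⟩ := exists_lorentz_description hq hg
  have hpos : ∀ ω z, 0 < lor (W ω) (lift z) ↔
      0 < lor (rep hq ω extVec) (lift (g.symm z)) := fun ω z => by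
    obtain ⟨l, hl, e⟩ := hWl ω z
    rw [e, mul_pos_iff_of_pos_left hl]
  have hnonneg : ∀ ω z, 0 ≤ lor (W ω) (lift z) ↔
      0 ≤ lor (rep hq ω extVec) (lift (g.symm z)) := fun ω z => by
    obtain ⟨l, hl, e⟩ := hWl ω z
    rw [e, mul_nonneg_iff_of_pos_left hl]
  have hzero : ∀ ω z, lor (W ω) (lift z) = 0 ↔
      lor (rep hq ω extVec) (lift (g.symm z)) = 0 := fun ω z => by
    obtain ⟨l, hl, e⟩ := hWl ω z
    rw [e, mul_eq_zero, or_iff_right hl.ne']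
  have hΩ : ∀ z : ℂ, z ∈ Metric.ball (ctr u₀) (rad u₀) ↔ g.symm z ∈ unitDisk := fun z => by
    rw [← hu, lor_lift_pos_iff hu1 hu2, OnePoint.coe_injective.mem_set_image]
  have hsph : ∀ ω, rep hq ω extVec ≠ extVec →
      Metric.sphere (ctr (W ω)) (rad (W ω)) ⊆ carpet q g := fun ω hω z hz => by
    rw [← lor_pt_zero_iff (hW ω hω).1 (hW ω hω).2, ← lift_coe, hzero] at hz
    rw [mem_carpet_iff]
    exact exists_sphere_preimage hω hz
  have hD : ∀ ω, rep hq ω extVec ≠ extVec →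
      {z | 0 < lor (rep hq ω extVec) (lift (g.symm z))} =
        (fun z : ℂ => (z : OnePoint ℂ)) '' Metric.ball (ctr (W ω)) (rad (W ω)) :=
    fun ω hω => by
      ext z
      rw [← lor_lift_pos_iff (hW ω hω).1 (hW ω hω).2, hpos]; rfl
  have hparam : ∀ p, p ∈ diskParams q g ↔ ∃ ω : CoxGroup q hq, rep hq ω extVec ≠ extVec ∧
      p = (ctr (W ω), rad (W ω)) := by
    intro p
    rw [diskParams, mem_ofPred_eq, mem_diskFamily_iff hq hg]
    constructor
    · rintro ⟨h0, ω, hω, e⟩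
      rw [hD ω hω, (OnePoint.coe_injective (X := ℂ)).image_injective.eq_iff] at e
      obtain ⟨h1, h2⟩ := ball_injective h0 (rad_pos (hW ω hω).1 (hW ω hω).2) e
      exact ⟨ω, hω, Prod.ext h1 h2⟩
    · rintro ⟨ω, hω, rfl⟩
      exact ⟨rad_pos (hW ω hω).1 (hW ω hω).2, ω, hω, (hD ω hω).symm⟩
  obtain ⟨f, hf⟩ := hg.1.exists_coe
  obtain ⟨γ, hγ⟩ := hg.1.symm_exists_coe
  have hnt : ∀ x ∈ unitDisk, x ≠ OnePoint.infty := by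
    rintro x ⟨y, -, rfl⟩; exact OnePoint.coe_ne_infty y
  have hgt : ∀ x ∈ unitDisk, g x ≠ OnePoint.infty := fun x hx h => hg.2 (by
    rw [← h, Equiv.symm_apply_apply]
    exact image_mono Metric.ball_subset_closedBall hx)
  refine ⟨fun D hDm => ?_, ctr u₀, rad u₀, ?_, ?_, ?_, ?_, ?_, ?_, ?_⟩
  · obtain ⟨ω, hω, rfl⟩ := (mem_diskFamily_iff hq hg D).mp hDm
    exact ⟨_, _, rad_pos (hW ω hω).1 (hW ω hω).2, hD ω hω, hsph ω hω⟩
  · exact fun p hp => hp.1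
  · rintro p hp z hz
    obtain ⟨ω, hω, rfl⟩ := (hparam p).mp hp
    rw [← lor_pt_nonneg_iff (hW ω hω).1 (hW ω hω).2, ← lift_coe, hnonneg] at hz
    rw [hΩ, mem_unitDisk_iff]
    by_contra h
    push Not at h
    exact absurd hz (not_le.mpr (lor_lift_neg_of_ne hω h))
  · rintro p hp p' hp' hne
    obtain ⟨ω, hω, rfl⟩ := (hparam p).mp hp
    obtain ⟨ω', hω', rfl⟩ := (hparam p').mp hp'
    have hr : rep hq ω extVec ≠ rep hq ω' extVec := fun h => hne (by
      have h1 := hD ω hω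
      rw [h, hD ω' hω', (OnePoint.coe_injective (X := ℂ)).image_injective.eq_iff] at h1
      obtain ⟨h2, h3⟩ := ball_injective hp'.1 hp.1 h1
      exact Prod.ext h2.symm h3.symm)
    refine disjoint_left.mpr fun z hz hz' => ?_
    rw [← lor_pt_nonneg_iff (hW ω hω).1 (hW ω hω).2, ← lift_coe, hnonneg] at hz
    rw [← lor_pt_nonneg_iff (hW ω' hω').1 (hW ω' hω').2, ← lift_coe, hnonneg] at hz'
    exact absurd hz' (not_le.mpr (lor_lift_neg_of_rep_ne hr hz))
  -- The part of the large disk that is not covered is contained in the image of the null set of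
  -- `volume_outerSet` under the differentiable map `f`.
  · set S := {z : ℂ | ‖z‖ < 1 ∧ (z : OnePoint ℂ) ∈ outerSet hq} with hS
    have hSf : DifferentiableOn ℝ f S := fun z hz =>
      (hf z (hgt _ ⟨z, mem_ball_zero_iff.mpr hz.1, rfl⟩)).2.differentiableWithinAt
    have h0 := addHaar_image_eq_zero_of_differentiableOn_of_addHaar_eq_zero volume hSf
      (volume_outerSet hq)
    refine measure_mono_null (fun z hz => ?_) h0
    have h1 := (hΩ z).mp hz.1
    obtain ⟨x, hx, e⟩ := h1
    have hgx : g (x : OnePoint ℂ) = z := by rw [← g.apply_symm_apply (z : OnePoint ℂ)]; congr 1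
    refine ⟨x, ⟨mem_ball_zero_iff.mp hx, fun ω => ?_⟩, ?_⟩
    · by_cases hω : rep hq ω extVec = extVec
      · rw [hω]; exact ((mem_unitDisk_iff _).mp ⟨x, hx, rfl⟩).le
      · by_contra hc
        push Not at hc
        apply hz.2
        have h2 : (z : OnePoint ℂ) ∈ {z | 0 < lor (rep hq ω extVec) (lift (g.symm z))} := by
          change 0 < lor (rep hq ω extVec) (lift (g.symm z))
          rw [← e]; exact hc
        rw [hD ω hω, OnePoint.coe_injective.mem_set_image] at h2
        exact mem_biUnion ((hparam _).mpr ⟨ω, hω, rfl⟩) h2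
    · have h3 := (hf x (by rw [hgx]; exact OnePoint.coe_ne_infty z)).1
      rw [hgx] at h3
      exact (OnePoint.coe_injective h3).symm
  · rintro p hp
    obtain ⟨ω, hω, rfl⟩ := (hparam p).mp hp
    exact hsph ω hω
  -- Inside the large disk the carpet is the preimage of the closed limit set under the continuous
  -- coordinate expression `γ` of `g⁻¹`.
  · have hcont : ContinuousOn γ (Metric.ball (ctr u₀) (rad u₀)) := fun z hz =>
      (hγ z (hnt _ ((hΩ z).mp hz))).2.continuousAt.continuousWithinAt
    obtain ⟨F, hF, e⟩ := continuousOn_iff_isClosed.mp hcont _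
      ((isClosed_limitSet (groupG q)).preimage OnePoint.continuous_coe)
    refine ⟨F, hF, ?_⟩
    rw [inter_comm, ← e]
    ext z
    rw [mem_carpet_iff, ← hΩ, and_comm, mem_inter_iff]
    refine and_congr_left fun hz => ?_
    rw [(hγ z (hnt _ ((hΩ z).mp hz))).1]; rfl
  · intro z hz
    rw [mem_carpet_iff] at hz
    obtain ⟨⟨x, hx, e⟩, hΛ⟩ := hz
    have hgx : g (x : OnePoint ℂ) = z := by rw [← g.apply_symm_apply (z : OnePoint ℂ)]; congr 1
    have hfx := hf x (by rw [hgx]; exact OnePoint.coe_ne_infty z)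
    have hzx : z = f x := OnePoint.coe_injective (by rw [← hgx]; exact hfx.1)
    obtain ⟨M, hM, hnear⟩ := exists_near_disk hq
    obtain ⟨r₀, hr₀, hr⟩ := hnear x (mem_ball_zero_iff.mp hx) (by
      have := limitSet_subset_outerSet hq hΛ
      rwa [← e] at this)
    rw [Metric.mem_closure_iff]
    intro ε hε
    obtain ⟨δ, hδ, hδε⟩ := Metric.continuousAt_iff.mp hfx.2.continuousAt ε hε
    obtain ⟨ω, hω, h1, h2, h3⟩ := hr (min (r₀ / 2) (δ / (2 * M))) (by positivity)
      (lt_of_le_of_lt (min_le_left _ _) (by linarith))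
    set v := rep hq ω extVec with hv
    have hMr : M * min (r₀ / 2) (δ / (2 * M)) < δ := by
      calc _ ≤ M * (δ / (2 * M)) := mul_le_mul_of_nonneg_left (min_le_right _ _) hM.le
        _ = δ / 2 := by field_simp
        _ < δ := by linarith
    have hrp : 0 < rad v := lt_of_lt_of_le (by positivity) h1
    have hd : 0 < ‖x - ctr v‖ := hrp.trans_le h2
    -- The radial projection of `x` to the circle of a nearby disk moves `x` by less than `δ`;
    -- applying `g` then gives a circle of the packing within `ε` of `z`.
    set x' := ctr v + (rad v / ‖x - ctr v‖) • (x - ctr v) with hx'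
    have hxs : x' ∈ Metric.sphere (ctr v) (rad v) := by
      rw [mem_sphere_iff_norm, hx', add_sub_cancel_left, norm_smul,
        Real.norm_of_nonneg (by positivity), div_mul_cancel₀ _ hd.ne']
    have hxd : dist x' x < δ := by
      have e1 : x' - x = (rad v / ‖x - ctr v‖ - 1) • (x - ctr v) := by
        rw [hx', sub_smul, one_smul]; ring
      rw [dist_eq_norm, e1, norm_smul, Real.norm_of_nonpos (by
        rw [sub_nonpos, div_le_one hd]; exact h2), neg_mul, sub_mul, div_mul_cancel₀ _ hd.ne']
      linarith
    have hv1 : v.1 < 0 := by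
      rcases rep_extVec hq ω with h | h
      · exact absurd h hω
      · exact h.1
    rw [← lor_pt_zero_iff hv1 (lor_rep_extVec_self hq ω), ← lift_coe] at hxs
    have hxu := (exists_sphere_preimage hω hxs).1
    have hfx' := (hf x' (hgt _ hxu)).1
    refine ⟨f x', mem_biUnion ((hparam _).mpr ⟨ω, hω, rfl⟩) ?_, ?_⟩
    · change f x' ∈ Metric.sphere (ctr (W ω)) (rad (W ω))
      rw [← lor_pt_zero_iff (hW ω hω).1 (hW ω hω).2, ← lift_coe, hzero, ← hfx',
        Equiv.symm_apply_apply]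
      exact hxs
    · rw [hzx, dist_comm]; exact hδε hxd

end RoundCarpet

/-! ## Measures on disk packings -/

namespace RoundCarpet

/-- The measure `∑_p R_p 𝓗¹_{∂D_p}` of a family of disks on `K`. -/
noncomputable def packMeasure (P : Set (ℂ × ℝ)) (K : Set ℂ) : Measure K :=
  (Measure.sum fun p : P => ENNReal.ofReal p.1.2 • circleLength p.1.1 p.1.2).comap Subtype.val

/-- The disjoint union of the parameter intervals `(0, 2π]` of the circles of `P`. -/
noncomputable def arcMeasure (P : Set (ℂ × ℝ)) : Measure (P × ℝ) :=
  (Measure.count : Measure P).prod (volume.restrict (Ioc 0 (2 * π)))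

variable {m₀ : ℂ} {R₀ : ℝ} {P : Set (ℂ × ℝ)} {K : Set ℂ}

theorem lintegral_arc {F : P × ℝ → ℝ≥0∞} (hF : Measurable F) :
    ∫⁻ z, F z ∂(arcMeasure P) = ∑' p : P, ∫⁻ θ in Ioc 0 (2 * π), F (p, θ) := by
  rw [arcMeasure, lintegral_prod _ hF.aemeasurable, lintegral_count]

namespace IsDiskPacking

/-- The parametrization of the boundary circle of a disk of the packing. -/
noncomputable def circ (h : IsDiskPacking m₀ R₀ P K) (p : P) (θ : ℝ) : K :=
  ⟨circleMap p.1.1 p.1.2 θ,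
    h.sphere_subset p.1 p.2 (circleMap_mem_sphere _ (h.radius_pos p.1 p.2).le θ)⟩

theorem pos (h : IsDiskPacking m₀ R₀ P K) (p : P) : 0 < p.1.2 := h.radius_pos p.1 p.2

theorem continuous_circ (h : IsDiskPacking m₀ R₀ P K) (p : P) : Continuous (h.circ p) :=
  (continuous_circleMap _ _).subtype_mk _

theorem lipschitz_circ (h : IsDiskPacking m₀ R₀ P K) (p : P) :
    LipschitzWith (Real.nnabs p.1.2) (h.circ p) := fun x y =>
  lipschitzWith_circleMap p.1.1 p.1.2 x y

theorem exists_circ (h : IsDiskPacking m₀ R₀ P K) (p : P) {x : K}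
    (hx : (x : ℂ) ∈ Metric.sphere p.1.1 p.1.2) : ∃ θ ∈ Ioc 0 (2 * π), h.circ p θ = x := by
  rw [← abs_of_pos (h.pos p), ← image_circleMap_Ioc] at hx
  obtain ⟨θ, hθ, e⟩ := hx
  exact ⟨θ, hθ, Subtype.ext e⟩

theorem countable (h : IsDiskPacking m₀ R₀ P K) : Countable P := by
  have : P.Countable := by
    refine PairwiseDisjoint.countable_of_isOpen (s := fun p : ℂ × ℝ => Metric.ball p.1 p.2)
      (fun p hp p' hp' hne => ?_) (fun p _ => Metric.isOpen_ball)
      (fun p hp => Metric.nonempty_ball.mpr (h.radius_pos p hp))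
    exact (h.disjoint p hp p' hp' hne).mono Metric.ball_subset_closedBall
      Metric.ball_subset_closedBall
  exact this.to_subtype

theorem subset_ball (h : IsDiskPacking m₀ R₀ P K) : K ⊆ Metric.ball m₀ R₀ := by
  obtain ⟨F, -, rfl⟩ := h.exists_isClosed
  exact inter_subset_left

theorem isLocallyClosed (h : IsDiskPacking m₀ R₀ P K) : IsLocallyClosed K := by
  obtain ⟨F, hF, rfl⟩ := h.exists_isClosed
  exact Metric.isOpen_ball.isLocallyClosed.inter hF.isLocallyClosed

theorem measurableSet (h : IsDiskPacking m₀ R₀ P K) : MeasurableSet K := by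
  obtain ⟨F, hF, rfl⟩ := h.exists_isClosed
  exact Metric.isOpen_ball.measurableSet.inter hF.measurableSet

theorem tsum_volume_ball (h : IsDiskPacking m₀ R₀ P K) :
    ∑' p : P, volume (Metric.ball p.1.1 p.1.2) ≤ volume (Metric.ball m₀ R₀) := by
  have := h.countable
  rw [← measure_iUnion]
  · exact measure_mono (iUnion_subset fun p =>
      Metric.ball_subset_closedBall.trans (h.closedBall_subset p.1 p.2))
  · intro p p' hne
    exact (h.disjoint p.1 p.2 p'.1 p'.2 (fun e => hne (Subtype.ext e))).mono
      Metric.ball_subset_closedBall Metric.ball_subset_closedBall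
  · exact fun p => Metric.isOpen_ball.measurableSet

/-- The disks are disjoint and their areas `π R²` add up to at most the area of the large disk. This
gives finiteness of the measure and of the energy of Lipschitz functions, and it drives the tail
estimate. -/
theorem summable_sq (h : IsDiskPacking m₀ R₀ P K) : Summable fun p : P => p.1.2 ^ 2 := by
  have h1 : ∑' p : P, volume (Metric.ball p.1.1 p.1.2) ≠ ∞ :=
    ne_top_of_le_ne_top measure_ball_lt_top.ne h.tsum_volume_ball
  have h2 := ENNReal.summable_toReal h1
  have e : (fun p : P => (volume (Metric.ball p.1.1 p.1.2)).toReal) =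
      fun p : P => p.1.2 ^ 2 * π := by
    ext p
    rw [Complex.volume_ball, ENNReal.toReal_mul, ENNReal.toReal_pow,
      ENNReal.toReal_ofReal (h.pos p).le]
    rfl
  rw [e] at h2
  exact (summable_mul_right_iff Real.pi_ne_zero).mp h2

theorem packMeasure_eq (h : IsDiskPacking m₀ R₀ P K) : packMeasure P K =
    Measure.sum fun p : P => ENNReal.ofReal (p.1.2 ^ 2) •
      (volume.restrict (Ioc 0 (2 * π))).map (h.circ p) := by
  ext s hs
  rw [packMeasure, (MeasurableEmbedding.subtype_coe h.measurableSet).comap_apply,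
    Measure.sum_apply _ ((MeasurableEmbedding.subtype_coe h.measurableSet).measurableSet_image' hs),
    Measure.sum_apply _ hs]
  refine tsum_congr fun p => ?_
  rw [circleLength, Measure.smul_apply, Measure.smul_apply, Measure.smul_apply,
    Measure.map_apply (continuous_circleMap _ _).measurable
      ((MeasurableEmbedding.subtype_coe h.measurableSet).measurableSet_image' hs),
    Measure.map_apply (h.continuous_circ p).measurable hs, sq, ENNReal.ofReal_mul (h.pos p).le,
    smul_eq_mul, smul_eq_mul, smul_eq_mul, mul_assoc]
  congr 3
  ext θ
  constructor
  · rintro ⟨x, hx, e⟩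
    have : h.circ p θ = x := Subtype.ext e.symm
    exact mem_preimage.mpr (this ▸ hx)
  · exact fun hx => ⟨_, hx, rfl⟩

theorem lintegral (h : IsDiskPacking m₀ R₀ P K) {F : K → ℝ≥0∞} (hF : Measurable F) :
    ∫⁻ x, F x ∂(packMeasure P K) =
      ∑' p : P, ENNReal.ofReal (p.1.2 ^ 2) * ∫⁻ θ in Ioc 0 (2 * π), F (h.circ p θ) := by
  rw [h.packMeasure_eq, lintegral_sum_measure]
  refine tsum_congr fun p => ?_
  rw [lintegral_smul_measure, lintegral_map hF (h.continuous_circ p).measurable, smul_eq_mul]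

theorem ae_circ (h : IsDiskPacking m₀ R₀ P K) {Q : K → Prop} (hQ : ∀ᵐ x ∂(packMeasure P K), Q x)
    (p : P) : ∀ᵐ θ ∂(volume.restrict (Ioc 0 (2 * π))), Q (h.circ p θ) := by
  have := h.countable
  rw [h.packMeasure_eq, Measure.ae_sum_iff] at hQ
  have h1 := hQ p
  rw [Measure.ae_ennreal_smul_measure_iff (by
    rw [Ne, ENNReal.ofReal_eq_zero, not_le]; exact pow_pos (h.pos p) 2)] at h1
  exact ae_of_ae_map (h.continuous_circ p).aemeasurable h1

theorem ae_arc_iff (h : IsDiskPacking m₀ R₀ P K) {Q : P × ℝ → Prop} :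
    (∀ᵐ z ∂(arcMeasure P), Q z) ↔
      ∀ p, ∀ᵐ θ ∂(volume.restrict (Ioc 0 (2 * π))), Q (p, θ) := by
  have := h.countable
  constructor
  · intro hQ p
    exact (Measure.ae_count_iff.mp (Measure.ae_ae_of_ae_prod hQ)) p
  · intro hQ
    have : {z : P × ℝ | ¬ Q z} ⊆ ⋃ p : P, {p} ×ˢ {θ | ¬ Q (p, θ)} := fun z hz =>
      mem_iUnion.mpr ⟨z.1, rfl, hz⟩
    refine measure_mono_null this (measure_iUnion_null fun p => ?_)
    rw [arcMeasure, Measure.prod_prod, ae_iff.mp (hQ p), mul_zero]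

theorem ae_arc (h : IsDiskPacking m₀ R₀ P K) {Q : K → Prop} (hQ : ∀ᵐ x ∂(packMeasure P K), Q x) :
    ∀ᵐ z ∂(arcMeasure P), Q (h.circ z.1 z.2) :=
  h.ae_arc_iff.mpr fun p => h.ae_circ hQ p

theorem measurable_circ (h : IsDiskPacking m₀ R₀ P K) :
    Measurable fun z : P × ℝ => h.circ z.1 z.2 := by
  have := h.countable
  exact measurable_from_prod_countable_right fun p => (h.continuous_circ p).measurable

theorem isFiniteMeasure (h : IsDiskPacking m₀ R₀ P K) : IsFiniteMeasure (packMeasure P K) := by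
  refine ⟨?_⟩
  rw [← lintegral_one, h.lintegral measurable_const]
  simp only [lintegral_one, Measure.restrict_apply_univ, Real.volume_Ioc]
  rw [ENNReal.tsum_mul_right]
  exact ENNReal.mul_lt_top (ENNReal.tsum_coe_ne_top_iff_summable.mpr h.summable_sq.toNNReal).lt_top
    ENNReal.ofReal_lt_top

/-- Circles are dense in `K`, so a nonempty open set contains an arc of positive length of one of
them. -/
theorem isOpenPosMeasure (h : IsDiskPacking m₀ R₀ P K) :
    (packMeasure P K).IsOpenPosMeasure := by
  refine ⟨fun U hU hne h0 => ?_⟩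
  obtain ⟨x, hx⟩ := hne
  obtain ⟨V, hV, rfl⟩ := isOpen_induced_iff.mp hU
  obtain ⟨z, hzV, hz⟩ := mem_closure_iff.mp (h.dense x.2) V hV hx
  obtain ⟨p, hp, hz⟩ := mem_iUnion₂.mp hz
  obtain ⟨θ, hθ, e⟩ := h.exists_circ ⟨p, hp⟩ (x := ⟨z, h.sphere_subset p hp hz⟩) hz
  have h1 : ∀ᵐ x ∂(packMeasure P K), x ∉ (Subtype.val ⁻¹' V : Set K) := by
    rw [ae_iff]; simp only [not_not]; exact h0
  have h2 := h.ae_circ h1 ⟨p, hp⟩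
  have hO : IsOpen (h.circ ⟨p, hp⟩ ⁻¹' (Subtype.val ⁻¹' V)) :=
    (hV.preimage continuous_subtype_val).preimage (h.continuous_circ _)
  have hmem : θ ∈ h.circ ⟨p, hp⟩ ⁻¹' (Subtype.val ⁻¹' V) := by
    change ((h.circ ⟨p, hp⟩ θ : K) : ℂ) ∈ V
    rw [e]; exact hzV
  -- The angle `θ` may be the endpoint `2π`, hence the passage to the closure of the open interval.
  have h3 : (h.circ ⟨p, hp⟩ ⁻¹' (Subtype.val ⁻¹' V) ∩ Ioo 0 (2 * π)).Nonempty := by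
    have : θ ∈ closure (Ioo 0 (2 * π)) := by
      rw [closure_Ioo Real.two_pi_pos.ne]; exact Ioc_subset_Icc_self hθ
    exact mem_closure_iff.mp this _ hO hmem
  have h4 := (hO.inter isOpen_Ioo).measure_pos (volume : Measure ℝ) h3
  rw [ae_restrict_iff' measurableSet_Ioc] at h2
  refine h4.ne' (measure_mono_null (fun t ht => ?_) h2)
  simp only [mem_compl_iff, mem_ofPred_eq, not_forall, not_not]
  exact ⟨Ioo_subset_Ioc_self ht.2, ht.1⟩

end IsDiskPacking

end RoundCarpet

/-! ## Tangential derivatives on the circles of a packing -/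

namespace RoundCarpet

variable {m₀ : ℂ} {R₀ : ℝ} {P : Set (ℂ × ℝ)} {K : Set ℂ}

namespace IsDiskPacking

theorem integrable_arc (h : IsDiskPacking m₀ R₀ P K) {F : P × ℝ → ℝ} (hm : Measurable F) (C : ℝ)
    (hF : ∀ z, |F z| ≤ C * z.1.1.2 ^ 2) : Integrable F (arcMeasure P) := by
  refine ⟨hm.aestronglyMeasurable, ?_⟩
  rw [HasFiniteIntegral, lintegral_arc hm.enorm]
  have hC : ∀ p : P, ∫⁻ θ in Ioc 0 (2 * π), ‖F (p, θ)‖ₑ ≤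
      ENNReal.ofReal (C * p.1.2 ^ 2 * (2 * π)) := fun p => by
    have h0 : 0 ≤ C * p.1.2 ^ 2 := (abs_nonneg _).trans (hF (p, 0))
    calc _ ≤ ∫⁻ _ in Ioc 0 (2 * π), ENNReal.ofReal (C * p.1.2 ^ 2) := by
          refine lintegral_mono fun θ => ?_
          rw [Real.enorm_eq_ofReal_abs]
          exact ENNReal.ofReal_le_ofReal (hF (p, θ))
      _ = _ := by
          rw [lintegral_const, Measure.restrict_apply_univ, Real.volume_Ioc, sub_zero,
            ENNReal.ofReal_mul h0]
  refine lt_of_le_of_lt (ENNReal.tsum_le_tsum hC) ?_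
  exact ((h.summable_sq.mul_left C).mul_right (2 * π)).tsum_ofReal_lt_top

theorem hasSum_arc (h : IsDiskPacking m₀ R₀ P K) {F : P × ℝ → ℝ}
    (hF : Integrable F (arcMeasure P)) :
    HasSum (fun p => ∫ θ in Ioc 0 (2 * π), F (p, θ)) (∫ z, F z ∂(arcMeasure P)) := by
  have := h.countable
  rw [arcMeasure, integral_prod _ hF]
  have h1 := hasSum_integral_measure (μ := fun p : P => Measure.dirac p) hF.integral_prod_left
  simp only [integral_dirac] at h1
  exact h1

/-- The derivatives of a function on `K` along the circles of the packing. -/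
noncomputable def arcDeriv (h : IsDiskPacking m₀ R₀ P K) (u : K → ℝ) (z : P × ℝ) : ℝ :=
  deriv (fun θ => u (h.circ z.1 θ)) z.2

theorem measurable_arcDeriv (h : IsDiskPacking m₀ R₀ P K) (u : K → ℝ) :
    Measurable (h.arcDeriv u) := by
  have := h.countable
  exact measurable_from_prod_countable_right fun p =>
    measurable_deriv fun θ => u (h.circ p θ)

theorem lipschitz_comp_circ (h : IsDiskPacking m₀ R₀ P K) {u : K → ℝ} {L : ℝ≥0}
    (hu : LipschitzWith L u) (p : P) :
    LipschitzWith (L * Real.nnabs p.1.2) fun θ => u (h.circ p θ) :=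
  hu.comp (h.lipschitz_circ p)

theorem abs_arcDeriv_le (h : IsDiskPacking m₀ R₀ P K) {u : K → ℝ} {L : ℝ≥0}
    (hu : LipschitzWith L u) (z : P × ℝ) : |h.arcDeriv u z| ≤ L * z.1.1.2 := by
  have := norm_deriv_le_of_lipschitz (x₀ := z.2) (h.lipschitz_comp_circ hu z.1)
  rwa [Real.norm_eq_abs, NNReal.coe_mul, Real.coe_nnabs, abs_of_pos (h.pos z.1)] at this

theorem integrable_arcDeriv_mul (h : IsDiskPacking m₀ R₀ P K) {u v : K → ℝ} {L M : ℝ≥0}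
    (hu : LipschitzWith L u) (hv : LipschitzWith M v) :
    Integrable (fun z => h.arcDeriv u z * h.arcDeriv v z) (arcMeasure P) := by
  refine h.integrable_arc ((h.measurable_arcDeriv u).mul (h.measurable_arcDeriv v)) (L * M)
    fun z => ?_
  rw [abs_mul]
  calc _ ≤ (L * z.1.1.2) * (M * z.1.1.2) := mul_le_mul (h.abs_arcDeriv_le hu z)
        (h.abs_arcDeriv_le hv z) (abs_nonneg _) (mul_nonneg L.2 (h.pos z.1).le)
    _ = _ := by ring

theorem memLp_arcDeriv (h : IsDiskPacking m₀ R₀ P K) {u : K → ℝ} {L : ℝ≥0}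
    (hu : LipschitzWith L u) : MemLp (h.arcDeriv u) 2 (arcMeasure P) := by
  rw [memLp_two_iff_integrable_sq (h.measurable_arcDeriv u).aestronglyMeasurable]
  simpa only [sq] using h.integrable_arcDeriv_mul hu hu

theorem circleGrad_circleMap (h : IsDiskPacking m₀ R₀ P K) (u : K → ℝ) (p : P) (θ : ℝ) :
    circleGrad p.1.1 p.1.2 (extendZero u) (circleMap p.1.1 p.1.2 θ) =
      (h.arcDeriv u (p, θ) / p.1.2) • (Complex.I * (circleMap p.1.1 p.1.2 θ - p.1.1) / p.1.2) := by
  have e : (fun φ : ℝ => extendZero u (p.1.1 + (circleMap p.1.1 p.1.2 θ - p.1.1) *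
      Complex.exp (φ * Complex.I))) = fun φ => u (h.circ p (θ + φ)) := by
    ext φ
    have e1 : p.1.1 + (circleMap p.1.1 p.1.2 θ - p.1.1) * Complex.exp (φ * Complex.I) =
        ((h.circ p (θ + φ) : K) : ℂ) := by
      simp only [circ, circleMap]
      push_cast
      rw [add_mul, Complex.exp_add]; ring
    rw [e1]
    exact Subtype.val_injective.extend_apply _ _ _
  rw [circleGrad, e, deriv_comp_const_add (f := fun φ => u (h.circ p φ)), add_zero]
  rfl

theorem energyDensity_circleMap (h : IsDiskPacking m₀ R₀ P K) (u v : K → ℝ) (p : P) (θ : ℝ) :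
    energyDensity u v p.1.1 p.1.2 (circleMap p.1.1 p.1.2 θ) =
      h.arcDeriv u (p, θ) * h.arcDeriv v (p, θ) / p.1.2 := by
  have hR := h.pos p
  have hn : ‖Complex.I * (circleMap p.1.1 p.1.2 θ - p.1.1) / (p.1.2 : ℂ)‖ = 1 := by
    rw [norm_div, norm_mul, Complex.norm_I, circleMap_sub_center, norm_circleMap_zero,
      Complex.norm_real, Real.norm_eq_abs, one_mul, div_self (abs_pos.mpr hR.ne').ne']
  rw [energyDensity, h.circleGrad_circleMap, h.circleGrad_circleMap, inner_smul_left,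
    inner_smul_right, real_inner_self_eq_norm_sq, hn]
  simp only [conj_trivial]
  field_simp

/-- On one period the parametrisation is injective, hence a measurable embedding of the interval as
a subtype. Integrals over the circle can then be transferred without measurability of the density on
`ℂ`. -/
theorem map_circleMap_eq (p : ℂ × ℝ) :
    (volume.restrict (Ioc 0 (2 * π))).map (circleMap p.1 p.2) =
      ((volume : Measure ℝ).comap Subtype.val).map
        ((Ioc 0 (2 * π)).domRestrict (circleMap p.1 p.2)) := by
  rw [← map_comap_subtype_coe measurableSet_Ioc, Measure.map_map
    (continuous_circleMap _ _).measurable measurable_subtype_coe]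
  rfl

theorem measurableEmbedding_circleMap {p : ℂ × ℝ} (hp : 0 < p.2) :
    MeasurableEmbedding ((Ioc 0 (2 * π)).domRestrict (circleMap p.1 p.2)) := by
  refine ContinuousOn.measurableEmbedding measurableSet_Ioc (continuous_circleMap _ _).continuousOn ?_
  have := injOn_circleMap_of_abs_sub_le (a := 0) (b := 2 * π) (c := p.1) hp.ne'
    (by rw [zero_sub, abs_neg, abs_of_pos Real.two_pi_pos])
  rwa [uIoc_of_le Real.two_pi_pos.le] at this

theorem integrable_energyDensity (h : IsDiskPacking m₀ R₀ P K) {u v : K → ℝ} {L M : ℝ≥0}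
    (hu : LipschitzWith L u) (hv : LipschitzWith M v) (p : P) :
    Integrable (energyDensity u v p.1.1 p.1.2) (circleLength p.1.1 p.1.2) := by
  refine Integrable.smul_measure ?_ ENNReal.ofReal_ne_top
  rw [map_circleMap_eq, (measurableEmbedding_circleMap (h.pos p)).integrable_map_iff]
  have : Integrable (fun θ => h.arcDeriv u (p, θ) * h.arcDeriv v (p, θ) / p.1.2)
      (volume.restrict (Ioc 0 (2 * π))) := by
    refine Integrable.div_const (Integrable.of_bound (C := (L * p.1.2) * (M * p.1.2)) ?_
      (ae_of_all _ fun θ => ?_)) _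
    · exact (((h.measurable_arcDeriv u).mul (h.measurable_arcDeriv v)).comp
        measurable_prodMk_left).aestronglyMeasurable
    · rw [Real.norm_eq_abs, abs_mul]
      exact mul_le_mul (h.abs_arcDeriv_le hu (p, θ)) (h.abs_arcDeriv_le hv (p, θ))
        (abs_nonneg _) (mul_nonneg L.2 (h.pos p).le)
  rw [← map_comap_subtype_coe measurableSet_Ioc,
    (MeasurableEmbedding.subtype_coe measurableSet_Ioc).integrable_map_iff] at this
  refine this.congr (ae_of_all _ fun θ => ?_)
  exact (h.energyDensity_circleMap u v p θ).symm

/-- The angular derivative is `R` times the arc length derivative, so the factors `R⁻²`, `R` and `R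
dθ` cancel. This is why `arcMeasure` carries no weights while `packMeasure` has weights `R²`. -/
theorem circleEnergy_eq (h : IsDiskPacking m₀ R₀ P K) (u v : K → ℝ) (p : P) :
    circleEnergy u v p.1.1 p.1.2 =
      ∫ θ in Ioc 0 (2 * π), h.arcDeriv u (p, θ) * h.arcDeriv v (p, θ) := by
  rw [circleEnergy, circleLength, integral_smul_measure, map_circleMap_eq,
    (measurableEmbedding_circleMap (h.pos p)).integral_map, ENNReal.toReal_ofReal (h.pos p).le]
  have e : ∀ θ : Ioc 0 (2 * π), energyDensity u v p.1.1 p.1.2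
      ((Ioc 0 (2 * π)).domRestrict (circleMap p.1.1 p.1.2) θ) =
      h.arcDeriv u (p, θ) * h.arcDeriv v (p, θ) / p.1.2 := fun θ =>
    h.energyDensity_circleMap u v p θ
  simp only [e]
  rw [integral_subtype_comap measurableSet_Ioc
    (fun θ => h.arcDeriv u (p, θ) * h.arcDeriv v (p, θ) / p.1.2), integral_div, smul_eq_mul,
    mul_div_cancel₀ _ (h.pos p).ne']

/-- The sum of the energies of the circles. -/
noncomputable def energy (h : IsDiskPacking m₀ R₀ P K) (u v : K → ℝ) : ℝ :=
  ∫ z, h.arcDeriv u z * h.arcDeriv v z ∂(arcMeasure P)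

theorem hasSum_circleEnergy (h : IsDiskPacking m₀ R₀ P K) {u v : K → ℝ} {L M : ℝ≥0}
    (hu : LipschitzWith L u) (hv : LipschitzWith M v) :
    HasSum (fun p : P => circleEnergy u v p.1.1 p.1.2) (h.energy u v) := by
  simp only [h.circleEnergy_eq]
  exact h.hasSum_arc (h.integrable_arcDeriv_mul hu hv)

theorem ae_hasDerivAt (h : IsDiskPacking m₀ R₀ P K) {u : K → ℝ} {L : ℝ≥0}
    (hu : LipschitzWith L u) :
    ∀ᵐ z ∂(arcMeasure P), HasDerivAt (fun θ => u (h.circ z.1 θ)) (h.arcDeriv u z) z.2 :=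
  h.ae_arc_iff.mpr fun p => ae_restrict_of_ae
    ((h.lipschitz_comp_circ hu p).ae_differentiableAt_real.mono fun _ hθ => hθ.hasDerivAt)

theorem intervalIntegral_arcDeriv (h : IsDiskPacking m₀ R₀ P K) {u : K → ℝ} {L : ℝ≥0}
    (hu : LipschitzWith L u) (p : P) (a b : ℝ) :
    ∫ θ in a..b, h.arcDeriv u (p, θ) = u (h.circ p b) - u (h.circ p a) :=
  ((h.lipschitz_comp_circ hu p).lipschitzOnWith.absolutelyContinuousOnInterval).integral_deriv_eq_sub

end IsDiskPacking

end RoundCarpet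

/-! ## The closed derivative of a packing -/

namespace RoundCarpet

/-- The derivative of an absolutely continuous function vanishes almost everywhere on each of
its level sets. -/
theorem ae_eq_zero_of_eq_const {f w : ℝ → ℝ} {a c T : ℝ} (hT : 0 ≤ T)
    (hw : IntervalIntegrable w volume 0 T)
    (hf : ∀ᵐ θ ∂(volume.restrict (Ioc 0 T)), f θ = a + ∫ s in 0..θ, w s) :
    ∀ᵐ θ ∂(volume.restrict (Ioc 0 T)), f θ = c → w θ = 0 := by
  set G := fun θ => a + ∫ s in 0..θ, w s with hG
  set s := {θ | G θ = c}
  -- Points of the level set that are isolated in it from the right are countable. At any other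
  -- point the derivative is a limit of difference quotients along the level set, which are zero.
  have h1 : ∀ᵐ θ, θ ∉ {x ∈ s | 𝓝[s ∩ Ioi x] x = ⊥} :=
    (countable_setOfPred_isolated_right_within (s := s)).ae_notMem volume
  have h2 := hw.ae_hasDerivAt_integral
  filter_upwards [hf, ae_restrict_of_ae h1, ae_restrict_of_ae h2,
    ae_restrict_mem measurableSet_Ioc] with θ e1 e2 e3 hθ hc
  have hs : θ ∈ s := e1.symm.trans hc
  have hne : (𝓝[s ∩ Ioi θ] θ).NeBot := ⟨fun h => e2 ⟨hs, h⟩⟩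
  have hd : HasDerivAt G (w θ) θ := by
    rw [uIcc_of_le hT] at e3
    exact (e3 (Ioc_subset_Icc_self hθ) 0 (left_mem_Icc.mpr hT)).const_add a
  have hd' := (hasDerivWithinAt_iff_tendsto_slope' (fun h => lt_irrefl θ h.2)).mp
    (hd.hasDerivWithinAt (s := s ∩ Ioi θ))
  refine tendsto_nhds_unique hd' (tendsto_const_nhds.congr' ?_)
  filter_upwards [self_mem_nhdsWithin] with t ht
  rw [slope_def_field, ht.1, hs, sub_self, zero_div]

variable {m₀ : ℂ} {R₀ : ℝ} {P : Set (ℂ × ℝ)} {K : Set ℂ}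

/-- The compactly supported Lipschitz functions on `K`. -/
def lipSpace (K : Set ℂ) : Submodule ℝ (K → ℝ) where
  carrier := {u | HasCompactSupport u ∧ ∃ L : ℝ≥0, LipschitzWith L u}
  zero_mem' := ⟨HasCompactSupport.zero, 0, LipschitzWith.const 0⟩
  add_mem' := by
    rintro u v ⟨hu, L, hL⟩ ⟨hv, M, hM⟩
    exact ⟨hu.add hv, L + M, hL.add hM⟩
  smul_mem' := by
    rintro a u ⟨hu, L, hL⟩
    exact ⟨hu.smul_left (f := fun _ => a), ‖a‖₊ * L, (lipschitzWith_smul a).comp hL⟩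

namespace IsDiskPacking

theorem restrict_arc (h : IsDiskPacking m₀ R₀ P K) (p : P) (s : Set ℝ) :
    (arcMeasure P).restrict ({p} ×ˢ s) =
      ((volume.restrict (Ioc 0 (2 * π))).restrict s).map (Prod.mk p) := by
  have := h.countable
  rw [arcMeasure, ← Measure.prod_restrict, Measure.restrict_singleton, Measure.count_singleton,
    one_smul, Measure.dirac_prod]

theorem memLp_slice (h : IsDiskPacking m₀ R₀ P K) {w : P × ℝ → ℝ} (hw : MemLp w 2 (arcMeasure P))
    (p : P) : MemLp (fun θ => w (p, θ)) 2 (volume.restrict (Ioc 0 (2 * π))) := by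
  have h1 := hw.restrict ({p} ×ˢ univ)
  rw [h.restrict_arc p univ, Measure.restrict_univ,
    (measurableEmbedding_prodMk_left p).memLp_map_measure_iff] at h1
  exact h1

theorem intervalIntegrable_slice (h : IsDiskPacking m₀ R₀ P K) {w : P × ℝ → ℝ}
    (hw : MemLp w 2 (arcMeasure P)) (p : P) :
    IntervalIntegrable (fun θ => w (p, θ)) volume 0 (2 * π) := by
  rw [intervalIntegrable_iff_integrableOn_Ioc_of_le Real.two_pi_pos.le]
  exact (h.memLp_slice hw p).integrable one_le_two

theorem intervalIntegral_slice (h : IsDiskPacking m₀ R₀ P K) (w : P × ℝ → ℝ) (p : P) {θ : ℝ}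
    (hθ : θ ∈ Ioc 0 (2 * π)) :
    ∫ s in 0..θ, w (p, s) = ∫ z in ({p} ×ˢ Ioc 0 θ), w z ∂(arcMeasure P) := by
  rw [h.restrict_arc p, (measurableEmbedding_prodMk_left p).integral_map,
    intervalIntegral.integral_of_le hθ.1.le, Measure.restrict_restrict measurableSet_Ioc,
    inter_eq_self_of_subset_left (Ioc_subset_Ioc_right hθ.2)]

/-- The integral over `{p} × (0, θ]` is the inner product with an indicator function of finite
measure, hence continuous on `L²`. -/
theorem tendsto_intervalIntegral (h : IsDiskPacking m₀ R₀ P K) {w : ℕ → Lp ℝ 2 (arcMeasure P)}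
    {w₀ : Lp ℝ 2 (arcMeasure P)} (hw : Tendsto w atTop (𝓝 w₀)) (p : P) {θ : ℝ}
    (hθ : θ ∈ Ioc 0 (2 * π)) :
    Tendsto (fun n => ∫ s in 0..θ, w n (p, s)) atTop (𝓝 (∫ s in 0..θ, w₀ (p, s))) := by
  have hm : MeasurableSet (({p} : Set P) ×ˢ Ioc 0 θ) :=
    (measurableSet_singleton p).prod measurableSet_Ioc
  have hfin : arcMeasure P ({p} ×ˢ Ioc 0 θ) ≠ ∞ := by
    have := h.countable
    rw [arcMeasure, Measure.prod_prod, Measure.count_singleton, one_mul]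
    exact measure_ne_top _ _
  simp only [h.intervalIntegral_slice _ p hθ]
  simp only [← L2.inner_indicatorConstLp_one (𝕜 := ℝ) hm hfin]
  exact tendsto_const_nhds.inner hw

theorem memLp_of_mem (h : IsDiskPacking m₀ R₀ P K) {u : K → ℝ} (hu : u ∈ lipSpace K) :
    MemLp u 2 (packMeasure P K) := by
  have := h.isFiniteMeasure
  obtain ⟨hc, L, hL⟩ := hu
  exact hL.continuous.memLp_of_hasCompactSupport hc

/-- The graph of the tangential derivative on Lipschitz functions. -/
noncomputable def lipGraph (h : IsDiskPacking m₀ R₀ P K) :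
    Submodule ℝ (Lp ℝ 2 (packMeasure P K) × Lp ℝ 2 (arcMeasure P)) where
  carrier := {x | ∃ u ∈ lipSpace K, (x.1 : K → ℝ) =ᵐ[packMeasure P K] u ∧
    (x.2 : P × ℝ → ℝ) =ᵐ[arcMeasure P] h.arcDeriv u}
  zero_mem' := by
    refine ⟨0, zero_mem _, Lp.coeFn_zero _ _ _, (Lp.coeFn_zero _ _ _).trans (ae_of_all _ fun z => ?_)⟩
    simp [arcDeriv]
  add_mem' := by
    rintro x y ⟨u, hu, e1, e2⟩ ⟨v, hv, e3, e4⟩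
    refine ⟨u + v, add_mem hu hv, (Lp.coeFn_add _ _).trans (e1.add e3), ?_⟩
    obtain ⟨-, L, hL⟩ := hu
    obtain ⟨-, M, hM⟩ := hv
    refine (Lp.coeFn_add _ _).trans ((e2.add e4).trans ?_)
    filter_upwards [h.ae_hasDerivAt hL, h.ae_hasDerivAt hM] with z h1 h2
    exact (h1.add h2).deriv.symm
  smul_mem' := by
    rintro c x ⟨u, hu, e1, e2⟩
    refine ⟨c • u, Submodule.smul_mem _ c hu, (Lp.coeFn_smul _ _).trans (e1.const_smul c), ?_⟩
    obtain ⟨-, L, hL⟩ := hu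
    refine (Lp.coeFn_smul _ _).trans ((e2.const_smul c).trans ?_)
    filter_upwards [h.ae_hasDerivAt hL] with z h1
    exact (h1.const_smul c).deriv.symm

/-- The closure of the graph of the tangential derivative. -/
noncomputable def closedGraph (h : IsDiskPacking m₀ R₀ P K) :
    Submodule ℝ (Lp ℝ 2 (packMeasure P K) × Lp ℝ 2 (arcMeasure P)) :=
  h.lipGraph.topologicalClosure

/-- The element of the graph that belongs to a Lipschitz function. -/
theorem exists_mem_lipGraph (h : IsDiskPacking m₀ R₀ P K) {u : K → ℝ} (hu : u ∈ lipSpace K) :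
    ∃ x ∈ h.lipGraph, (x.1 : K → ℝ) =ᵐ[packMeasure P K] u ∧
      (x.2 : P × ℝ → ℝ) =ᵐ[arcMeasure P] h.arcDeriv u := by
  have h1 := h.memLp_of_mem hu
  have h2 := h.memLp_arcDeriv hu.2.choose_spec
  exact ⟨(h1.toLp u, h2.toLp _), ⟨u, hu, h1.coeFn_toLp, h2.coeFn_toLp⟩, h1.coeFn_toLp,
    h2.coeFn_toLp⟩

theorem exists_seq (h : IsDiskPacking m₀ R₀ P K) {x} (hx : x ∈ h.closedGraph) :
    ∃ (y : ℕ → Lp ℝ 2 (packMeasure P K) × Lp ℝ 2 (arcMeasure P)) (u : ℕ → K → ℝ),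
      (∀ n, u n ∈ lipSpace K) ∧ (∀ n, ((y n).1 : K → ℝ) =ᵐ[packMeasure P K] u n) ∧
      (∀ n, ((y n).2 : P × ℝ → ℝ) =ᵐ[arcMeasure P] h.arcDeriv (u n)) ∧
      (∀ n, y n ∈ h.lipGraph) ∧
      Tendsto (fun n => (y n).1) atTop (𝓝 x.1) ∧ Tendsto (fun n => (y n).2) atTop (𝓝 x.2) ∧
      ∀ᵐ t ∂(packMeasure P K), Tendsto (fun n => u n t) atTop (𝓝 (x.1 t)) := by
  obtain ⟨y, hy, hlim⟩ := mem_closure_iff_seq_limit.mp hx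
  have h1 := (continuous_fst.tendsto x).comp hlim
  have h2 := (continuous_snd.tendsto x).comp hlim
  obtain ⟨ns, hns, hae⟩ := (tendstoInMeasure_of_tendsto_Lp h1).exists_seq_tendsto_ae
  choose u hu e1 e2 using hy
  refine ⟨fun n => y (ns n), fun n => u (ns n), fun n => hu _, fun n => e1 _, fun n => e2 _,
    fun n => ⟨_, hu _, e1 _, e2 _⟩, h1.comp hns.tendsto_atTop, h2.comp hns.tendsto_atTop, ?_⟩
  filter_upwards [hae, ae_all_iff.mpr e1] with t ht e
  refine ht.congr fun n => ?_
  exact e (ns n)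

/-- For the Lipschitz approximants the difference `u_n(θ) - ∫₀^θ u_n'` is the number `u_n(0)`. It
converges at almost every `θ`, so the limit is one constant per circle. -/
theorem exists_const (h : IsDiskPacking m₀ R₀ P K) {x} (hx : x ∈ h.closedGraph) (p : P) :
    ∃ a : ℝ, ∀ᵐ θ ∂(volume.restrict (Ioc 0 (2 * π))),
      x.1 (h.circ p θ) = a + ∫ s in 0..θ, x.2 (p, s) := by
  obtain ⟨y, u, hu, -, e2, -, -, h2, hae⟩ := h.exists_seq hx
  have key : ∀ᵐ θ ∂(volume.restrict (Ioc 0 (2 * π))), Tendsto (fun n => u n (h.circ p 0)) atTop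
      (𝓝 (x.1 (h.circ p θ) - ∫ s in 0..θ, x.2 (p, s))) := by
    filter_upwards [h.ae_circ hae p, ae_restrict_mem measurableSet_Ioc] with θ h3 hθ
    refine (h3.sub (h.tendsto_intervalIntegral h2 p hθ)).congr fun n => ?_
    have : ∫ s in 0..θ, (y n).2 (p, s) = ∫ s in 0..θ, h.arcDeriv (u n) (p, s) := by
      rw [h.intervalIntegral_slice _ p hθ, h.intervalIntegral_slice _ p hθ]
      exact integral_congr_ae (ae_restrict_of_ae (e2 n))
    rw [this, h.intervalIntegral_arcDeriv (hu n).2.choose_spec]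
    ring
  have hne : (ae (volume.restrict (Ioc 0 (2 * π)))).NeBot := by
    rw [ae_neBot, Ne, Measure.restrict_eq_zero, Real.volume_Ioc, ENNReal.ofReal_eq_zero, not_le]
    linarith [Real.two_pi_pos]
  obtain ⟨θ₀, hθ₀⟩ := key.exists
  refine ⟨x.1 (h.circ p θ₀) - ∫ s in 0..θ₀, x.2 (p, s), ?_⟩
  filter_upwards [key] with θ hθ
  linarith [tendsto_nhds_unique hθ hθ₀]

/-- Locality of the derivative. -/
theorem ae_deriv_eq_zero (h : IsDiskPacking m₀ R₀ P K) {x} (hx : x ∈ h.closedGraph) (c : ℝ) :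
    ∀ᵐ z ∂(arcMeasure P), x.1 (h.circ z.1 z.2) = c → x.2 z = 0 :=
  h.ae_arc_iff.mpr fun p => by
    obtain ⟨a, ha⟩ := h.exists_const hx p
    exact ae_eq_zero_of_eq_const (w := fun θ => x.2 (p, θ)) Real.two_pi_pos.le
      (h.intervalIntegrable_slice (Lp.memLp _) p) ha

theorem ae_arcDeriv_eq_zero (h : IsDiskPacking m₀ R₀ P K) {u : K → ℝ} {L : ℝ≥0}
    (hu : LipschitzWith L u) (c : ℝ) :
    ∀ᵐ z ∂(arcMeasure P), u (h.circ z.1 z.2) = c → h.arcDeriv u z = 0 :=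
  h.ae_arc_iff.mpr fun p => by
    refine ae_eq_zero_of_eq_const (f := fun θ => u (h.circ p θ)) (a := u (h.circ p 0))
      (w := fun θ => h.arcDeriv u (p, θ)) Real.two_pi_pos.le
      (h.intervalIntegrable_slice (h.memLp_arcDeriv hu) p) (ae_of_all _ fun θ => ?_)
    rw [h.intervalIntegral_arcDeriv hu]; ring

/-- This is closability: a limit function that vanishes a.e. lies on the level 0, where its
derivative vanishes as well. -/
theorem snd_eq_zero (h : IsDiskPacking m₀ R₀ P K) {x} (hx : x ∈ h.closedGraph) (h0 : x.1 = 0) :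
    x.2 = 0 := by
  rw [Lp.eq_zero_iff_ae_eq_zero]
  have h1 : ∀ᵐ t ∂(packMeasure P K), x.1 t = 0 := by
    rw [h0]; exact Lp.coeFn_zero _ _ _
  filter_upwards [h.ae_deriv_eq_zero hx 0, h.ae_arc h1] with z h2 h3
  exact h2 h3

end IsDiskPacking

end RoundCarpet

/-! ## The Markov property of the closed derivative -/

namespace RoundCarpet

/-- The unit contraction. -/
def unitClip (t : ℝ) : ℝ := min (max t 0) 1

theorem unitClip_zero : unitClip 0 = 0 := by simp [unitClip]

theorem lipschitz_unitClip : LipschitzWith 1 unitClip :=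
  (LipschitzWith.id.max_const 0).min_const 1

/-- The indicator function of the interval `(0, 1)`. -/
noncomputable def unitInd : ℝ → ℝ := (Ioo 0 1).indicator 1

theorem measurable_unitInd : Measurable unitInd := measurable_one.indicator measurableSet_Ioo

theorem unitInd_of_mem {t : ℝ} (ht : t ∈ Ioo (0 : ℝ) 1) : unitInd t = 1 := by
  simp [unitInd, ht]

theorem unitInd_of_notMem {t : ℝ} (ht : t ∉ Ioo (0 : ℝ) 1) : unitInd t = 0 :=
  indicator_of_notMem ht _

theorem abs_unitInd_le (t : ℝ) : |unitInd t| ≤ 1 := by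
  by_cases ht : t ∈ Ioo (0 : ℝ) 1
  · simp [unitInd_of_mem ht]
  · simp [unitInd_of_notMem ht]

theorem abs_unitInd_sub_le (s t : ℝ) : |unitInd s - unitInd t| ≤ 1 := by
  by_cases hs : s ∈ Ioo (0 : ℝ) 1 <;> by_cases ht : t ∈ Ioo (0 : ℝ) 1 <;>
    simp [unitInd_of_mem, unitInd_of_notMem, hs, ht]

theorem tendsto_unitInd {a : ℕ → ℝ} {t : ℝ} (ha : Tendsto a atTop (𝓝 t)) (h0 : t ≠ 0)
    (h1 : t ≠ 1) : ∀ᶠ n in atTop, unitInd (a n) = unitInd t := by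
  by_cases ht : t ∈ Ioo (0 : ℝ) 1
  · filter_upwards [ha.eventually (isOpen_Ioo.mem_nhds ht)] with n hn
    rw [unitInd_of_mem hn, unitInd_of_mem ht]
  · have : t ∈ (Icc (0 : ℝ) 1)ᶜ := fun h =>
      ht ⟨lt_of_le_of_ne h.1 h0.symm, lt_of_le_of_ne h.2 h1⟩
    filter_upwards [ha.eventually (isClosed_Icc.isOpen_compl.mem_nhds this)] with n hn
    rw [unitInd_of_notMem (fun h => hn (Ioo_subset_Icc_self h)), unitInd_of_notMem ht]

theorem unitClip_mem_lipSpace {K : Set ℂ} {u : K → ℝ} (hu : u ∈ lipSpace K) :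
    (fun x => unitClip (u x)) ∈ lipSpace K :=
  ⟨hu.1.comp_left unitClip_zero, hu.2.imp fun L hL => by
    have := lipschitz_unitClip.comp hL
    rwa [one_mul] at this
    ⟩

variable {m₀ : ℂ} {R₀ : ℝ} {P : Set (ℂ × ℝ)} {K : Set ℂ}

namespace IsDiskPacking

/-- The corners of the contraction cause no trouble: outside `(0, 1)` the clipped function has the
value 0 or 1, and on these level sets its derivative vanishes a.e. -/
theorem ae_arcDeriv_unitClip (h : IsDiskPacking m₀ R₀ P K) {u : K → ℝ} (hu : u ∈ lipSpace K) :
    ∀ᵐ z ∂(arcMeasure P), h.arcDeriv (fun x => unitClip (u x)) z =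
      unitInd (u (h.circ z.1 z.2)) * h.arcDeriv u z := by
  obtain ⟨-, L, hL⟩ := unitClip_mem_lipSpace hu
  obtain ⟨-, M, hM⟩ := hu
  filter_upwards [h.ae_arcDeriv_eq_zero hL 0, h.ae_arcDeriv_eq_zero hL 1] with z h0 h1
  by_cases hz : u (h.circ z.1 z.2) ∈ Ioo (0 : ℝ) 1
  · rw [unitInd_of_mem hz, one_mul]
    refine EventuallyEq.deriv_eq ?_
    have hc : Continuous fun θ => u (h.circ z.1 θ) := hM.continuous.comp (h.continuous_circ z.1)
    filter_upwards [hc.continuousAt.eventually (isOpen_Ioo.mem_nhds hz)] with θ hθ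
    rw [unitClip, max_eq_left hθ.1.le, min_eq_left hθ.2.le]
  · rw [unitInd_of_notMem hz, zero_mul]
    rcases le_or_gt (u (h.circ z.1 z.2)) 0 with h2 | h2
    · exact h0 (by rw [unitClip, max_eq_right h2, min_eq_left zero_le_one])
    · have h3 : 1 ≤ u (h.circ z.1 z.2) := by
        by_contra hc
        exact hz ⟨h2, not_le.mp hc⟩
      exact h1 (by rw [unitClip, max_eq_left h2.le, min_eq_right h3])

/-- Clipping the Lipschitz approximants stays inside the core, and their derivatives converge to
`unitInd (x.1) * x.2`, whose norm is at most that of `x.2`. No weak compactness is involved. -/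
theorem exists_unitClip (h : IsDiskPacking m₀ R₀ P K) {x} (hx : x ∈ h.closedGraph) :
    ∃ y ∈ h.closedGraph, ((y.1 : K → ℝ) =ᵐ[packMeasure P K] fun t => unitClip (x.1 t)) ∧
      ‖y.2‖ ≤ ‖x.2‖ := by
  obtain ⟨y, u, hu, e1, e2, -, l1, l2, hae⟩ := h.exists_seq hx
  have hv := fun n => unitClip_mem_lipSpace (hu n)
  choose v hvm ev1 ev2 using fun n => h.exists_mem_lipGraph (hv n)
  have hfm : Measurable fun z : P × ℝ => x.1 (h.circ z.1 z.2) :=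
    (Lp.stronglyMeasurable x.1).measurable.comp h.measurable_circ
  have hum : ∀ n, Measurable fun z : P × ℝ => u n (h.circ z.1 z.2) := fun n =>
    (hu n).2.choose_spec.continuous.measurable.comp h.measurable_circ
  have hwm := (Lp.stronglyMeasurable x.2).measurable
  have hg : MemLp (fun z => unitInd (x.1 (h.circ z.1 z.2)) * x.2 z) 2 (arcMeasure P) := by
    refine (Lp.memLp x.2).mono
      (((measurable_unitInd.comp hfm).mul hwm).aestronglyMeasurable) (ae_of_all _ fun z => ?_)
    rw [norm_mul]
    exact mul_le_of_le_one_left (norm_nonneg _) (abs_unitInd_le _)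
  -- The error of the derivatives splits into `unitInd (u_n) * (u_n' - x.2)`, which is small by the
  -- convergence of derivatives, and this term, in which only the indicators differ.
  have hE : ∀ n, MemLp (fun z => (unitInd (u n (h.circ z.1 z.2)) -
      unitInd (x.1 (h.circ z.1 z.2))) * x.2 z) 2 (arcMeasure P) := fun n => by
    refine (Lp.memLp x.2).mono ((((measurable_unitInd.comp (hum n)).sub
      (measurable_unitInd.comp hfm)).mul hwm).aestronglyMeasurable) (ae_of_all _ fun z => ?_)
    rw [norm_mul]
    exact mul_le_of_le_one_left (norm_nonneg _) (abs_unitInd_sub_le _ _)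
  set g := hg.toLp _ with hgd
  have hglim : ∀ n, ‖(v n).2 - g‖ ≤ ‖(y n).2 - x.2‖ + ‖(hE n).toLp _‖ := fun n => by
    have h1 : ‖((v n).2 - g) - (hE n).toLp _‖ ≤ ‖(y n).2 - x.2‖ := by
      refine Lp.norm_le_norm_of_ae_le ?_
      filter_upwards [Lp.coeFn_sub ((v n).2 - g) ((hE n).toLp _), Lp.coeFn_sub (v n).2 g,
        Lp.coeFn_sub (y n).2 x.2, hg.coeFn_toLp, (hE n).coeFn_toLp, ev2 n, e2 n,
        h.ae_arcDeriv_unitClip (hu n)] with z a1 a2 a3 a4 a5 a6 a7 a8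
      rw [a1, Pi.sub_apply, a2, a3, Pi.sub_apply, Pi.sub_apply, hgd, a4, a5, a6, a7, a8]
      have : unitInd (u n (h.circ z.1 z.2)) * h.arcDeriv (u n) z -
          unitInd (x.1 (h.circ z.1 z.2)) * x.2 z -
          (unitInd (u n (h.circ z.1 z.2)) - unitInd (x.1 (h.circ z.1 z.2))) * x.2 z =
          unitInd (u n (h.circ z.1 z.2)) * (h.arcDeriv (u n) z - x.2 z) := by ring
      rw [this, norm_mul]
      exact mul_le_of_le_one_left (norm_nonneg _) (abs_unitInd_le _)
    have h2 := norm_le_norm_sub_add ((v n).2 - g) ((hE n).toLp _)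
    linarith
  have hEz : Tendsto (fun n => ‖(hE n).toLp _‖) atTop (𝓝 0) := by
    have h1 : Tendsto (fun n => ‖(hE n).toLp _‖ ^ 2) atTop (𝓝 0) := by
      have e : ∀ n, ‖(hE n).toLp _‖ ^ 2 = ∫ z, ((unitInd (u n (h.circ z.1 z.2)) -
          unitInd (x.1 (h.circ z.1 z.2))) * x.2 z) ^ 2 ∂(arcMeasure P) := fun n => by
        rw [← real_inner_self_eq_norm_sq, L2.inner_def]
        refine integral_congr_ae ?_
        filter_upwards [(hE n).coeFn_toLp] with z hz
        rw [hz, real_inner_self_eq_norm_sq, Real.norm_eq_abs, sq_abs]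
      simp only [e]
      rw [← integral_zero (P × ℝ) ℝ (μ := arcMeasure P)]
      refine tendsto_integral_of_dominated_convergence (fun z => x.2 z ^ 2)
        (fun n => ((hE n).1.pow 2)) (Lp.memLp x.2).integrable_sq
        (fun n => ae_of_all _ fun z => ?_) ?_
      · rw [norm_pow, norm_mul, mul_pow, Real.norm_eq_abs, Real.norm_eq_abs, sq_abs (x.2 z)]
        exact mul_le_of_le_one_left (sq_nonneg _)
          (pow_le_one₀ (abs_nonneg _) (abs_unitInd_sub_le _ _))
      -- `unitInd` is discontinuous exactly at 0 and 1, and `x.2` vanishes a.e. where `x.1` takes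
      -- these values.
      · filter_upwards [h.ae_arc hae, h.ae_deriv_eq_zero hx 0, h.ae_deriv_eq_zero hx 1]
          with z hz h0 h1
        by_cases h3 : x.2 z = 0
        · simp [h3]
        · refine tendsto_const_nhds.congr' ?_
          filter_upwards [tendsto_unitInd hz (fun h => h3 (h0 h)) (fun h => h3 (h1 h))] with n hn
          rw [hn, sub_self, zero_mul, zero_pow two_ne_zero]
    have := h1.sqrt
    simpa [Real.sqrt_sq] using this
  refine ⟨(lipschitz_unitClip.compLp unitClip_zero x.1, g), ?_,
    lipschitz_unitClip.coeFn_compLp unitClip_zero x.1,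
    ?_⟩
  · refine mem_closure_of_tendsto (f := v) (b := atTop) ?_ (Eventually.of_forall hvm)
    refine Tendsto.prodMk_nhds (mx := fun n => (v n).1) (my := fun n => (v n).2) ?_ ?_
    · have h1 := ((lipschitz_unitClip.continuous_compLp unitClip_zero
        (p := 2) (μ := packMeasure P K)).tendsto x.1).comp l1
      refine h1.congr fun n => ?_
      refine Lp.ext ?_
      filter_upwards [lipschitz_unitClip.coeFn_compLp unitClip_zero (y n).1, ev1 n, e1 n]
        with t a1 a2 a3
      rw [Function.comp_apply, a1, a2, Function.comp_apply, a3]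
    · rw [tendsto_iff_norm_sub_tendsto_zero]
      have h1 := (tendsto_iff_norm_sub_tendsto_zero.mp l2).add hEz
      rw [add_zero] at h1
      exact squeeze_zero (fun _ => norm_nonneg _) hglim h1
  · refine Lp.norm_le_norm_of_ae_le ?_
    filter_upwards [hg.coeFn_toLp] with z hz
    change ‖g z‖ ≤ _
    rw [hgd, hz, norm_mul]
    exact mul_le_of_le_one_left (norm_nonneg _) (abs_unitInd_le _)

end IsDiskPacking

end RoundCarpet

/-! ## The Dirichlet form of a packing -/

namespace RoundCarpet

open DirichletForm

/-- The soft threshold function. -/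
noncomputable def softThreshold (ε t : ℝ) : ℝ := t - max (min t ε) (-ε)

/-- Compactly supported continuous functions are uniform limits of compactly supported Lipschitz
functions. -/
theorem exists_mem_lipSpace_near {K : Set ℂ} {w : K → ℝ} (hw : Continuous w)
    (hc : HasCompactSupport w) {ε : ℝ} (hε : 0 < ε) :
    ∃ u ∈ lipSpace K, ∀ x, |w x - u x| < ε := by
  obtain ⟨M, hM⟩ := hw.bounded_above_of_compact_support hc
  have hM' : ∀ x, |w x| ≤ |M| := fun x => (hM x).trans (le_abs_self M)
  obtain ⟨δ, hδ, hunif⟩ := Metric.uniformContinuous_iff.mp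
    (hw.uniformContinuous_of_tendsto_cocompact hc.is_zero_at_infty) (ε / 3) (by positivity)
  -- With `L δ = 2 |M|`, points at distance at least `δ` cannot bring the infimum below `w x`;
  -- nearer points lower it by at most `ε / 3`.
  set L : ℝ≥0 := ⟨2 * |M| / δ, by positivity⟩ with hL
  have hLδ : (L : ℝ) * δ = 2 * |M| := by
    change 2 * |M| / δ * δ = _
    field_simp
  -- The infimal convolution is Lipschitz and uniformly close to `w`, but its support may be too
  -- large. Soft thresholding at `ε / 3` kills it wherever `w` vanishes.
  set v : K → ℝ := fun x => ⨅ y, w y + L * dist x y with hv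
  have hbdd : ∀ x, BddBelow (range fun y => w y + L * dist x y) := fun x =>
    ⟨-|M|, by
      rintro _ ⟨y, rfl⟩
      have h1 := (abs_le.mp (hM' y)).1
      have h2 : 0 ≤ (L : ℝ) * dist x y := mul_nonneg L.2 dist_nonneg
      change -|M| ≤ w y + L * dist x y
      linarith⟩
  have hvw : ∀ x, v x ≤ w x := fun x => by
    have := ciInf_le (hbdd x) x
    simpa using this
  have hwv : ∀ x, w x - ε / 3 ≤ v x := fun x => by
    have : Nonempty K := ⟨x⟩
    refine le_ciInf fun y => ?_
    have h1 := (abs_le.mp (hM' y)).1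
    have h2 := (abs_le.mp (hM' x)).2
    rcases lt_or_ge (dist x y) δ with h | h
    · have h3 := hunif h
      rw [Real.dist_eq] at h3
      have h4 := (abs_lt.mp h3).2
      have h5 : 0 ≤ (L : ℝ) * dist x y := mul_nonneg L.2 dist_nonneg
      linarith
    · have h3 := mul_le_mul_of_nonneg_left h L.2
      change (L : ℝ) * δ ≤ L * dist x y at h3
      linarith
  have hvL : LipschitzWith L v := LipschitzWith.of_le_add_mul L fun x x' => by
    have : Nonempty K := ⟨x⟩
    rw [← sub_le_iff_le_add]
    refine le_ciInf fun y => ?_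
    have h1 := ciInf_le (hbdd x) y
    change v x ≤ w y + L * dist x y at h1
    have h2 := mul_le_mul_of_nonneg_left (dist_triangle x x' y) L.2
    change (L : ℝ) * dist x y ≤ L * (dist x x' + dist x' y) at h2
    linarith
  refine ⟨fun x => softThreshold (ε / 3) (v x), ⟨?_, L + L, ?_⟩, fun x => ?_⟩
  · refine hc.mono fun x hx => ?_
    contrapose! hx
    have h0 : w x = 0 := by simpa using hx
    have h1 := hvw x
    have h2 := hwv x
    rw [Function.notMem_support, softThreshold, min_eq_left (by linarith),
      max_eq_left (by linarith), sub_self]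
  · exact hvL.sub ((hvL.min_const (ε / 3)).max_const (-(ε / 3)))
  · have h1 := hvw x
    have h2 := hwv x
    have h3 : |max (min (v x) (ε / 3)) (-(ε / 3))| ≤ ε / 3 :=
      abs_le.mpr ⟨le_max_right _ _, max_le (min_le_right _ _) (by linarith)⟩
    rw [abs_le] at h3
    change |w x - (v x - max (min (v x) (ε / 3)) (-(ε / 3)))| < ε
    rw [abs_lt]
    constructor <;> linarith [h3.1, h3.2]

theorem measure_ne_zero_notMem_lpSupport {X : Type*} [MeasurableSpace X] [TopologicalSpace X]
    [SecondCountableTopology X] {μ : Measure X} (f : Lp ℝ 2 μ) :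
    ∀ᵐ x ∂μ, x ∉ lpSupport f → f x = 0 := by
  rw [ae_iff]
  refine measure_null_of_locally_null _ fun x hx => ?_
  simp only [mem_ofPred_eq, Classical.not_imp] at hx
  obtain ⟨U, hU, h0⟩ : ∃ U ∈ 𝓝 x, μ {y | y ∈ U ∧ f y ≠ 0} = 0 := by
    by_contra hc
    push Not at hc
    exact hx.1 hc
  refine ⟨_, ?_, h0⟩
  filter_upwards [self_mem_nhdsWithin, mem_nhdsWithin_of_mem_nhds hU] with y hy hyU
  simp only [Classical.not_imp] at hy
  exact ⟨hyU, hy.2⟩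

variable {m₀ : ℂ} {R₀ : ℝ} {P : Set (ℂ × ℝ)} {K : Set ℂ}

namespace IsDiskPacking

theorem locallyCompactSpace (h : IsDiskPacking m₀ R₀ P K) : LocallyCompactSpace K :=
  h.isLocallyClosed.locallyCompactSpace

/-- The closed tangential derivative as an operator. -/
noncomputable def deriv (h : IsDiskPacking m₀ R₀ P K) :
    Lp ℝ 2 (packMeasure P K) →ₗ.[ℝ] Lp ℝ 2 (arcMeasure P) :=
  h.closedGraph.toLinearPMap

theorem mk_deriv_mem (h : IsDiskPacking m₀ R₀ P K) (f : h.deriv.domain) :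
    ((f : Lp ℝ 2 (packMeasure P K)), h.deriv f) ∈ h.closedGraph :=
  Submodule.mem_graph_toLinearPMap (fun _ hx h0 => h.snd_eq_zero hx h0) f

theorem exists_eq_deriv (h : IsDiskPacking m₀ R₀ P K) {x} (hx : x ∈ h.closedGraph) :
    ∃ f : h.deriv.domain, (f : Lp ℝ 2 (packMeasure P K)) = x.1 ∧ h.deriv f = x.2 := by
  refine ⟨⟨x.1, ⟨x, hx, rfl⟩⟩, rfl, ?_⟩
  have h1 := sub_mem (h.mk_deriv_mem ⟨x.1, ⟨x, hx, rfl⟩⟩) hx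
  have h2 := h.snd_eq_zero h1 (sub_self _)
  exact sub_eq_zero.mp h2

theorem dense_domain (h : IsDiskPacking m₀ R₀ P K) :
    Dense (h.deriv.domain : Set (Lp ℝ 2 (packMeasure P K))) := by
  have := h.isFiniteMeasure
  have := h.locallyCompactSpace
  intro f
  rw [Metric.mem_closure_iff]
  intro ε hε
  obtain ⟨g, hgc, hg1, hg2, hg3⟩ := (Lp.memLp f).exists_hasCompactSupport_eLpNorm_sub_le
    ENNReal.ofNat_ne_top (ε := ENNReal.ofReal (ε / 2)) (by simpa using hε)
  set m := ENNReal.toReal (packMeasure P K univ ^ (2⁻¹ : ℝ)) with hm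
  have hm0 : 0 ≤ m := ENNReal.toReal_nonneg
  obtain ⟨u, hu, hgu⟩ := exists_mem_lipSpace_near hg2 hgc (ε := ε / (4 * (m + 1))) (by positivity)
  have hum := h.memLp_of_mem hu
  obtain ⟨x, hx, e1, -⟩ := h.exists_mem_lipGraph hu
  obtain ⟨f', e2, -⟩ := h.exists_eq_deriv (subset_closure hx)
  refine ⟨f', f'.2, ?_⟩
  have e3 : (f' : Lp ℝ 2 (packMeasure P K)) = hum.toLp u := Lp.ext (by
    rw [e2]; exact e1.trans hum.coeFn_toLp.symm)
  have d1 : dist f (hg3.toLp g) ≤ ε / 2 := by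
    rw [Lp.dist_def]
    refine ENNReal.toReal_le_of_le_ofReal (by positivity) ?_
    refine le_of_eq_of_le (eLpNorm_congr_ae ?_) hg1
    exact EventuallyEq.rfl.sub hg3.coeFn_toLp
  have d2 : dist (hg3.toLp g) (hum.toLp u) ≤ m * (ε / (4 * (m + 1))) := by
    rw [Lp.dist_def]
    refine ENNReal.toReal_le_of_le_ofReal (by positivity) ?_
    calc _ = eLpNorm (g - u) 2 (packMeasure P K) :=
          eLpNorm_congr_ae (hg3.coeFn_toLp.sub hum.coeFn_toLp)
      _ ≤ packMeasure P K univ ^ (2 : ℝ≥0∞).toReal⁻¹ * ENNReal.ofReal (ε / (4 * (m + 1))) :=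
          eLpNorm_le_of_ae_bound (ae_of_all _ fun x => (hgu x).le)
      _ = _ := by
          rw [ENNReal.toReal_ofNat, ENNReal.ofReal_mul hm0, hm, ENNReal.ofReal_toReal]
          exact ENNReal.rpow_ne_top_of_nonneg (by norm_num) (measure_ne_top _ _)
  have d3 : m * (ε / (4 * (m + 1))) < ε / 2 := by
    rw [← mul_div_assoc, div_lt_div_iff₀ (by positivity) (by norm_num)]
    nlinarith [mul_nonneg hm0 hε.le]
  rw [e3]
  calc _ ≤ dist f (hg3.toLp g) + dist (hg3.toLp g) (hum.toLp u) := dist_triangle _ _ _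
    _ < ε := by linarith

/-- The Dirichlet form of a packing. -/
noncomputable def dirichletForm (h : IsDiskPacking m₀ R₀ P K) : SymmForm (packMeasure P K) where
  dom := h.deriv.domain
  form := (innerₗ (Lp ℝ 2 (arcMeasure P))).compl₁₂ h.deriv.toFun h.deriv.toFun
  dense := h.dense_domain
  symm := fun f g => real_inner_comm (h.deriv g) (h.deriv f)
  nonneg := fun f => real_inner_self_nonneg (x := h.deriv f)

/-- The gradient on the domain of the Dirichlet form. -/
noncomputable def grad (h : IsDiskPacking m₀ R₀ P K) :
    h.dirichletForm.dom →ₗ[ℝ] Lp ℝ 2 (arcMeasure P) := h.deriv.toFun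

theorem mk_grad_mem (h : IsDiskPacking m₀ R₀ P K) (f : h.dirichletForm.dom) :
    ((f : Lp ℝ 2 (packMeasure P K)), h.grad f) ∈ h.closedGraph := h.mk_deriv_mem f

theorem exists_eq_grad (h : IsDiskPacking m₀ R₀ P K) {x} (hx : x ∈ h.closedGraph) :
    ∃ f : h.dirichletForm.dom, (f : Lp ℝ 2 (packMeasure P K)) = x.1 ∧ h.grad f = x.2 :=
  h.exists_eq_deriv hx

theorem exists_dom_of_mem (h : IsDiskPacking m₀ R₀ P K) {u : K → ℝ} (hu : u ∈ lipSpace K) :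
    ∃ f : h.dirichletForm.dom, ((f : Lp ℝ 2 (packMeasure P K)) : K → ℝ) =ᵐ[packMeasure P K] u := by
  obtain ⟨x, hx, e1, -⟩ := h.exists_mem_lipGraph hu
  obtain ⟨f, e2, -⟩ := h.exists_eq_grad (subset_closure hx)
  exact ⟨f, by rw [e2]; exact e1⟩

theorem grad_ae_eq (h : IsDiskPacking m₀ R₀ P K) {u : K → ℝ} (hu : u ∈ lipSpace K)
    {f : h.dirichletForm.dom}
    (hf : ((f : Lp ℝ 2 (packMeasure P K)) : K → ℝ) =ᵐ[packMeasure P K] u) :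
    (h.grad f : P × ℝ → ℝ) =ᵐ[arcMeasure P] h.arcDeriv u := by
  obtain ⟨x, hx, e1, e2⟩ := h.exists_mem_lipGraph hu
  obtain ⟨f', e3, e4⟩ := h.exists_eq_grad (subset_closure hx)
  have : f = f' := Subtype.ext (by rw [e3]; exact Lp.ext (hf.trans e1.symm))
  rw [this, e4]
  exact e2

theorem form_apply (h : IsDiskPacking m₀ R₀ P K) (f g : h.dirichletForm.dom) :
    h.dirichletForm.form f g = inner ℝ (h.grad f) (h.grad g) := rfl

theorem form_self (h : IsDiskPacking m₀ R₀ P K) (f : h.dirichletForm.dom) :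
    h.dirichletForm.form f f = ‖h.grad f‖ ^ 2 :=
  real_inner_self_eq_norm_sq (h.grad f)

theorem normSq_sub (h : IsDiskPacking m₀ R₀ P K) (f g : h.dirichletForm.dom) :
    h.dirichletForm.normSq (f - g) = ‖h.grad f - h.grad g‖ ^ 2 +
      ‖(f : Lp ℝ 2 (packMeasure P K)) - g‖ ^ 2 := by
  rw [SymmForm.normSq, form_self, ← map_sub]
  rfl

theorem form_eq_energy (h : IsDiskPacking m₀ R₀ P K) {u v : K → ℝ} (hu : u ∈ lipSpace K)
    (hv : v ∈ lipSpace K) {f g : h.dirichletForm.dom}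
    (hf : ((f : Lp ℝ 2 (packMeasure P K)) : K → ℝ) =ᵐ[packMeasure P K] u)
    (hg : ((g : Lp ℝ 2 (packMeasure P K)) : K → ℝ) =ᵐ[packMeasure P K] v) :
    h.dirichletForm.form f g = h.energy u v := by
  rw [form_apply, L2.inner_def, energy]
  refine integral_congr_ae ?_
  filter_upwards [h.grad_ae_eq hu hf, h.grad_ae_eq hv hg] with z e1 e2
  rw [e1, e2, real_inner_eq_re_inner, RCLike.inner_apply, conj_trivial, mul_comm]
  rfl

theorem isClosed_closedGraph (h : IsDiskPacking m₀ R₀ P K) :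
    IsClosed (h.closedGraph : Set (Lp ℝ 2 (packMeasure P K) × Lp ℝ 2 (arcMeasure P))) :=
  Submodule.isClosed_topologicalClosure _

theorem exists_limit (h : IsDiskPacking m₀ R₀ P K)
    {x : ℕ → Lp ℝ 2 (packMeasure P K) × Lp ℝ 2 (arcMeasure P)} (hx : ∀ n, x n ∈ h.closedGraph)
    (hc : ∀ ε : ℝ, 0 < ε → ∃ N : ℕ, ∀ m n : ℕ, N ≤ m → N ≤ n →
      ‖(x m).2 - (x n).2‖ ^ 2 + ‖(x m).1 - (x n).1‖ ^ 2 < ε) :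
    ∃ y ∈ h.closedGraph, Tendsto x atTop (𝓝 y) := by
  have hcau : CauchySeq x := by
    rw [Metric.cauchySeq_iff]
    intro ε hε
    obtain ⟨N, hN⟩ := hc (ε ^ 2) (by positivity)
    refine ⟨N, fun m hm n hn => ?_⟩
    have h1 := hN m n hm hn
    rw [Prod.dist_eq, dist_eq_norm, dist_eq_norm]
    exact max_lt (lt_of_pow_lt_pow_left₀ 2 hε.le (by nlinarith [sq_nonneg ‖(x m).2 - (x n).2‖]))
      (lt_of_pow_lt_pow_left₀ 2 hε.le (by nlinarith [sq_nonneg ‖(x m).1 - (x n).1‖]))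
  obtain ⟨y, hy⟩ := cauchySeq_tendsto_of_complete hcau
  exact ⟨y, h.isClosed_closedGraph.mem_of_tendsto hy (Eventually.of_forall hx), hy⟩

theorem isClosedForm (h : IsDiskPacking m₀ R₀ P K) : h.dirichletForm.IsClosedForm := by
  intro f hf
  obtain ⟨y, hy, hlim⟩ := h.exists_limit (x := fun n => ((f n : Lp ℝ 2 (packMeasure P K)),
    h.grad (f n))) (fun n => h.mk_grad_mem (f n)) (fun ε hε => by
      obtain ⟨N, hN⟩ := hf ε hε
      exact ⟨N, fun m n hm hn => by rw [← normSq_sub]; exact hN m n hm hn⟩)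
  obtain ⟨g, e1, e2⟩ := h.exists_eq_grad hy
  refine ⟨g, ?_⟩
  simp only [normSq_sub]
  have h1 := tendsto_iff_norm_sub_tendsto_zero.mp ((continuous_fst.tendsto y).comp hlim)
  have h2 := tendsto_iff_norm_sub_tendsto_zero.mp ((continuous_snd.tendsto y).comp hlim)
  have h3 := (h2.pow 2).add (h1.pow 2)
  rw [e1, e2]
  simpa using h3

theorem isMarkovian (h : IsDiskPacking m₀ R₀ P K) : h.dirichletForm.IsMarkovian := by
  intro f g hg
  obtain ⟨y, hy, e1, e2⟩ := h.exists_unitClip (h.mk_grad_mem f)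
  obtain ⟨g', e3, e4⟩ := h.exists_eq_grad hy
  have : g = g' := by rw [e3]; exact Lp.ext (hg.trans e1.symm)
  subst this
  refine ⟨g'.2, ?_⟩
  change h.dirichletForm.form g' g' ≤ _
  rw [form_self, form_self, e4]
  exact pow_le_pow_left₀ (norm_nonneg _) e2 2

/-- The product of gradients vanishes pointwise a.e.: off the support of `f` the function `f` is 0,
and on it `g` is constant, so `ae_deriv_eq_zero` applies to one of the two factors. -/
theorem isStronglyLocal (h : IsDiskPacking m₀ R₀ P K) : h.dirichletForm.IsStronglyLocal := by
  rintro f g - - ⟨U, c, hU, hfU, hg⟩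
  rw [form_apply, L2.inner_def]
  refine integral_eq_zero_of_ae ?_
  filter_upwards [h.ae_arc (measure_ne_zero_notMem_lpSupport (f : Lp ℝ 2 (packMeasure P K))),
    h.ae_arc hg, h.ae_deriv_eq_zero (h.mk_grad_mem f) 0, h.ae_deriv_eq_zero (h.mk_grad_mem g) c]
    with z h1 h2 h3 h4
  by_cases hz : h.circ z.1 z.2 ∈ lpSupport (f : Lp ℝ 2 (packMeasure P K))
  · have : (h.grad g) z = 0 := h4 (h2 (hfU hz))
    rw [this, inner_zero_right]; rfl
  · have : (h.grad f) z = 0 := h3 (h1 hz)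
    rw [this, inner_zero_left]; rfl

theorem isRegular (h : IsDiskPacking m₀ R₀ P K) : h.dirichletForm.IsRegular := by
  constructor
  · intro f ε hε
    obtain ⟨y, u, hu, e1, -, hy, l1, l2, -⟩ := h.exists_seq (h.mk_grad_mem f)
    have h1 := tendsto_iff_norm_sub_tendsto_zero.mp l1
    have h2 := tendsto_iff_norm_sub_tendsto_zero.mp l2
    have h3 := (h2.pow 2).add (h1.pow 2)
    rw [zero_pow two_ne_zero, add_zero] at h3
    obtain ⟨n, hn⟩ := (h3.eventually_lt_const hε).exists
    obtain ⟨g, e3, e4⟩ := h.exists_eq_grad (subset_closure (hy n))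
    refine ⟨g, u n, (hu n).2.choose_spec.continuous, (hu n).1, by rw [e3]; exact e1 n, ?_⟩
    rw [normSq_sub, e3, e4, norm_sub_rev, norm_sub_rev (f : Lp ℝ 2 (packMeasure P K))]
    exact hn
  · intro w hw hc ε hε
    obtain ⟨u, hu, hwu⟩ := exists_mem_lipSpace_near hw hc hε
    obtain ⟨f, hf⟩ := h.exists_dom_of_mem hu
    exact ⟨f, u, hu.2.choose_spec.continuous, hu.1, hf, hwu⟩

theorem extends_energy (h : IsDiskPacking m₀ R₀ P K) {E : (K → ℝ) → (K → ℝ) → ℝ}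
    (hE : ∀ u ∈ lipSpace K, ∀ v ∈ lipSpace K, E u v = h.energy u v) :
    h.dirichletForm.Extends (lipSpace K) E :=
  ⟨fun _ hu => h.exists_dom_of_mem hu, fun u hu v hv f g hf hg => by
    rw [hE u hu v hv]; exact h.form_eq_energy hu hv hf hg⟩

/-- Both forms agree on Lipschitz functions, so an approximating sequence for `f` is also Cauchy for
the norm of `𝓔`. Its limit there is the same `L²` class and has the same energy. -/
theorem mem_dom_of_extends (h : IsDiskPacking m₀ R₀ P K) {E : (K → ℝ) → (K → ℝ) → ℝ}
    (hE : ∀ u ∈ lipSpace K, ∀ v ∈ lipSpace K, E u v = h.energy u v)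
    {𝓔 : SymmForm (packMeasure P K)} (hc : 𝓔.IsClosedForm) (he : 𝓔.Extends (lipSpace K) E)
    (f : h.dirichletForm.dom) : ∃ g : 𝓔.dom, (g : Lp ℝ 2 (packMeasure P K)) = f ∧
      𝓔.form g g = h.dirichletForm.form f f := by
  obtain ⟨y, u, hu, e1, -, hy, l1, l2, -⟩ := h.exists_seq (h.mk_grad_mem f)
  choose F hF1 hF2 using fun n => h.exists_eq_grad (subset_closure (hy n))
  have hFu : ∀ n, ((F n : Lp ℝ 2 (packMeasure P K)) : K → ℝ) =ᵐ[packMeasure P K] u n := fun n => by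
    rw [hF1]; exact e1 n
  choose G hG using fun n => he.1 (u n) (hu n)
  have hGF : ∀ n, (G n : Lp ℝ 2 (packMeasure P K)) = F n := fun n =>
    Lp.ext ((hG n).trans (hFu n).symm)
  have hform : ∀ m n, 𝓔.form (G m) (G n) = h.dirichletForm.form (F m) (F n) := fun m n => by
    rw [he.2 _ (hu m) _ (hu n) _ _ (hG m) (hG n), hE _ (hu m) _ (hu n),
      h.form_eq_energy (hu m) (hu n) (hFu m) (hFu n)]
  have hN : ∀ m n, 𝓔.normSq (G m - G n) = h.dirichletForm.normSq (F m - F n) := fun m n => by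
    simp only [SymmForm.normSq, map_sub, LinearMap.sub_apply, hform, Submodule.coe_sub, hGF]
  obtain ⟨g, hg⟩ := hc G (fun ε hε => by
    have hcy : CauchySeq y := (Tendsto.prodMk_nhds l1 l2).cauchySeq
    obtain ⟨N, hN'⟩ := Metric.cauchySeq_iff.mp hcy (√(ε / 2)) (by positivity)
    refine ⟨N, fun m n hm hn => ?_⟩
    have h1 := hN' m hm n hn
    rw [Prod.dist_eq, max_lt_iff, dist_eq_norm, dist_eq_norm, Real.lt_sqrt (norm_nonneg _),
      Real.lt_sqrt (norm_nonneg _)] at h1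
    rw [hN, normSq_sub, hF1, hF1, hF2, hF2]
    linarith [h1.1, h1.2])
  have hg1 : Tendsto (fun n => ‖((G n : Lp ℝ 2 (packMeasure P K)) - g)‖ ^ 2) atTop (𝓝 0) :=
    squeeze_zero (fun _ => sq_nonneg _)
      (fun n => le_add_of_nonneg_left (𝓔.nonneg (G n - g))) hg
  have hg2 : Tendsto (fun n => 𝓔.form (G n - g) (G n - g)) atTop (𝓝 0) :=
    squeeze_zero (fun n => 𝓔.nonneg (G n - g)) (fun n => le_add_of_nonneg_right (sq_nonneg _)) hg
  have hgf : (g : Lp ℝ 2 (packMeasure P K)) = f := by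
    have h1 : Tendsto (fun n => (G n : Lp ℝ 2 (packMeasure P K))) atTop (𝓝 g) := by
      rw [tendsto_iff_norm_sub_tendsto_zero]
      simpa [Real.sqrt_sq] using hg1.sqrt
    refine tendsto_nhds_unique h1 (l1.congr fun n => ?_)
    rw [hGF, hF1]
  have hff : Tendsto (fun n => 𝓔.form (G n) (G n)) atTop (𝓝 (h.dirichletForm.form f f)) := by
    rw [form_self]
    refine (l2.norm.pow 2).congr fun n => ?_
    rw [hform, form_self, hF2]
  refine ⟨g, hgf, ?_⟩
  -- Cauchy–Schwarz for the form `𝓔` removes the mixed term, which identifies `𝓔(g, g)` as the limit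
  -- of the energies of the approximants.
  have hcs : Tendsto (fun n => 𝓔.form (G n) (G n - g)) atTop (𝓝 0) := by
    have h1 : Tendsto (fun n => 𝓔.form (G n) (G n - g) ^ 2) atTop (𝓝 0) := by
      have h2 := hff.mul hg2
      rw [mul_zero] at h2
      refine squeeze_zero (fun _ => sq_nonneg _) (fun n => ?_) h2
      have h3 := LinearMap.BilinForm.apply_mul_apply_le_of_forall_zero_le 𝓔.form 𝓔.nonneg
        (G n) (G n - g)
      rwa [𝓔.symm (G n - g), ← sq] at h3
    have h2 := h1.sqrt
    simp only [Real.sqrt_sq_eq_abs, Real.sqrt_zero] at h2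
    exact (tendsto_zero_iff_abs_tendsto_zero _).mpr h2
  have h1 := (hff.sub (hcs.const_mul 2)).add hg2
  rw [mul_zero, sub_zero, add_zero] at h1
  refine tendsto_nhds_unique (tendsto_const_nhds.congr fun n => ?_) h1
  simp only [map_sub, LinearMap.sub_apply, 𝓔.symm g (G n)]
  ring

theorem isSmallestClosedExtension (h : IsDiskPacking m₀ R₀ P K) {E : (K → ℝ) → (K → ℝ) → ℝ}
    (hE : ∀ u ∈ lipSpace K, ∀ v ∈ lipSpace K, E u v = h.energy u v) :
    h.dirichletForm.IsSmallestClosedExtension (lipSpace K) E := by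
  refine ⟨h.isClosedForm, h.extends_energy hE, fun 𝓔 hc he => ?_⟩
  have key := h.mem_dom_of_extends hE hc he
  have hle : h.dirichletForm.dom ≤ 𝓔.dom := fun f hf => by
    obtain ⟨g, e, -⟩ := key ⟨f, hf⟩
    change (g : Lp ℝ 2 (packMeasure P K)) = f at e
    rw [← e]; exact g.2
  have hself : ∀ f, 𝓔.form (Submodule.inclusion hle f) (Submodule.inclusion hle f) =
      h.dirichletForm.form f f := fun f => by
    obtain ⟨g, e, e'⟩ := key f
    have : Submodule.inclusion hle f = g := Subtype.ext e.symm
    rw [this, e']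
  -- Polarisation: agreement on the diagonal gives agreement of the bilinear forms.
  refine ⟨hle, fun f g => ?_⟩
  have h1 := hself (f + g)
  simp only [map_add, LinearMap.add_apply, hself, 𝓔.symm (Submodule.inclusion hle g),
    h.dirichletForm.symm g] at h1
  linarith

/-- A form-Cauchy sequence has converging gradients, and the pair formed by 0 and their limit lies
in the closed graph; `snd_eq_zero` makes the limit vanish. -/
theorem closable (h : IsDiskPacking m₀ R₀ P K) {E : (K → ℝ) → (K → ℝ) → ℝ}
    (hE : ∀ u ∈ lipSpace K, ∀ v ∈ lipSpace K, E u v = h.energy u v) :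
    Closable (packMeasure P K) (lipSpace K) E := by
  refine ⟨fun u hu => h.memLp_of_mem hu, fun u hu hc h0 => ?_⟩
  choose F hF using fun n => h.exists_dom_of_mem (hu n)
  have hsub : ∀ m n, E (u m - u n) (u m - u n) = ‖h.grad (F m) - h.grad (F n)‖ ^ 2 :=
    fun m n => by
      have hmem := sub_mem (hu m) (hu n)
      have e : (((F m - F n : h.dirichletForm.dom) : Lp ℝ 2 (packMeasure P K)) : K → ℝ)
          =ᵐ[packMeasure P K] u m - u n :=
        (Lp.coeFn_sub _ _).trans ((hF m).sub (hF n))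
      rw [hE _ hmem _ hmem, ← h.form_eq_energy hmem hmem e e, form_self, ← map_sub]
  have hself : ∀ n, E (u n) (u n) = ‖h.grad (F n)‖ ^ 2 := fun n => by
    rw [hE _ (hu n) _ (hu n), ← h.form_eq_energy (hu n) (hu n) (hF n) (hF n), form_self]
  have hFz : Tendsto (fun n => (F n : Lp ℝ 2 (packMeasure P K))) atTop (𝓝 0) := by
    rw [tendsto_zero_iff_norm_tendsto_zero]
    have h1 := (ENNReal.tendsto_toReal ENNReal.zero_ne_top).comp h0
    refine h1.congr fun n => ?_
    rw [Lp.norm_def, Function.comp_apply, eLpNorm_congr_ae (hF n)]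
  have hcau : CauchySeq fun n => h.grad (F n) := by
    rw [Metric.cauchySeq_iff]
    intro ε hε
    obtain ⟨N, hN⟩ := hc (ε ^ 2) (by positivity)
    refine ⟨N, fun m hm n hn => ?_⟩
    have h1 := hN m n hm hn
    rw [hsub] at h1
    rw [dist_eq_norm]
    exact lt_of_pow_lt_pow_left₀ 2 hε.le h1
  obtain ⟨w, hw⟩ := cauchySeq_tendsto_of_complete hcau
  have hmem : ((0 : Lp ℝ 2 (packMeasure P K)), w) ∈ h.closedGraph :=
    h.isClosed_closedGraph.mem_of_tendsto (hFz.prodMk_nhds hw)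
      (Eventually.of_forall fun n => h.mk_grad_mem (F n))
  have hw0 : w = 0 := h.snd_eq_zero hmem rfl
  simp only [hself]
  have := hw.norm.pow 2
  rwa [hw0, norm_zero, zero_pow two_ne_zero] at this

end IsDiskPacking

end RoundCarpet

/-! ## Restrictions of Lipschitz functions to lines -/

namespace RoundCarpet

/-- If disjoint intervals fill `(a, b)` up to a null set, then the increment of a Lipschitz
function over `(a, b)` is at most the sum of its increments over these intervals. -/
theorem ofReal_sub_le_tsum {ι : Type*} [Countable ι] {v : ℝ → ℝ} {L : ℝ≥0} (hv : LipschitzWith L v)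
    {a b : ℝ} (hab : a ≤ b) {l r J : ι → ℝ} (hlr : ∀ i, l i ≤ r i)
    (hsub : ∀ i, Ioo (l i) (r i) ⊆ Ioo a b)
    (hdisj : Pairwise (Function.onFun Disjoint fun i => Ioo (l i) (r i)))
    (hnull : volume (Ioo a b \ ⋃ i, Ioo (l i) (r i)) = 0) (hJ0 : ∀ i, 0 ≤ J i)
    (hJ : ∀ i, v (r i) - v (l i) ≤ J i) :
    ENNReal.ofReal (v b - v a) ≤ ∑' i, ENNReal.ofReal (J i) := by
  by_cases htop : ∑' i, ENNReal.ofReal (J i) = ∞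
  · rw [htop]; exact le_top
  have hsum : Summable J := by
    have := ENNReal.summable_toReal htop
    simpa only [ENNReal.toReal_ofReal (hJ0 _)] using this
  have hftc : ∀ {x y : ℝ}, x ≤ y → ∫ t in Ioo x y, deriv v t = v y - v x := fun {x y} hxy => by
    rw [← integral_Ioc_eq_integral_Ioo, ← intervalIntegral.integral_of_le hxy]
    exact (hv.lipschitzOnWith.absolutelyContinuousOnInterval).integral_deriv_eq_sub
  have hint : IntegrableOn (deriv v) (Ioo a b) :=
    Integrable.of_bound (C := L) (measurable_deriv v).aestronglyMeasurable
      (ae_of_all _ fun t => norm_deriv_le_of_lipschitz hv)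
  have hU : (⋃ i, Ioo (l i) (r i)) ⊆ Ioo a b := iUnion_subset hsub
  have h1 := hasSum_integral_iUnion (fun i => measurableSet_Ioo) hdisj (hint.mono_set hU)
  have h2 : (⋃ i, Ioo (l i) (r i)) =ᵐ[volume] Ioo a b :=
    hU.eventuallyLE.antisymm (ae_le_set.mpr hnull)
  rw [setIntegral_congr_set h2, hftc hab] at h1
  simp only [hftc (hlr _)] at h1
  rw [← ENNReal.ofReal_tsum_of_nonneg hJ0 hsum]
  exact ENNReal.ofReal_le_ofReal (hasSum_le hJ h1 hsum.hasSum)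

theorem mk_mem_ball_iff {c : ℂ} {R x t : ℝ} (hR : 0 < R) :
    (⟨x, t⟩ : ℂ) ∈ Metric.ball c R ↔ (x - c.re) ^ 2 + (t - c.im) ^ 2 < R ^ 2 := by
  rw [mem_ball_iff_norm, ← pow_lt_pow_iff_left₀ (norm_nonneg _) hR.le two_ne_zero,
    ← Complex.normSq_eq_norm_sq, Complex.normSq_apply]
  simp [sq]

/-- Half the length of the chord over the abscissa `x`. -/
noncomputable def halfChord (c : ℂ) (R x : ℝ) : ℝ := √(R ^ 2 - (x - c.re) ^ 2)

theorem mk_mem_ball_iff_Ioo {c : ℂ} {R x t : ℝ} (hR : 0 < R) :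
    (⟨x, t⟩ : ℂ) ∈ Metric.ball c R ↔
      t ∈ Ioo (c.im - halfChord c R x) (c.im + halfChord c R x) := by
  have e : t ∈ Ioo (c.im - halfChord c R x) (c.im + halfChord c R x) ↔
      |t - c.im| < halfChord c R x := by
    rw [abs_lt]
    constructor <;> rintro ⟨h1, h2⟩ <;> constructor <;> linarith
  rw [mk_mem_ball_iff hR, e, halfChord, Real.lt_sqrt (abs_nonneg _), sq_abs]
  constructor <;> intro h <;> linarith

theorem halfChord_pos {c : ℂ} {R x : ℝ} (hx : |x - c.re| < R) : 0 < halfChord c R x := by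
  have h1 := abs_nonneg (x - c.re)
  refine Real.sqrt_pos.mpr ?_
  rw [← sq_abs (x - c.re)]
  nlinarith

theorem abs_lt_of_mk_mem_ball {c : ℂ} {R x t : ℝ} (hR : 0 < R)
    (h : (⟨x, t⟩ : ℂ) ∈ Metric.ball c R) : |x - c.re| < R := by
  rw [mk_mem_ball_iff hR] at h
  exact abs_lt_of_sq_lt_sq (by nlinarith [sq_nonneg (t - c.im)]) hR.le

theorem mk_mem_sphere {c : ℂ} {R x t : ℝ} (hx : |x - c.re| < R)
    (ht : (t - c.im) ^ 2 = halfChord c R x ^ 2) : (⟨x, t⟩ : ℂ) ∈ Metric.sphere c R := by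
  have hR : 0 < R := (abs_nonneg _).trans_lt hx
  rw [halfChord, Real.sq_sqrt (Real.sqrt_pos.mp (halfChord_pos hx)).le] at ht
  rw [mem_sphere_iff_norm, ← pow_left_inj₀ (norm_nonneg _) hR.le two_ne_zero,
    ← Complex.normSq_eq_norm_sq, Complex.normSq_apply]
  simp only [Complex.sub_re, Complex.sub_im]
  linarith

/-- Disks with disjoint closures fill the disk `|z - m| < R₀` up to a null set. -/
structure DiskFilling {ι : Type*} (m : ℂ) (R₀ : ℝ) (c : ι → ℂ) (R : ι → ℝ) : Prop where
  pos : ∀ i, 0 < R i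
  subset : ∀ i, Metric.closedBall (c i) (R i) ⊆ Metric.ball m R₀
  disjoint : Pairwise (Function.onFun Disjoint fun i => Metric.closedBall (c i) (R i))
  null : volume (Metric.ball m R₀ \ ⋃ i, Metric.ball (c i) (R i)) = 0

theorem lipschitz_mk (x : ℝ) : LipschitzWith 1 fun t : ℝ => (⟨x, t⟩ : ℂ) := by
  refine LipschitzWith.of_dist_le_mul fun s t => ?_
  rw [Complex.dist_mk, sub_self, NNReal.coe_one, one_mul]
  simp [Real.sqrt_sq_eq_abs, Real.dist_eq]

variable {ι : Type*} {m : ℂ} {R₀ : ℝ} {c : ι → ℂ} {R : ι → ℝ}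

theorem DiskFilling.ae_vertical_null (F : DiskFilling m R₀ c R) :
    ∀ᵐ x : ℝ, volume {t : ℝ | (⟨x, t⟩ : ℂ) ∈ Metric.ball m R₀ \ ⋃ i, Metric.ball (c i) (R i)}
      = 0 := by
  have h1 : ∀ᵐ z : ℂ, z ∉ Metric.ball m R₀ \ ⋃ i, Metric.ball (c i) (R i) :=
    measure_eq_zero_iff_ae_notMem.mp F.null
  have h2 := Complex.volume_preserving_equiv_real_prod.symm.quasiMeasurePreserving.ae h1
  filter_upwards [Measure.ae_ae_of_ae_prod h2] with x hx
  exact measure_eq_zero_iff_ae_notMem.mpr hx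

/-- On almost every vertical line that meets a disk, a Lipschitz function is bounded at some point
of the boundary of this disk by the sum of its oscillations on the circles that the line meets. -/
theorem DiskFilling.ae_vertical [Countable ι] (F : DiskFilling m R₀ c R) {v : ℂ → ℝ} {L : ℝ≥0}
    (hv : LipschitzWith L v) (hv0 : ∀ z, z ∉ Metric.ball m R₀ → v z = 0) {J : ι → ℝ}
    (hJ0 : ∀ i, 0 ≤ J i)
    (hJ : ∀ i, ∀ z ∈ Metric.sphere (c i) (R i), ∀ z' ∈ Metric.sphere (c i) (R i), v z - v z' ≤ J i) :
    ∀ᵐ x : ℝ, ∀ i, |x - (c i).re| < R i → ∃ z ∈ Metric.sphere (c i) (R i),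
      ENNReal.ofReal (v z) ≤
        ∑' j, {x : ℝ | |x - (c j).re| < R j}.indicator (fun _ => ENNReal.ofReal (J j)) x := by
  filter_upwards [F.ae_vertical_null] with x hnull i hi
  set S := fun j => halfChord (c j) (R j) x with hS
  -- `b` is the lower point of circle `i` on the line. Below, `a` is the lower end of the chord of
  -- the large disk, where `v` vanishes, so `v` at `b` is an increment over `(a, b)`.
  set b := (c i).im - S i with hb
  have hbs : (⟨x, b⟩ : ℂ) ∈ Metric.sphere (c i) (R i) := mk_mem_sphere hi (by rw [hb]; ring)
  refine ⟨_, hbs, ?_⟩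
  have hbm : (⟨x, b⟩ : ℂ) ∈ Metric.ball m R₀ := F.subset i (Metric.sphere_subset_closedBall hbs)
  have hR₀ : 0 < R₀ := Metric.pos_of_mem_ball hbm
  have hxm := abs_lt_of_mk_mem_ball hR₀ hbm
  set a := m.im - halfChord m R₀ x with ha
  have hbI := (mk_mem_ball_iff_Ioo hR₀).mp hbm
  have hva : v ⟨x, a⟩ = 0 := hv0 _ (by
    rw [mk_mem_ball_iff_Ioo hR₀]
    exact fun h => lt_irrefl _ h.1)
  -- The disks whose chords lie below `b`. Their chords fill `(a, b)` up to a null set, and the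
  -- increment over each one is between two points of the same circle.
  set κ := {j : ι // |x - (c j).re| < R j ∧ (c j).im + S j ≤ b} with hκ
  have key := ofReal_sub_le_tsum (ι := κ) (v := fun t => v ⟨x, t⟩) (a := a) (b := b)
    (l := fun j => (c j.1).im - S j.1) (r := fun j => (c j.1).im + S j.1) (J := fun j => J j.1)
    (hv.comp (lipschitz_mk x)) hbI.1.le
    (fun j => by have := halfChord_pos j.2.1; simp only [hS]; linarith)
    (fun j t ht => by
      refine ⟨?_, ht.2.trans_le j.2.2⟩
      have h1 : (⟨x, t⟩ : ℂ) ∈ Metric.ball (c j.1) (R j.1) :=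
        (mk_mem_ball_iff_Ioo (F.pos j.1)).mpr ht
      exact ((mk_mem_ball_iff_Ioo hR₀).mp (F.subset _ (Metric.ball_subset_closedBall h1))).1)
    (fun j j' hne => disjoint_left.mpr fun t ht ht' =>
      disjoint_left.mp (F.disjoint (fun e => hne (Subtype.ext e)))
        (Metric.ball_subset_closedBall ((mk_mem_ball_iff_Ioo (F.pos j.1)).mpr ht))
        (Metric.ball_subset_closedBall ((mk_mem_ball_iff_Ioo (F.pos j'.1)).mpr ht')))
    (by
      refine measure_mono_null (fun t ht => ?_) hnull
      refine ⟨(mk_mem_ball_iff_Ioo hR₀).mpr ⟨ht.1.1, ht.1.2.trans hbI.2⟩, fun hU => ht.2 ?_⟩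
      obtain ⟨j, hj⟩ := mem_iUnion.mp hU
      have hjI := (mk_mem_ball_iff_Ioo (F.pos j)).mp hj
      refine mem_iUnion.mpr ⟨⟨j, abs_lt_of_mk_mem_ball (F.pos j) hj, ?_⟩, hjI⟩
      -- A chord that starts below `b` and ends above it would put the boundary point of disk `i`
      -- into another disk, or into the open disk `i` itself.
      by_contra hlt
      push Not at hlt
      have hbj : (⟨x, b⟩ : ℂ) ∈ Metric.ball (c j) (R j) :=
        (mk_mem_ball_iff_Ioo (F.pos j)).mpr ⟨hjI.1.trans ht.1.2, hlt⟩
      by_cases hij : i = j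
      · subst hij
        exact (Metric.mem_ball.mp hbj).ne (Metric.mem_sphere.mp hbs)
      · exact disjoint_left.mp (F.disjoint hij) (Metric.sphere_subset_closedBall hbs)
          (Metric.ball_subset_closedBall hbj))
    (fun j => hJ0 _)
    (fun j => hJ _ _ (mk_mem_sphere j.2.1 (by ring)) _ (mk_mem_sphere j.2.1 (by ring)))
  simp only [hva, sub_zero] at key
  refine key.trans ?_
  calc ∑' j : κ, ENNReal.ofReal (J j.1)
      = ∑' j : κ, {x : ℝ | |x - (c j.1).re| < R j.1}.indicator
          (fun _ => ENNReal.ofReal (J j.1)) x := by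
        refine tsum_congr fun j => ?_
        rw [indicator_of_mem]
        exact j.2.1
    _ ≤ _ := ENNReal.tsum_comp_le_tsum_of_injective Subtype.val_injective
        (fun j => {x : ℝ | |x - (c j).re| < R j}.indicator (fun _ => ENNReal.ofReal (J j)) x)

/-- The reflection that exchanges real and imaginary parts. -/
noncomputable def swapLIE : ℂ ≃ₗᵢ[ℝ] ℂ :=
  Complex.conjLIE.trans (rotation ⟨Complex.I, by simp [Submonoid.unitSphere]⟩)

theorem swapLIE_apply (z : ℂ) : swapLIE z = ⟨z.im, z.re⟩ := by
  change Complex.I * conj z = _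
  apply Complex.ext <;> simp

theorem swapLIE_swapLIE (z : ℂ) : swapLIE (swapLIE z) = z := by
  rw [swapLIE_apply, swapLIE_apply]

theorem DiskFilling.swap (F : DiskFilling m R₀ c R) :
    DiskFilling (swapLIE m) R₀ (fun i => swapLIE (c i)) R := by
  have hb : ∀ (z w : ℂ) (r : ℝ), swapLIE z ∈ Metric.ball (swapLIE w) r ↔ z ∈ Metric.ball w r :=
    fun z w r => by rw [Metric.mem_ball, Metric.mem_ball, swapLIE.dist_map]
  have hcb : ∀ (z w : ℂ) (r : ℝ),
      swapLIE z ∈ Metric.closedBall (swapLIE w) r ↔ z ∈ Metric.closedBall w r :=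
    fun z w r => by rw [Metric.mem_closedBall, Metric.mem_closedBall, swapLIE.dist_map]
  refine ⟨F.pos, fun i z hz => ?_, fun i j hij => disjoint_left.mpr fun z hz hz' => ?_, ?_⟩
  · rw [← swapLIE_swapLIE z, hcb] at hz
    rw [← swapLIE_swapLIE z, hb]
    exact F.subset i hz
  · change z ∈ Metric.closedBall (swapLIE (c i)) (R i) at hz
    change z ∈ Metric.closedBall (swapLIE (c j)) (R j) at hz'
    rw [← swapLIE_swapLIE z, hcb] at hz hz'
    exact disjoint_left.mp (F.disjoint hij) hz hz'
  · have h1 := swapLIE.measurePreserving.quasiMeasurePreserving.ae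
      (measure_eq_zero_iff_ae_notMem.mp F.null)
    refine measure_eq_zero_iff_ae_notMem.mpr (h1.mono fun z hz hz' => hz ?_)
    rw [← swapLIE_swapLIE z] at hz'
    refine ⟨(hb _ _ _).mp hz'.1, fun hU => hz'.2 ?_⟩
    obtain ⟨i, hi⟩ := mem_iUnion.mp hU
    exact mem_iUnion.mpr ⟨i, (hb _ _ _).mpr hi⟩

theorem lintegral_tsum_indicator [Countable ι] (a J : ι → ℝ) (R : ι → ℝ) :
    ∫⁻ x : ℝ, ∑' j, {x : ℝ | |x - a j| < R j}.indicator (fun _ => ENNReal.ofReal (J j)) x =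
      ∑' j, ENNReal.ofReal (2 * R j) * ENNReal.ofReal (J j) := by
  have hb : ∀ j, {x : ℝ | |x - a j| < R j} = Metric.ball (a j) (R j) := fun j => by
    ext x; rw [Metric.mem_ball, Real.dist_eq]; rfl
  simp only [hb]
  rw [lintegral_tsum fun j =>
    (measurable_const.indicator Metric.isOpen_ball.measurableSet).aemeasurable]
  refine tsum_congr fun j => ?_
  rw [lintegral_indicator Metric.isOpen_ball.measurableSet, setLIntegral_const, Real.volume_ball,
    mul_comm]

/-- The sum of the squared minima of a Lipschitz function over the circles of a filling, weighted
with the areas of the disks, is controlled by its oscillations. -/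
theorem DiskFilling.area_estimate [Countable ι] (F : DiskFilling m R₀ c R) {v : ℂ → ℝ} {L : ℝ≥0}
    (hv : LipschitzWith L v) (hv0 : ∀ z, z ∉ Metric.ball m R₀ → v z = 0) {J μ : ι → ℝ}
    (hJ0 : ∀ i, 0 ≤ J i)
    (hJ : ∀ i, ∀ z ∈ Metric.sphere (c i) (R i), ∀ z' ∈ Metric.sphere (c i) (R i), v z - v z' ≤ J i)
    (hμ : ∀ i, ∀ z ∈ Metric.sphere (c i) (R i), μ i ≤ v z) :
    ∑' i, volume (Metric.ball (c i) (R i)) * ENNReal.ofReal (μ i) ^ 2 ≤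
      (∑' i, ENNReal.ofReal (2 * R i) * ENNReal.ofReal (J i)) ^ 2 := by
  set A := fun x : ℝ =>
    ∑' j, {x : ℝ | |x - (c j).re| < R j}.indicator (fun _ => ENNReal.ofReal (J j)) x with hA
  set B := fun x : ℝ =>
    ∑' j, {x : ℝ | |x - (c j).im| < R j}.indicator (fun _ => ENNReal.ofReal (J j)) x with hB
  have hmeas : ∀ a : ι → ℝ, Measurable fun x : ℝ =>
      ∑' j, {x : ℝ | |x - a j| < R j}.indicator (fun _ => ENNReal.ofReal (J j)) x := fun a => by
    refine Measurable.tsum fun j => measurable_const.indicator ?_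
    exact measurableSet_lt (by fun_prop) measurable_const
  have h1 : ∀ᵐ x : ℝ, ∀ i, |x - (c i).re| < R i → ENNReal.ofReal (μ i) ≤ A x := by
    filter_upwards [F.ae_vertical hv hv0 hJ0 hJ] with x hx i hi
    obtain ⟨z, hz, hle⟩ := hx i hi
    exact (ENNReal.ofReal_le_ofReal (hμ i z hz)).trans hle
  have hsph : ∀ (z w : ℂ) (r : ℝ), z ∈ Metric.sphere (swapLIE w) r → swapLIE z ∈ Metric.sphere w r :=
    fun z w r hz => by
      rw [← swapLIE_swapLIE z] at hz
      rwa [Metric.mem_sphere, swapLIE.dist_map] at hz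
  have h2 : ∀ᵐ x : ℝ, ∀ i, |x - (c i).im| < R i → ENNReal.ofReal (μ i) ≤ B x := by
    have h3 := F.swap.ae_vertical (hv.comp swapLIE.lipschitz) (fun z hz => hv0 _ fun h => hz (by
      rw [← swapLIE_swapLIE z, Metric.mem_ball, swapLIE.dist_map]; exact h)) hJ0
      (fun i z hz z' hz' => hJ i _ (hsph _ _ _ hz) _ (hsph _ _ _ hz'))
    simp only [swapLIE_apply] at h3
    filter_upwards [h3] with x hx i hi
    obtain ⟨z, hz, hle⟩ := hx i hi
    rw [← swapLIE_apply] at hz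
    exact (ENNReal.ofReal_le_ofReal (hμ i _ (hsph _ _ _ hz))).trans hle
  -- A point of disk `i` lies on a vertical and on a horizontal line meeting that disk. Using one
  -- bound for each direction gives a product of a function of `x` and a function of `y`, whose
  -- integral over the plane factors.
  have h4 : ∀ᵐ z : ℂ, ∀ i, z ∈ Metric.ball (c i) (R i) →
      ENNReal.ofReal (μ i) ^ 2 ≤ A z.re * B z.im := by
    have e1 := (Measure.quasiMeasurePreserving_fst (μ := (volume : Measure ℝ))
      (ν := (volume : Measure ℝ))).ae h1
    have e2 := (Measure.quasiMeasurePreserving_snd (μ := (volume : Measure ℝ))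
      (ν := (volume : Measure ℝ))).ae h2
    have e3 := Complex.volume_preserving_equiv_real_prod.quasiMeasurePreserving.ae (e1.and e2)
    filter_upwards [e3] with z hz i hi
    have hre : |z.re - (c i).re| < R i :=
      lt_of_le_of_lt (Complex.abs_re_le_norm (z - c i)) (mem_ball_iff_norm.mp hi)
    have him : |z.im - (c i).im| < R i :=
      lt_of_le_of_lt (Complex.abs_im_le_norm (z - c i)) (mem_ball_iff_norm.mp hi)
    rw [sq]
    exact mul_le_mul' (hz.1 i hre) (hz.2 i him)
  calc ∑' i, volume (Metric.ball (c i) (R i)) * ENNReal.ofReal (μ i) ^ 2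
      = ∑' i, ∫⁻ _ in Metric.ball (c i) (R i), ENNReal.ofReal (μ i) ^ 2 := by
        refine tsum_congr fun i => ?_
        rw [setLIntegral_const, mul_comm]
    _ ≤ ∑' i, ∫⁻ z in Metric.ball (c i) (R i), A z.re * B z.im := by
        refine ENNReal.tsum_le_tsum fun i => ?_
        refine lintegral_mono_ae ?_
        filter_upwards [ae_restrict_of_ae h4, ae_restrict_mem Metric.isOpen_ball.measurableSet]
          with z hz hzi
        exact hz i hzi
    _ = ∫⁻ z in ⋃ i, Metric.ball (c i) (R i), A z.re * B z.im := by
        rw [lintegral_iUnion (fun i => Metric.isOpen_ball.measurableSet)]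
        exact fun i j hij => (F.disjoint hij).mono Metric.ball_subset_closedBall
          Metric.ball_subset_closedBall
    _ ≤ ∫⁻ z : ℂ, A z.re * B z.im := setLIntegral_le_lintegral _ _
    _ = ∫⁻ p : ℝ × ℝ, A p.1 * B p.2 :=
        Complex.volume_preserving_equiv_real_prod.lintegral_comp (f := fun p => A p.1 * B p.2)
          (((hmeas _).comp measurable_fst).mul ((hmeas _).comp measurable_snd))
    _ = (∫⁻ x, A x) * ∫⁻ y, B y :=
        lintegral_prod_mul (hmeas _).aemeasurable (hmeas _).aemeasurable
    _ = _ := by rw [hA, hB, lintegral_tsum_indicator, lintegral_tsum_indicator, sq]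

end RoundCarpet

/-! ## The tail estimate -/

namespace RoundCarpet

theorem abs_sub_le_setIntegral {f g : ℝ → ℝ} {L : ℝ≥0} (hf : LipschitzWith L f) {s : Set ℝ}
    {x y : ℝ} (hxy : uIoc y x ⊆ s) (hg : IntegrableOn g s)
    (hfg : ∀ᵐ t ∂(volume.restrict s), |deriv f t| ≤ g t) : |f x - f y| ≤ ∫ t in s, g t := by
  have hint : IntegrableOn (fun t => |deriv f t|) s :=
    hg.mono' (measurable_deriv f).norm.aestronglyMeasurable
      (hfg.mono fun t ht => by rwa [Real.norm_eq_abs, abs_abs])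
  rw [← (hf.lipschitzOnWith.absolutelyContinuousOnInterval).integral_deriv_eq_sub]
  calc |∫ t in y..x, deriv f t| ≤ ∫ t in uIoc y x, |deriv f t| :=
        intervalIntegral.norm_integral_le_integral_norm_uIoc (f := deriv f)
    _ ≤ ∫ t in s, |deriv f t| :=
        setIntegral_mono_set hint (ae_of_all _ fun t => abs_nonneg _) hxy.eventuallyLE
    _ ≤ ∫ t in s, g t := integral_mono_ae hint hg hfg

theorem sq_mem_lipSpace {K : Set ℂ} {u : K → ℝ} (hu : u ∈ lipSpace K) :
    (fun x => u x ^ 2) ∈ lipSpace K := by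
  obtain ⟨hc, L, hL⟩ := hu
  obtain ⟨M, hM⟩ := hL.continuous.bounded_above_of_compact_support hc
  refine ⟨hc.comp_left (g := fun t => t ^ 2) (by simp), L * (2 * Real.nnabs M),
    LipschitzWith.of_dist_le_mul fun x y => ?_⟩
  have h1 := hL.dist_le_mul x y
  rw [Real.dist_eq] at h1 ⊢
  have h2 : |u x + u y| ≤ 2 * |M| := by
    have hx := (hM x).trans (le_abs_self M)
    have hy := (hM y).trans (le_abs_self M)
    rw [Real.norm_eq_abs] at hx hy
    exact (abs_add_le _ _).trans (by linarith)
  rw [show u x ^ 2 - u y ^ 2 = (u x - u y) * (u x + u y) by ring, abs_mul]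
  push_cast
  calc _ ≤ (L * dist x y) * (2 * |M|) := mul_le_mul h1 h2 (abs_nonneg _)
        (mul_nonneg L.2 dist_nonneg)
    _ = _ := by ring

variable {m₀ : ℂ} {R₀ : ℝ} {P : Set (ℂ × ℝ)} {K : Set ℂ}

namespace IsDiskPacking

theorem diskFilling (h : IsDiskPacking m₀ R₀ P K) :
    DiskFilling m₀ R₀ (fun p : P => p.1.1) (fun p : P => p.1.2) := by
  refine ⟨h.pos, fun p => h.closedBall_subset p.1 p.2, fun p p' hne =>
    h.disjoint p.1 p.2 p'.1 p'.2 fun e => hne (Subtype.ext e), ?_⟩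
  have := h.null
  rwa [biUnion_eq_iUnion] at this

/-- Functions of `lipSpace K` extend to Lipschitz functions that vanish off the large disk. -/
theorem exists_extension (h : IsDiskPacking m₀ R₀ P K) {u : K → ℝ} (hu : u ∈ lipSpace K) :
    ∃ (v : ℂ → ℝ) (L : ℝ≥0), LipschitzWith L v ∧ (∀ z, z ∉ Metric.ball m₀ R₀ → v z = 0) ∧
      ∀ x : K, v x = u x := by
  obtain ⟨hc, L, hL⟩ := hu
  obtain ⟨M, hM⟩ := hL.continuous.bounded_above_of_compact_support hc
  -- The compact support keeps a distance `δ` from the outer boundary, so extension by zero across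
  -- the gap costs only a Lipschitz constant `|M| / δ`.
  obtain ⟨δ, hδ, hsub⟩ := (hc.isCompact.image continuous_subtype_val).exists_thickening_subset_open
    Metric.isOpen_ball (by rintro _ ⟨x, -, rfl⟩; exact h.subset_ball x.2)
  have hsep : ∀ x : K, ∀ z, z ∉ Metric.ball m₀ R₀ → |u x| ≤ |M| / δ * dist (x : ℂ) z := by
    intro x z hz
    by_cases hx : u x = 0
    · rw [hx, abs_zero]; positivity
    · have hd : δ ≤ dist (x : ℂ) z := by
        by_contra hlt
        push Not at hlt
        rw [dist_comm] at hlt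
        exact hz (hsub (Metric.mem_thickening_iff.mpr
          ⟨x, mem_image_of_mem _ (subset_tsupport _ hx), hlt⟩))
      calc |u x| ≤ |M| := (hM x).trans (le_abs_self M)
        _ = |M| / δ * δ := by field_simp
        _ ≤ _ := by gcongr
  set C : ℝ≥0 := ⟨L + |M| / δ, by positivity⟩ with hC
  have hCL : (L : ℝ) ≤ C := le_add_of_nonneg_right (by positivity)
  have hCM : |M| / δ ≤ C := le_add_of_nonneg_left L.2
  have hK : ∀ x : K, extendZero u x = u x := fun x => Subtype.val_injective.extend_apply _ _ _
  have hout : ∀ z, z ∉ Metric.ball m₀ R₀ → extendZero u z = 0 := fun z hz =>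
    Function.extend_apply' _ _ _ (by rintro ⟨x, rfl⟩; exact hz (h.subset_ball x.2))
  have hlip : LipschitzOnWith C (extendZero u) (K ∪ (Metric.ball m₀ R₀)ᶜ) := by
    refine LipschitzOnWith.of_dist_le_mul ?_
    rintro x (hx | hx) y (hy | hy)
    · have e1 := hK ⟨x, hx⟩
      have e2 := hK ⟨y, hy⟩
      change extendZero u x = _ at e1
      change extendZero u y = _ at e2
      rw [e1, e2]
      exact (hL.dist_le_mul _ _).trans (mul_le_mul_of_nonneg_right hCL dist_nonneg)
    · have e1 := hK ⟨x, hx⟩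
      change extendZero u x = _ at e1
      rw [e1, hout y hy, Real.dist_0_eq_abs]
      exact (hsep ⟨x, hx⟩ y hy).trans (mul_le_mul_of_nonneg_right hCM dist_nonneg)
    · have e1 := hK ⟨y, hy⟩
      change extendZero u y = _ at e1
      rw [e1, hout x hx, dist_comm, Real.dist_0_eq_abs, dist_comm]
      exact (hsep ⟨y, hy⟩ x hx).trans (mul_le_mul_of_nonneg_right hCM dist_nonneg)
    · rw [hout x hx, hout y hy, dist_self]; positivity
  obtain ⟨v, hv, e⟩ := hlip.extend_real
  exact ⟨v, C, hv, fun z hz => by rw [← e (Or.inr hz), hout z hz],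
    fun x => by rw [← e (Or.inl x.2), hK]⟩

/-- The integral of `u²` over a circle with respect to the angle. -/
noncomputable def arcSq (h : IsDiskPacking m₀ R₀ P K) (u : K → ℝ) (p : P) : ℝ :=
  ∫ θ in Ioc 0 (2 * π), u (h.circ p θ) ^ 2

/-- The energy of `u` on a circle. -/
noncomputable def arcEnergy (h : IsDiskPacking m₀ R₀ P K) (u : K → ℝ) (p : P) : ℝ :=
  ∫ θ in Ioc 0 (2 * π), h.arcDeriv u (p, θ) ^ 2

/-- The squared form norm on functions. -/
noncomputable def formNormSq (h : IsDiskPacking m₀ R₀ P K) (u : K → ℝ) : ℝ :=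
  h.energy u u + ∫ x, u x ^ 2 ∂(packMeasure P K)

theorem arcSq_nonneg (h : IsDiskPacking m₀ R₀ P K) (u : K → ℝ) (p : P) : 0 ≤ h.arcSq u p :=
  integral_nonneg fun _ => sq_nonneg _

theorem arcEnergy_nonneg (h : IsDiskPacking m₀ R₀ P K) (u : K → ℝ) (p : P) :
    0 ≤ h.arcEnergy u p :=
  integral_nonneg fun _ => sq_nonneg _

theorem hasSum_arcEnergy (h : IsDiskPacking m₀ R₀ P K) {u : K → ℝ} (hu : u ∈ lipSpace K) :
    HasSum (fun p => h.arcEnergy u p) (h.energy u u) := by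
  obtain ⟨-, L, hL⟩ := hu
  have := h.hasSum_arc (h.integrable_arcDeriv_mul hL hL)
  simp only [arcEnergy, sq]
  exact this

theorem hasSum_arcSq (h : IsDiskPacking m₀ R₀ P K) {u : K → ℝ} (hu : u ∈ lipSpace K) :
    HasSum (fun p : P => p.1.2 ^ 2 * h.arcSq u p) (∫ x, u x ^ 2 ∂(packMeasure P K)) := by
  have h1 := (h.memLp_of_mem hu).integrable_sq
  rw [h.packMeasure_eq] at h1 ⊢
  have h2 := hasSum_integral_measure h1
  refine h2.congr_fun fun p => ?_
  obtain ⟨-, L, hL⟩ := hu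
  rw [integral_smul_measure, integral_map (h.continuous_circ p).aemeasurable
    (f := fun x => u x ^ 2) (hL.continuous.pow 2).aestronglyMeasurable, ENNReal.toReal_ofReal (sq_nonneg _), smul_eq_mul]
  rfl

theorem hasSum_formNormSq (h : IsDiskPacking m₀ R₀ P K) {u : K → ℝ} (hu : u ∈ lipSpace K) :
    HasSum (fun p : P => h.arcEnergy u p + p.1.2 ^ 2 * h.arcSq u p) (h.formNormSq u) :=
  (h.hasSum_arcEnergy hu).add (h.hasSum_arcSq hu)

theorem integrableOn_sq_arcDeriv (h : IsDiskPacking m₀ R₀ P K) {u : K → ℝ} (hu : u ∈ lipSpace K)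
    (p : P) : IntegrableOn (fun θ => h.arcDeriv u (p, θ) ^ 2) (Ioc 0 (2 * π)) :=
  (h.memLp_slice (h.memLp_arcDeriv hu.2.choose_spec) p).integrable_sq

theorem integrableOn_sq (h : IsDiskPacking m₀ R₀ P K) {u : K → ℝ} (hu : u ∈ lipSpace K)
    (p : P) : IntegrableOn (fun θ => u (h.circ p θ) ^ 2) (Ioc 0 (2 * π)) :=
  ((hu.2.choose_spec.continuous.comp (h.continuous_circ p)).pow 2).integrableOn_Ioc

/-- The oscillation of `u²` on a circle. -/
theorem sq_sub_sq_le (h : IsDiskPacking m₀ R₀ P K) {u : K → ℝ} (hu : u ∈ lipSpace K) (p : P)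
    {θ θ' : ℝ} (hθ : θ ∈ Icc 0 (2 * π)) (hθ' : θ' ∈ Icc 0 (2 * π)) :
    u (h.circ p θ) ^ 2 - u (h.circ p θ') ^ 2 ≤
      p.1.2 * h.arcSq u p + h.arcEnergy u p / p.1.2 := by
  obtain ⟨-, L, hL⟩ := sq_mem_lipSpace hu
  have hR := h.pos p
  have h1 := (h.integrableOn_sq hu p).const_mul p.1.2
  have h2 := (h.integrableOn_sq_arcDeriv hu p).div_const p.1.2
  have hsub : uIoc θ' θ ⊆ Ioc 0 (2 * π) :=
    Ioc_subset_Ioc (le_min hθ'.1 hθ.1) (max_le hθ'.2 hθ.2)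
  have key := abs_sub_le_setIntegral (h.lipschitz_comp_circ hL p) hsub
    (h1.add h2) (by
      refine ae_restrict_of_ae ?_
      filter_upwards [(h.lipschitz_comp_circ hu.2.choose_spec p).ae_differentiableAt_real] with t ht
      have e := (ht.hasDerivAt.pow 2).deriv
      change |_root_.deriv ((fun θ => u (h.circ p θ)) ^ 2) t| ≤ p.1.2 * u (h.circ p t) ^ 2 +
        _root_.deriv (fun θ => u (h.circ p θ)) t ^ 2 / p.1.2
      rw [e]
      set d := _root_.deriv (fun θ => u (h.circ p θ)) t
      simp only [Nat.cast_ofNat, Nat.add_one_sub_one, pow_one]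
      rw [← sub_nonneg]
      -- Arithmetic–geometric mean with weight `R`, chosen so that `R` times the oscillation of `u²`
      -- becomes exactly the contribution of the circle to the squared form norm.
      have e2 : p.1.2 * u (h.circ p t) ^ 2 + d ^ 2 / p.1.2 - |2 * u (h.circ p t) * d| =
          (p.1.2 * |u (h.circ p t)| - |d|) ^ 2 / p.1.2 := by
        rw [abs_mul, abs_mul, abs_two, ← sq_abs (u (h.circ p t)), ← sq_abs d]
        field_simp
        ring
      rw [e2]
      positivity)
  refine (le_abs_self _).trans (key.trans (le_of_eq ?_))
  simp only [Pi.add_apply]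
  rw [integral_add h1 h2, integral_const_mul, integral_div]
  rfl

/-- The mean of `u²` over a circle differs from its values by at most the oscillation. -/
theorem arcSq_le (h : IsDiskPacking m₀ R₀ P K) {u : K → ℝ} (hu : u ∈ lipSpace K) (p : P)
    {θ : ℝ} (hθ : θ ∈ Icc 0 (2 * π)) : h.arcSq u p ≤
      2 * π * (u (h.circ p θ) ^ 2 + (p.1.2 * h.arcSq u p + h.arcEnergy u p / p.1.2)) := by
  have h1 : h.arcSq u p ≤ ∫ _ in Ioc 0 (2 * π),
      (u (h.circ p θ) ^ 2 + (p.1.2 * h.arcSq u p + h.arcEnergy u p / p.1.2)) := by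
    refine setIntegral_mono_on (h.integrableOn_sq hu p) (integrableOn_const measure_Ioc_lt_top.ne)
      measurableSet_Ioc
      fun t ht => ?_
    have := h.sq_sub_sq_le hu p (Ioc_subset_Icc_self ht) hθ
    linarith
  rw [setIntegral_const, smul_eq_mul, Real.volume_real_Ioc_of_le Real.two_pi_pos.le, sub_zero] at h1
  exact h1

theorem sq_le (h : IsDiskPacking m₀ R₀ P K) {u : K → ℝ} (hu : u ∈ lipSpace K) (p : P)
    {θ : ℝ} (hθ : θ ∈ Icc 0 (2 * π)) : 2 * π * u (h.circ p θ) ^ 2 ≤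
      h.arcSq u p + 2 * π * (p.1.2 * h.arcSq u p + h.arcEnergy u p / p.1.2) := by
  have h1 : ∫ _ in Ioc 0 (2 * π),
      (u (h.circ p θ) ^ 2 - (p.1.2 * h.arcSq u p + h.arcEnergy u p / p.1.2)) ≤ h.arcSq u p := by
    refine setIntegral_mono_on (integrableOn_const measure_Ioc_lt_top.ne) (h.integrableOn_sq hu p)
      measurableSet_Ioc
      fun t ht => ?_
    have := h.sq_sub_sq_le hu p hθ (Ioc_subset_Icc_self ht)
    linarith
  rw [setIntegral_const, smul_eq_mul, Real.volume_real_Ioc_of_le Real.two_pi_pos.le, sub_zero] at h1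
  linarith

/-- This is `area_estimate` for the extension of `u²`: by `sq_sub_sq_le` the sum of `2 R J` over all
circles is `2 * h.formNormSq u`. The factor `π` of the areas is estimated from below by 1. -/
theorem sum_area_le (h : IsDiskPacking m₀ R₀ P K) {u : K → ℝ} (hu : u ∈ lipSpace K)
    (F : Finset P) {μ : P → ℝ} (hμ0 : ∀ p, 0 ≤ μ p)
    (hμ : ∀ p, ∀ x : K, (x : ℂ) ∈ Metric.sphere p.1.1 p.1.2 → μ p ≤ u x ^ 2) :
    ∑ p ∈ F, p.1.2 ^ 2 * μ p ^ 2 ≤ (2 * h.formNormSq u) ^ 2 := by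
  have := h.countable
  obtain ⟨v, L, hL, hv0, hv⟩ := h.exists_extension (sq_mem_lipSpace hu)
  set J : P → ℝ := fun p => p.1.2 * h.arcSq u p + h.arcEnergy u p / p.1.2 with hJd
  have hJ0 : ∀ p, 0 ≤ J p := fun p => by
    have h1 := h.pos p
    have h2 := h.arcSq_nonneg u p
    have h3 := h.arcEnergy_nonneg u p
    positivity
  have hsph : ∀ p : P, ∀ z ∈ Metric.sphere p.1.1 p.1.2, ∃ θ ∈ Icc 0 (2 * π),
      v z = u (h.circ p θ) ^ 2 := fun p z hz => by
    obtain ⟨θ, hθ, e⟩ := h.exists_circ p (x := ⟨z, h.sphere_subset p.1 p.2 hz⟩) hz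
    refine ⟨θ, Ioc_subset_Icc_self hθ, ?_⟩
    rw [e]
    exact hv ⟨z, h.sphere_subset p.1 p.2 hz⟩
  have key := h.diskFilling.area_estimate hL hv0 (J := J) (μ := μ) hJ0
    (fun p z hz z' hz' => by
      obtain ⟨θ, hθ, e⟩ := hsph p z hz
      obtain ⟨θ', hθ', e'⟩ := hsph p z' hz'
      rw [e, e']
      exact h.sq_sub_sq_le hu p hθ hθ')
    (fun p z hz => by
      have h1 := hμ p ⟨z, h.sphere_subset p.1 p.2 hz⟩ hz
      rw [← hv] at h1
      exact h1)
  have hN := h.hasSum_formNormSq hu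
  have hN0 : 0 ≤ h.formNormSq u := hN.nonneg fun p =>
    add_nonneg (h.arcEnergy_nonneg u p) (mul_nonneg (sq_nonneg _) (h.arcSq_nonneg u p))
  have e1 : ∑' p : P, ENNReal.ofReal (2 * p.1.2) * ENNReal.ofReal (J p) =
      ENNReal.ofReal (2 * h.formNormSq u) := by
    have h2 := hN.mul_left 2
    rw [← h2.tsum_eq, ENNReal.ofReal_tsum_of_nonneg _ h2.summable]
    · refine tsum_congr fun p => ?_
      have := h.pos p
      rw [← ENNReal.ofReal_mul (by positivity)]
      congr 1
      rw [hJd]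
      field_simp
      ring
    · intro p
      exact mul_nonneg two_pos.le (add_nonneg (h.arcEnergy_nonneg u p)
        (mul_nonneg (sq_nonneg _) (h.arcSq_nonneg u p)))
  rw [e1, ← ENNReal.ofReal_pow (by positivity)] at key
  have h3 : ENNReal.ofReal (∑ p ∈ F, p.1.2 ^ 2 * μ p ^ 2) ≤
      ENNReal.ofReal ((2 * h.formNormSq u) ^ 2) := by
    refine le_trans ?_ key
    rw [ENNReal.ofReal_sum_of_nonneg (fun p _ => by positivity)]
    refine le_trans (Finset.sum_le_sum fun p _ => ?_) (ENNReal.sum_le_tsum F)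
    rw [Complex.volume_ball, ENNReal.ofReal_mul (sq_nonneg _), ENNReal.ofReal_pow (h.pos p).le,
      ENNReal.ofReal_pow (hμ0 p), mul_assoc]
    refine mul_le_mul_right (le_mul_of_one_le_left (by positivity) ?_) _
    rw [ENNReal.one_le_coe_iff, ← NNReal.coe_le_coe]
    exact (by norm_num : (1 : ℝ) ≤ 3).trans Real.pi_gt_three.le
  exact (ENNReal.ofReal_le_ofReal_iff (by positivity)).mp h3

/-- Small circles carry a small part of the `L²` norm. -/
theorem tail_estimate (h : IsDiskPacking m₀ R₀ P K) {u : K → ℝ} (hu : u ∈ lipSpace K)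
    {F : Finset P} {δ : ℝ} (hδ : 0 ≤ δ) (hF : ∑ p ∈ F, p.1.2 ^ 2 ≤ δ ^ 2) :
    ∑ p ∈ F, p.1.2 ^ 2 * h.arcSq u p ≤ 6 * π * δ * h.formNormSq u := by
  set J : P → ℝ := fun p => p.1.2 * h.arcSq u p + h.arcEnergy u p / p.1.2 with hJd
  -- The mean of `u²` minus its oscillation is a lower bound for `u²` on the circle. The part `μ` is
  -- summed with Cauchy–Schwarz against `∑ R² ≤ δ²`, the oscillation part with `R ≤ δ`.
  set μ : P → ℝ := fun p => max (h.arcSq u p / (2 * π) - J p) 0 with hμd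
  set N := h.formNormSq u with hNd
  have hπ := Real.two_pi_pos
  have hN := h.hasSum_formNormSq hu
  have hnn : ∀ p : P, 0 ≤ h.arcEnergy u p + p.1.2 ^ 2 * h.arcSq u p := fun p =>
    add_nonneg (h.arcEnergy_nonneg u p) (mul_nonneg (sq_nonneg _) (h.arcSq_nonneg u p))
  have hN0 : 0 ≤ N := hN.nonneg hnn
  have h1 : ∑ p ∈ F, p.1.2 ^ 2 * μ p ^ 2 ≤ (2 * N) ^ 2 := by
    refine h.sum_area_le hu F (fun p => le_max_right _ _) fun p x hx => ?_
    obtain ⟨θ, hθ, e⟩ := h.exists_circ p hx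
    rw [← e]
    refine max_le ?_ (sq_nonneg _)
    have := h.arcSq_le hu p (Ioc_subset_Icc_self hθ)
    rw [sub_le_iff_le_add, div_le_iff₀ hπ]
    linarith
  have h2 : ∑ p ∈ F, p.1.2 ^ 2 * μ p ≤ δ * (2 * N) := by
    have h3 := Finset.sum_mul_sq_le_sq_mul_sq F (fun p : P => p.1.2) (fun p : P => p.1.2 * μ p)
    simp only [mul_pow] at h3
    have h4 : (∑ p ∈ F, p.1.2 * (p.1.2 * μ p)) ^ 2 ≤ (δ * (2 * N)) ^ 2 := by
      rw [mul_pow]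
      refine h3.trans (mul_le_mul hF h1 (Finset.sum_nonneg fun p _ => by positivity)
        (sq_nonneg _))
    have h5 := abs_le_of_sq_le_sq h4 (by positivity)
    have e : ∑ p ∈ F, p.1.2 ^ 2 * μ p = ∑ p ∈ F, p.1.2 * (p.1.2 * μ p) :=
      Finset.sum_congr rfl fun p _ => by ring
    rw [e]
    exact (le_abs_self _).trans h5
  have h3 : ∑ p ∈ F, p.1.2 ^ 2 * J p ≤ δ * N := by
    calc ∑ p ∈ F, p.1.2 ^ 2 * J p
        ≤ ∑ p ∈ F, δ * (h.arcEnergy u p + p.1.2 ^ 2 * h.arcSq u p) := by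
          refine Finset.sum_le_sum fun p hp => ?_
          have hR := h.pos p
          have e : p.1.2 ^ 2 * J p = p.1.2 * (h.arcEnergy u p + p.1.2 ^ 2 * h.arcSq u p) := by
            rw [hJd]; field_simp; ring
          rw [e]
          refine mul_le_mul_of_nonneg_right ?_ (hnn p)
          have h4 : p.1.2 ^ 2 ≤ δ ^ 2 :=
            (Finset.single_le_sum (f := fun p : P => p.1.2 ^ 2) (fun p _ => sq_nonneg _) hp).trans hF
          exact (le_abs_self _).trans (abs_le_of_sq_le_sq h4 hδ)
      _ = δ * ∑ p ∈ F, (h.arcEnergy u p + p.1.2 ^ 2 * h.arcSq u p) := by rw [Finset.mul_sum]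
      _ ≤ δ * N := mul_le_mul_of_nonneg_left (sum_le_hasSum F (fun p _ => hnn p) hN) hδ
  calc ∑ p ∈ F, p.1.2 ^ 2 * h.arcSq u p
      ≤ ∑ p ∈ F, 2 * π * (p.1.2 ^ 2 * J p + p.1.2 ^ 2 * μ p) := by
        refine Finset.sum_le_sum fun p _ => ?_
        have h4 : h.arcSq u p / (2 * π) - J p ≤ μ p := le_max_left _ _
        rw [sub_le_iff_le_add, div_le_iff₀ hπ] at h4
        have := mul_le_mul_of_nonneg_left h4 (sq_nonneg p.1.2)
        linarith
    _ = 2 * π * (∑ p ∈ F, p.1.2 ^ 2 * J p + ∑ p ∈ F, p.1.2 ^ 2 * μ p) := by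
        rw [← Finset.sum_add_distrib, Finset.mul_sum]
    _ ≤ 2 * π * (δ * N + δ * (2 * N)) :=
        mul_le_mul_of_nonneg_left (add_le_add h3 h2) hπ.le
    _ = _ := by ring

end IsDiskPacking

end RoundCarpet

/-! ## Compactness of the inclusion -/

namespace RoundCarpet

open DirichletForm

variable {m₀ : ℂ} {R₀ : ℝ} {P : Set (ℂ × ℝ)} {K : Set ℂ}

namespace IsDiskPacking

/-- Hölder continuity along the circles, in additive form. -/
theorem abs_sub_le (h : IsDiskPacking m₀ R₀ P K) {u : K → ℝ} (hu : u ∈ lipSpace K) (p : P)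
    {θ θ' : ℝ} (hθ : θ ∈ Icc 0 (2 * π)) (hθ' : θ' ∈ Icc 0 (2 * π)) {t : ℝ} (ht : 0 < t) :
    |u (h.circ p θ) - u (h.circ p θ')| ≤
      t / 2 * |θ - θ'| + h.arcEnergy u p / (2 * t) := by
  have hsub : uIoc θ' θ ⊆ Ioc 0 (2 * π) :=
    Ioc_subset_Ioc (le_min hθ'.1 hθ.1) (max_le hθ'.2 hθ.2)
  have h1 := h.integrableOn_sq_arcDeriv hu p
  have h2 : IntegrableOn (fun _ : ℝ => t / 2) (uIoc θ' θ) :=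
    integrableOn_const measure_Ioc_lt_top.ne
  have h3 := (h1.mono_set hsub).div_const (2 * t)
  have key := abs_sub_le_setIntegral (h.lipschitz_comp_circ hu.2.choose_spec p) subset_rfl
    (h2.add h3) (ae_of_all _ fun s => by
      set d := _root_.deriv (fun θ => u (h.circ p θ)) s with hd
      change |d| ≤ t / 2 + d ^ 2 / (2 * t)
      rw [← sub_nonneg]
      have : t / 2 + d ^ 2 / (2 * t) - |d| = (t - |d|) ^ 2 / (2 * t) := by
        rw [← sq_abs d]
        field_simp
        ring
      rw [this]
      positivity)
  refine key.trans ?_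
  simp only [Pi.add_apply]
  rw [integral_add h2 h3, setIntegral_const, integral_div, measureReal_def, Real.volume_uIoc,
    ENNReal.toReal_ofReal (abs_nonneg _), smul_eq_mul, mul_comm]
  gcongr
  exact setIntegral_mono_set h1 (ae_of_all _ fun _ => sq_nonneg _) hsub.eventuallyLE

theorem arcEnergy_le (h : IsDiskPacking m₀ R₀ P K) {u : K → ℝ} (hu : u ∈ lipSpace K) (p : P) :
    h.arcEnergy u p ≤ h.formNormSq u := by
  have h1 := le_hasSum (h.hasSum_formNormSq hu) p fun p' _ =>
    add_nonneg (h.arcEnergy_nonneg u p') (mul_nonneg (sq_nonneg _) (h.arcSq_nonneg u p'))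
  have h2 := mul_nonneg (sq_nonneg p.1.2) (h.arcSq_nonneg u p)
  linarith

theorem sq_mul_arcSq_le (h : IsDiskPacking m₀ R₀ P K) {u : K → ℝ} (hu : u ∈ lipSpace K) (p : P) :
    p.1.2 ^ 2 * h.arcSq u p ≤ h.formNormSq u := by
  have h1 := le_hasSum (h.hasSum_formNormSq hu) p fun p' _ =>
    add_nonneg (h.arcEnergy_nonneg u p') (mul_nonneg (sq_nonneg _) (h.arcSq_nonneg u p'))
  have h2 := h.arcEnergy_nonneg u p
  linarith

/-- A pointwise bound on the circles in terms of the form norm. -/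
theorem exists_bound (h : IsDiskPacking m₀ R₀ P K) (N : ℝ) (p : P) : ∃ B : ℝ, ∀ u ∈ lipSpace K,
    h.formNormSq u ≤ N → ∀ θ ∈ Icc 0 (2 * π), |u (h.circ p θ)| ≤ B := by
  have hR := h.pos p
  refine ⟨1 + (N / p.1.2 ^ 2 + 2 * π * (p.1.2 * (N / p.1.2 ^ 2) + N / p.1.2)) / (2 * π),
    fun u hu hN θ hθ => ?_⟩
  have h1 : h.arcSq u p ≤ N / p.1.2 ^ 2 := by
    rw [le_div_iff₀ (by positivity), mul_comm]
    exact (h.sq_mul_arcSq_le hu p).trans hN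
  have h2 := (h.arcEnergy_le hu p).trans hN
  have h3 : u (h.circ p θ) ^ 2 ≤
      (N / p.1.2 ^ 2 + 2 * π * (p.1.2 * (N / p.1.2 ^ 2) + N / p.1.2)) / (2 * π) := by
    rw [le_div_iff₀ Real.two_pi_pos, mul_comm]
    refine (h.sq_le hu p hθ).trans ?_
    gcongr
  refine le_trans ?_ (add_le_add_right h3 1)
  rw [← sq_abs]
  nlinarith [sq_nonneg (|u (h.circ p θ)| - 1), abs_nonneg (u (h.circ p θ))]

theorem norm_sq_eq_integral {u : K → ℝ} {f : Lp ℝ 2 (packMeasure P K)}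
    (hf : (f : K → ℝ) =ᵐ[packMeasure P K] u) : ‖f‖ ^ 2 = ∫ x, u x ^ 2 ∂(packMeasure P K) := by
  rw [← real_inner_self_eq_norm_sq, L2.inner_def]
  refine integral_congr_ae ?_
  filter_upwards [hf] with x hx
  rw [real_inner_self_eq_norm_sq, hx, Real.norm_eq_abs, sq_abs]

theorem normSq_eq (h : IsDiskPacking m₀ R₀ P K) {u : K → ℝ} (hu : u ∈ lipSpace K)
    {f : h.dirichletForm.dom}
    (hf : ((f : Lp ℝ 2 (packMeasure P K)) : K → ℝ) =ᵐ[packMeasure P K] u) :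
    h.dirichletForm.normSq f = h.formNormSq u := by
  rw [SymmForm.normSq, h.form_eq_energy hu hu hf hf, norm_sq_eq_integral hf, formNormSq]

theorem formNormSq_sub_le (h : IsDiskPacking m₀ R₀ P K) {u v : K → ℝ} (hu : u ∈ lipSpace K)
    (hv : v ∈ lipSpace K) :
    h.formNormSq (u - v) ≤ 2 * (h.formNormSq u + h.formNormSq v) := by
  obtain ⟨f, hf⟩ := h.exists_dom_of_mem hu
  obtain ⟨g, hg⟩ := h.exists_dom_of_mem hv
  have e : (((f - g : h.dirichletForm.dom) : Lp ℝ 2 (packMeasure P K)) : K → ℝ)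
      =ᵐ[packMeasure P K] u - v :=
    (Lp.coeFn_sub _ _).trans (hf.sub hg)
  rw [← h.normSq_eq (sub_mem hu hv) e, ← h.normSq_eq hu hf, ← h.normSq_eq hv hg, normSq_sub,
    SymmForm.normSq, SymmForm.normSq, form_self, form_self]
  have h1 := parallelogram_law_with_norm ℝ (h.grad f) (h.grad g)
  have h2 := parallelogram_law_with_norm ℝ (f : Lp ℝ 2 (packMeasure P K)) g
  nlinarith [sq_nonneg ‖h.grad f + h.grad g‖,
    sq_nonneg ‖(f : Lp ℝ 2 (packMeasure P K)) + (g : Lp ℝ 2 (packMeasure P K))‖]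

/-- If the values of two functions of bounded form norm are close at enough points of the circles,
then the functions are close in `L²`. -/
theorem exists_finset_integral_lt (h : IsDiskPacking m₀ R₀ P K) {ε : ℝ} (hε : 0 < ε) :
    ∃ (I : Finset (P × ℝ)) (η : ℝ), 0 < η ∧ (∀ i ∈ I, i.2 ∈ Icc 0 (2 * π)) ∧
      ∀ u ∈ lipSpace K, ∀ v ∈ lipSpace K, h.formNormSq u ≤ 2 → h.formNormSq v ≤ 2 →
        (∀ i ∈ I, |u (h.circ i.1 i.2) - v (h.circ i.1 i.2)| ≤ 2 * η) →
          ∫ x, (u x - v x) ^ 2 ∂(packMeasure P K) < ε := by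
  classical
  have hπ := Real.pi_pos
  set M := ∑' p : P, p.1.2 ^ 2 with hM
  have hM0 : 0 ≤ M := tsum_nonneg fun p => sq_nonneg _
  set δ := ε / (144 * π) with hδ
  set η := √(ε / (216 * π * (M + 1))) with hη
  have hδ0 : 0 < δ := by positivity
  have hη0 : 0 < η := Real.sqrt_pos.mpr (by positivity)
  have hη2 : 72 * π * η ^ 2 * M ≤ ε / 3 := by
    rw [hη, Real.sq_sqrt (by positivity)]
    calc 72 * π * (ε / (216 * π * (M + 1))) * M = ε / 3 * (M / (M + 1)) := by field_simp; ring
      _ ≤ ε / 3 * 1 := by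
          gcongr
          exact div_le_one_of_le₀ (by linarith) (by linarith)
      _ = ε / 3 := mul_one _
  -- Circles outside `S` are left to the tail estimate: the squared norm of `u - v` is at most 8,
  -- and `6 π δ · 8 = ε / 3`. On `S` the angles are sampled with mesh `2 η²`.
  obtain ⟨S, hS⟩ := summable_iff_vanishing_norm.mp h.summable_sq (δ ^ 2) (by positivity)
  obtain ⟨T, hTsub, hTfin, hT⟩ := (isCompact_Icc (a := (0 : ℝ)) (b := 2 * π)).finite_cover_balls
    (e := 2 * η ^ 2) (by positivity)
  refine ⟨S ×ˢ hTfin.toFinset, η, hη0, fun i hi => ?_, fun u hu v hv hu2 hv2 huv => ?_⟩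
  · rw [Finset.mem_product, Finite.mem_toFinset] at hi
    exact hTsub hi.2
  have hw := sub_mem hu hv
  have hN : h.formNormSq (u - v) ≤ 8 := (h.formNormSq_sub_le hu hv).trans (by linarith)
  -- The choice `t = 1/η` in `abs_sub_le` balances the two terms, each being at most `η`. With the
  -- closeness at the sample points, `u` and `v` then differ by at most `6 η` on the circles of `S`.
  have hosc : ∀ w ∈ lipSpace K, h.formNormSq w ≤ 2 → ∀ p : P, ∀ θ ∈ Icc 0 (2 * π),
      ∀ t ∈ Icc 0 (2 * π), |θ - t| < 2 * η ^ 2 →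
        |w (h.circ p θ) - w (h.circ p t)| ≤ 2 * η := by
    intro w hw hw2 p θ hθ t ht hd
    have h1 := h.abs_sub_le hw p hθ ht (t := 1 / η) (by positivity)
    have h2 := (h.arcEnergy_le hw p).trans hw2
    refine h1.trans ?_
    calc 1 / η / 2 * |θ - t| + h.arcEnergy w p / (2 * (1 / η))
        ≤ 1 / η / 2 * (2 * η ^ 2) + 2 / (2 * (1 / η)) := by gcongr
      _ = 2 * η := by field_simp; ring
  have hclose : ∀ p ∈ S, h.arcSq (u - v) p ≤ 72 * π * η ^ 2 := by
    intro p hp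
    have h1 : ∀ θ ∈ Ioc 0 (2 * π), (u - v) (h.circ p θ) ^ 2 ≤ (6 * η) ^ 2 := by
      intro θ hθ
      have hθ' := Ioc_subset_Icc_self hθ
      obtain ⟨t, ht, hd⟩ := mem_iUnion₂.mp (hT hθ')
      rw [Metric.mem_ball, Real.dist_eq] at hd
      have a1 := hosc u hu hu2 p θ hθ' t (hTsub ht) hd
      have a2 := hosc v hv hv2 p θ hθ' t (hTsub ht) hd
      have a3 := huv (p, t) (Finset.mem_product.mpr ⟨hp, hTfin.mem_toFinset.mpr ht⟩)
      rw [abs_le] at a1 a2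
      dsimp only at a3
      rw [abs_le] at a3
      refine sq_le_sq' ?_ ?_ <;> rw [Pi.sub_apply] <;> linarith
    have h2 := setIntegral_mono_on (h.integrableOn_sq hw p)
      (integrableOn_const (C := (6 * η) ^ 2) measure_Ioc_lt_top.ne) measurableSet_Ioc h1
    rw [setIntegral_const, smul_eq_mul, Real.volume_real_Ioc_of_le Real.two_pi_pos.le,
      sub_zero] at h2
    refine h2.trans (le_of_eq ?_)
    ring
  have hsum := h.hasSum_arcSq hw
  simp only [Pi.sub_apply] at hsum
  rw [← hsum.tsum_eq]
  refine lt_of_le_of_lt (hsum.summable.tsum_le_of_sum_le (a₂ := ε / 3 + ε / 3) fun F => ?_)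
    (by linarith)
  rw [← Finset.sum_inter_add_sum_sdiff F S]
  refine add_le_add ?_ ?_
  · calc ∑ p ∈ F ∩ S, p.1.2 ^ 2 * h.arcSq (u - v) p
        ≤ ∑ p ∈ F ∩ S, p.1.2 ^ 2 * (72 * π * η ^ 2) := by
          refine Finset.sum_le_sum fun p hp => ?_
          have := hclose p (Finset.mem_inter.mp hp).2
          gcongr
      _ = 72 * π * η ^ 2 * ∑ p ∈ F ∩ S, p.1.2 ^ 2 := by rw [← Finset.sum_mul, mul_comm]
      _ ≤ 72 * π * η ^ 2 * M := by
          gcongr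
          exact h.summable_sq.sum_le_tsum _ fun p _ => sq_nonneg _
      _ ≤ ε / 3 := hη2
  · have h1 := (hS (F \ S) Finset.sdiff_disjoint).le
    have h2 := h.tail_estimate hw hδ0.le ((le_abs_self _).trans h1)
    refine h2.trans ?_
    calc 6 * π * δ * h.formNormSq (u - v) ≤ 6 * π * δ * 8 := by gcongr
      _ = ε / 3 := by rw [hδ]; field_simp; norm_num

/-- Sample values at finitely many points range over a compact cube by `exists_bound`; functions
sharing a member of a finite `η`-net of this cube are `ε`-close in `L²`. -/
theorem totallyBounded_lip (h : IsDiskPacking m₀ R₀ P K) :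
    TotallyBounded {f : Lp ℝ 2 (packMeasure P K) |
      ∃ u ∈ lipSpace K, (f : K → ℝ) =ᵐ[packMeasure P K] u ∧ h.formNormSq u ≤ 2} := by
  refine Metric.totallyBounded_of_finite_discretization fun ε hε => ?_
  obtain ⟨I, η, hη, hI, key⟩ := h.exists_finset_integral_lt (ε := ε ^ 2) (by positivity)
  choose B hB using h.exists_bound 2
  set A : Set (I → ℝ) := Set.pi univ fun i => Icc (-B i.1.1) (B i.1.1) with hA
  obtain ⟨T, -, hTfin, hT⟩ := (isCompact_univ_pi fun i : I =>
    isCompact_Icc (a := -B i.1.1) (b := B i.1.1)).finite_cover_balls hη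
  have hval : ∀ u ∈ lipSpace K, h.formNormSq u ≤ 2 →
      ∃ t : T, dist (fun i : I => u (h.circ i.1.1 i.1.2)) t < η := by
    intro u hu hu2
    have h1 : (fun i : I => u (h.circ i.1.1 i.1.2)) ∈ A := fun i _ =>
      abs_le.mp (hB i.1.1 u hu hu2 i.1.2 (hI i.1 i.2))
    obtain ⟨t, ht, hd⟩ := mem_iUnion₂.mp (hT h1)
    exact ⟨⟨t, ht⟩, hd⟩
  choose U hU using fun f : {f : Lp ℝ 2 (packMeasure P K) |
      ∃ u ∈ lipSpace K, (f : K → ℝ) =ᵐ[packMeasure P K] u ∧ h.formNormSq u ≤ 2} => f.2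
  choose F hF using fun f => hval (U f) (hU f).1 (hU f).2.2
  refine ⟨T, hTfin.fintype, F, fun f g hfg => ?_⟩
  have h1 := key (U f) (hU f).1 (U g) (hU g).1 (hU f).2.2 (hU g).2.2 fun i hi => by
    have h2 := (dist_triangle_right _ _ _).trans_lt
      (add_lt_add (hF f) (by rw [hfg]; exact hF g : dist _ ((F f : T) : I → ℝ) < η))
    have h3 := (dist_le_pi_dist _ _ ⟨i, hi⟩).trans h2.le
    rw [Real.dist_eq] at h3
    linarith
  have h4 := norm_sq_eq_integral (f := (f : Lp ℝ 2 (packMeasure P K)) - (g : Lp ℝ 2 (packMeasure P K))) (u := U f - U g)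
    ((Lp.coeFn_sub _ _).trans ((hU f).2.1.sub (hU g).2.1))
  simp only [Pi.sub_apply] at h4
  rw [← h4] at h1
  rw [dist_eq_norm]
  exact lt_of_pow_lt_pow_left₀ 2 hε.le h1

/-- The unit ball of the form norm lies in the `L²` closure of the Lipschitz functions with squared
norm at most 2; the slack between 1 and 2 absorbs the approximation error. -/
theorem hasCompactInclusion (h : IsDiskPacking m₀ R₀ P K) :
    h.dirichletForm.HasCompactInclusion := by
  have hsub : (fun f : h.dirichletForm.dom => (f : Lp ℝ 2 (packMeasure P K))) ''
      {f | h.dirichletForm.normSq f ≤ 1} ⊆ closure {f : Lp ℝ 2 (packMeasure P K) |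
        ∃ u ∈ lipSpace K, (f : K → ℝ) =ᵐ[packMeasure P K] u ∧ h.formNormSq u ≤ 2} := by
    rintro _ ⟨f, hf, rfl⟩
    obtain ⟨y, u, hu, e1, -, hy, l1, l2, -⟩ := h.exists_seq (h.mk_grad_mem f)
    refine mem_closure_of_tendsto l1 ?_
    have h3 := (l2.norm.pow 2).add (l1.norm.pow 2)
    have h4 : ‖h.grad f‖ ^ 2 + ‖(f : Lp ℝ 2 (packMeasure P K))‖ ^ 2 < 2 := by
      have : h.dirichletForm.normSq f ≤ 1 := hf
      rw [SymmForm.normSq, form_self] at this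
      linarith
    filter_upwards [h3.eventually_lt_const h4] with n hn
    obtain ⟨g, e3, e4⟩ := h.exists_eq_grad (subset_closure (hy n))
    have e5 : ((g : Lp ℝ 2 (packMeasure P K)) : K → ℝ) =ᵐ[packMeasure P K] u n := by
      rw [e3]; exact e1 n
    refine ⟨u n, hu n, e1 n, ?_⟩
    rw [← h.normSq_eq (hu n) e5, SymmForm.normSq, form_self, e3, e4]
    exact hn.le
  exact (h.totallyBounded_lip.closure.subset hsub).closure.isCompact_of_isClosed isClosed_closure

end IsDiskPacking

end RoundCarpet

/-! ### Application of the packing results to the carpets -/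

theorem mainTheorem8 (q : ℕ) (hq : 6 < q) (g : Equiv.Perm (OnePoint ℂ))
    (hg : g ∈ RoundCarpet.shapes) :
    -- every member of `𝓓_g` is a bounded open disk whose boundary circle lies in `K_g`
    (∀ D ∈ RoundCarpet.diskFamily q g, ∃ (c : ℂ) (R : ℝ), 0 < R ∧
      D = (fun z : ℂ => (z : OnePoint ℂ)) '' Metric.ball c R ∧
      Metric.sphere c R ⊆ RoundCarpet.carpet q g) ∧
    -- `K_g` is locally compact and `μ^g` is a finite measure with full support
    LocallyCompactSpace (RoundCarpet.carpet q g) ∧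
    IsFiniteMeasure (RoundCarpet.carpetMeasure q g) ∧
    (RoundCarpet.carpetMeasure q g).IsOpenPosMeasure ∧
    -- the integrals and the sum that define `𝓔^g` on `𝓒_g` converge absolutely
    (∀ u ∈ RoundCarpet.lipFunctions q g, ∀ v ∈ RoundCarpet.lipFunctions q g,
      (∀ p ∈ RoundCarpet.diskParams q g,
        Integrable (RoundCarpet.energyDensity u v p.1 p.2)
          (RoundCarpet.circleLength p.1 p.2)) ∧
      Summable fun p : RoundCarpet.diskParams q g =>
        RoundCarpet.circleEnergy u v p.1.1 p.1.2) ∧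
    -- closability, and the properties of the smallest closed extension
    DirichletForm.Closable (RoundCarpet.carpetMeasure q g) (RoundCarpet.lipFunctions q g)
      (RoundCarpet.carpetForm q g) ∧
    ∃ 𝓔 : DirichletForm.SymmForm (RoundCarpet.carpetMeasure q g),
      𝓔.IsSmallestClosedExtension (RoundCarpet.lipFunctions q g) (RoundCarpet.carpetForm q g) ∧
      𝓔.IsDirichlet ∧ 𝓔.IsRegular ∧ 𝓔.IsStronglyLocal ∧ 𝓔.HasCompactInclusion := by
  obtain ⟨hdisk, m₀, R₀, h⟩ := RoundCarpet.carpet_isDiskPacking hq hg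
  -- For `P = diskParams q g` the space `lipSpace` and the measure `packMeasure` unfold to
  -- `lipFunctions` and `carpetMeasure`; only the form, given as a series, has to be identified with
  -- the energy integral.
  have hE : ∀ u ∈ RoundCarpet.lipSpace (RoundCarpet.carpet q g),
      ∀ v ∈ RoundCarpet.lipSpace (RoundCarpet.carpet q g),
        RoundCarpet.carpetForm q g u v = h.energy u v := by
    rintro u ⟨-, L, hL⟩ v ⟨-, M, hM⟩
    exact (h.hasSum_circleEnergy hL hM).tsum_eq
  refine ⟨hdisk, h.locallyCompactSpace, h.isFiniteMeasure, h.isOpenPosMeasure, ?_, h.closable hE,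
    h.dirichletForm, h.isSmallestClosedExtension hE, ⟨h.isClosedForm, h.isMarkovian⟩, h.isRegular,
    h.isStronglyLocal, h.hasCompactInclusion⟩
  rintro u ⟨-, L, hL⟩ v ⟨-, M, hM⟩
  exact ⟨fun p hp => h.integrable_energyDensity hL hM ⟨p, hp⟩, (h.hasSum_circleEnergy hL hM).summable⟩
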